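/- Let $p$ be an odd prime, let $K=\mathbb{Q}_q$ be a finite unramified extension of $\mathbb{Q}_p$ with ring of integers $\mathbb{Z}_q$, Frobenius automorphism $\sigma$ and valuation $\mathrm{ord}$, $\mathrm{ord}\,p=1$. Let $g\ge 1$ and let $Q(X,\Gamma)\in\mathbb{Z}_q[X,\Gamma]$ be monic of degree $2g+1$ in $X$ and of degree $\kappa$ in $\Gamma$, such that its reduction $\bar Q$ modulo $p$ also has degree $\kappa$ in $\Gamma$. Let $Q'=\partial Q/\partial X$ and let $r(\Gamma)=\mathrm{Res}_X(Q,Q')$; assume that $\bar Q(X,0)$ has no double roots, that is, $r(0)\in\mathbb{Z}_q^\times$. Let $\rho'$ be the largest index with $\mathrm{ord}(r_{\rho'})=0$, where $r=\sum_i r_i\Gamma^i$, and let $R(\Gamma)=\sum_{i\le\rho'}r_i\Gamma^i$. Let $S=\mathbb{Q}_q[\Gamma,1/R(\Gamma)]^\dagger$ be the ring of all series $s=\sum_{i\ge0}a_i\Gamma^i+\sum_{j\ge1}b_j(\Gamma)/R(\Gamma)^j$ with $a_i\in\mathbb{Q}_q$, $b_j\in\mathbb{Q}_q[\Gamma]$,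 $\deg b_j<\rho'$, $\liminf_i \mathrm{ord}(a_i)/i>0$ and $\liminf_j\mathrm{ord}(b_j)/j>0$, where the order of a polynomial is the minimum of the orders of its coefficients. The order $\mathrm{ord}(s)$ is the minimum of all $\mathrm{ord}(a_i)$, $\mathrm{ord}(b_j)$, and $s\equiv s' \bmod p^N$ means $\mathrm{ord}(s-s')\ge N$. Since $R(0)$ is a unit, $S\subset\mathbb{Q}_q[[\Gamma]]$. Let $T$ be the $S$-module of all series $\sum_{k\in\mathbb{Z}}\sum_{m=0}^{2g}s_{mk}X^m/\sqrt{Q}^{\,k}$ with $s_{mk}\in S$ for which there are $\delta>0$ and $c\in\mathbb{R}$ such that the $i$-th (respectively $j$-th) coefficients $a_i$ and $b_j$ of $s_{mk}$ have order at least $\delta(|k|+i)-c$ (respectively $\delta(|k|+j)-c$) for all $m,k,i,j$. Let $T_-\subset T$ be the part where only odd $k$ occur, let $d=\frac{\partial}{\partial X}dX:T\to T\,dX$ and $H^-_{MW}=T_-dX/d(T_-)$, and put $\omega_i=X^i\,dX/\sqrt Q$ for $0\le i\le 2g-1$. Let $F_p$ be the $\sigma$-semilinear Frobenius lift given by $$\Gamma\mapsto\Gamma^p,\quad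 X\mapsto X^p,\quad dX\mapsto pX^{p-1}dX,\quad \sqrt{Q}\mapsto Q^{p/2}\left(1-\frac{Q^p-Q^\sigma(X^p,\Gamma^p)}{Q^p}\right)^{1/2},$$ and let $F(\Gamma)=(F_{il})$ be its matrix on $H^-_{MW}$: its entries lie in $S$ and $F_p(\omega_i)\equiv\sum_{l=0}^{2g-1}F_{il}\omega_l$ modulo $d(T_-)$ for all $i$. Let $N\in\mathbb{N}$ with $N\ge(pg-4)/2$, and put $\chi_1=p(2N+4)+(p-1)/2$ and $\chi_2=(2N+5)(8g+2)\kappa p+1$. Let $f(\Gamma)$ be an entry of $F(\Gamma)$ reduced modulo $p^N$, that is, $f\in S$ is congruent to this entry modulo $p^N$. Then, modulo $p^N$, $r(\Gamma)^{\chi_1}f(\Gamma)$ is a polynomial over $\mathbb{Q}_q$ in $\Gamma$ of degree at most $\chi_2$. Moreover, $\mathrm{ord}(f(\Gamma))\ge-(\log_p g+2)$. -/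

import Mathlib

open Polynomial

namespace HyperellipticFamily

noncomputable section

/-! Polynomials in `X, Γ` over `K` are elements of `K[X][X]`: the outer variable is `X` and the inner
variable is `Γ`.  The valuation is `ord x = -log_p ‖x‖`, so `ord x ≥ c` reads `‖x‖ ≤ p ^ (-c)`. -/

/-- A finite extension `K` of `ℚ_p` (with the norm extending the `p`-adic one) is unramified:
`p` generates the maximal ideal of its valuation ring. -/
def IsUnramified (p : ℕ) (K : Type*) [NormedField K] : Prop :=
  ∀ x : K, ‖x‖ < 1 → ‖x‖ ≤ (p : ℝ)⁻¹

/-- `σ` is the Frobenius automorphism of the unramified field `K`: on the residue field it induces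
`x ↦ x ^ p`. -/
def IsFrobenius (p : ℕ) [Fact p.Prime] {K : Type*} [NormedField K] [NormedAlgebra ℚ_[p] K]
    (σ : K ≃ₐ[ℚ_[p]] K) : Prop :=
  ∀ x : K, ‖x‖ ≤ 1 → ‖σ x - x ^ p‖ < 1

section Base

variable {K : Type*} [NormedField K]

/-- The degree `κ` of `Q` in `Γ`. -/
def degΓ (Q : K[X][X]) : ℕ :=
  Q.support.sup fun i => (Q.coeff i).natDegree

/-- The resultant `r(Γ) = Res_X(Q, ∂Q/∂X)`. -/
def res (Q : K[X][X]) : K[X] :=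
  resultant Q (derivative Q)

/-- `Q` is a lift to characteristic zero, of the same degrees in `X` and `Γ`, of a polynomial
`Q̄(X, Γ)` over the residue field that is monic of degree `2g + 1` in `X` and for which `Q̄(X, 0)`
has no double root, that is, `r(0)` is nonzero modulo `p`. -/
structure IsFamily (g : ℕ) (Q : K[X][X]) : Prop where
  monic : Q.Monic
  natDegree_eq : Q.natDegree = 2 * g + 1
  integral : ∀ i j, ‖(Q.coeff i).coeff j‖ ≤ 1
  degree_preserving : ∃ i, ‖(Q.coeff i).coeff (degΓ Q)‖ = 1
  res_zero : ‖(res Q).eval 0‖ = 1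

/-- The largest index of a coefficient of order `0`. -/
def unitDegree (r : K[X]) : ℕ :=
  (r.support.filter fun i => ‖r.coeff i‖ = 1).sup id

/-- The polynomial `R(Γ)`: the polynomial `r(Γ)` cut off after its last coefficient of order `0`. -/
def unitPart (r : K[X]) : K[X] :=
  ∑ i ∈ Finset.range (unitDegree r + 1), monomial i (r.coeff i)

/-- The series `s` has the expansion `s = ∑_{i ≥ 0} a_i Γ^i + ∑_{j ≥ 0} b_j(Γ) / R(Γ)^(j+1)` with
`deg b_j < deg R`, where `ord a_i` and `ord b_j` grow at least linearly, with constants `C` and `θ`.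
Everything is seen in `K⟦Γ⟧`, where `R` is invertible as `R(0)` is a unit; the infinite sum converges
`p`-adically in each power of `Γ`. The expansion of a given `s` is unique. -/
structure HasExpansion (R : K[X]) (C θ : ℝ) (a : ℕ → K) (b : ℕ → K[X]) (s : PowerSeries K) :
    Prop where
  degree_lt : ∀ j, (b j).degree < (R.natDegree : WithBot ℕ)
  hasSum : ∀ n, HasSum
    (fun j => PowerSeries.coeff n ((b j : PowerSeries K) * ((R : PowerSeries K)⁻¹) ^ (j + 1)))
    (PowerSeries.coeff n s - a n)
  norm_a_le : ∀ i, ‖a i‖ ≤ C * θ ^ i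
  norm_b_le : ∀ j m, ‖(b j).coeff m‖ ≤ C * θ ^ (j + 1)

/-- The base ring `S = K[Γ, 1/R(Γ)]†`, as a subset of `K⟦Γ⟧`. -/
def S (R : K[X]) : Set (PowerSeries K) :=
  {s | ∃ C θ : ℝ, 0 < θ ∧ θ < 1 ∧ ∃ a b, HasExpansion R C θ a b s}

/-- `s` is an element of `S` with `ord s ≥ c`; the order of `s` is the minimum of the orders of the
coefficients `a_i` and `b_j` of its expansion. -/
def OrdGE (p : ℕ) (R : K[X]) (c : ℝ) (s : PowerSeries K) : Prop :=
  ∃ C θ : ℝ, 0 < θ ∧ θ < 1 ∧ ∃ a b, HasExpansion R C θ a b s ∧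
    (∀ i, ‖a i‖ ≤ (p : ℝ) ^ (-c)) ∧ ∀ j m, ‖(b j).coeff m‖ ≤ (p : ℝ) ^ (-c)

/-- Congruence modulo `p ^ N` in `S`. -/
def CongrModPow (p : ℕ) (R : K[X]) (N : ℕ) (s s' : PowerSeries K) : Prop :=
  OrdGE p R N (s - s')

/-! An element `∑_{k ∈ ℤ} t_k(X, Γ) / √Q ^ k` of `T`, with `t_k` of degree at most `2g` in `X`, is
given by the family `t : ℤ → K⟦Γ⟧[X]`.  Elements `∑ (t_k / √Q ^ k) dX` of `T dX` are given by the
same data. -/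

/-- `Q` as a polynomial in `X` over `K⟦Γ⟧`. -/
def toSeries (Q : K[X][X]) : (PowerSeries K)[X] :=
  Q.map coeToPowerSeries.ringHom

/-- The `S`-module `T`: all coefficients lie in `S`, and their expansions tend to `0` linearly,
jointly in `|k|` and in the index of the expansion. -/
def T (g : ℕ) (Q : K[X][X]) : Set (ℤ → (PowerSeries K)[X]) :=
  {t | (∀ k, (t k).natDegree ≤ 2 * g) ∧ ∃ C θ : ℝ, 0 < θ ∧ θ < 1 ∧ ∀ k m,
    ∃ a b, HasExpansion (unitPart (res Q)) (C * θ ^ k.natAbs) θ a b ((t k).coeff m)}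

/-- The part `T₋` of `T` on which the hyperelliptic involution `√Q ↦ -√Q` is `-1`. -/
def Tminus (g : ℕ) (Q : K[X][X]) : Set (ℤ → (PowerSeries K)[X]) :=
  {t | t ∈ T g Q ∧ ∀ k, Even k → t k = 0}

/-- The differential `d = (∂/∂X) dX : T → T dX`.  As `(√Q)' = Q' / (2 √Q)`,
`d(t_k / √Q^k) = t_k' / √Q^k - (k/2) t_k Q' / √Q^(k+2)`, and dividing `t_k Q'` by `Q` with quotient
`u` and remainder `v` turns the last fraction into `u / √Q^k + v / √Q^(k+2)`. -/
def d (Q : K[X][X]) (t : ℤ → (PowerSeries K)[X]) : ℤ → (PowerSeries K)[X] :=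
  let Q₁ := toSeries Q
  let h : ℤ → (PowerSeries K)[X] := fun k => C (PowerSeries.C ((k : K) / 2)) * (t k * derivative Q₁)
  fun k => derivative (t k) - h k /ₘ Q₁ - h (k - 2) %ₘ Q₁

/-- The fraction `B / √Q^m`, with `B ∈ K⟦Γ⟧[X]`, written as `∑ t_k / √Q^k` with `deg_X t_k ≤ 2g`:
if `B = ∑ B_j Q^j` is the expansion of `B` in base `Q` then `t_(m - 2j) = B_j`. -/
def frac (Q : K[X][X]) (B : (PowerSeries K)[X]) (m : ℤ) : ℤ → (PowerSeries K)[X] :=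
  fun k => if k ≤ m ∧ Even (m - k) then
    (B /ₘ toSeries Q ^ ((m - k) / 2).toNat) %ₘ toSeries Q else 0

/-- The element `b_i = X^i dX / √Q` of `T dX`. -/
def basisForm (i : ℕ) : ℤ → (PowerSeries K)[X] :=
  fun k => if k = 1 then X ^ i else 0

end Base

section Frobenius

variable (p : ℕ) [Fact p.Prime] {K : Type*} [NormedField K] [NormedAlgebra ℚ_[p] K]

/-- The `σ`-linear substitution `X ↦ X^p`, `Γ ↦ Γ^p` on `K⟦Γ⟧[X]`. -/
def frobPoly (σ : K ≃ₐ[ℚ_[p]] K) (B : (PowerSeries K)[X]) : (PowerSeries K)[X] :=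
  Polynomial.expand (PowerSeries K) p
    (B.map ((PowerSeries.expand p (Fact.out : p.Prime).ne_zero).toRingHom.comp
      (PowerSeries.map (σ : K →+* K))))

/-- The polynomial `Q^σ(X^p, Γ^p) - Q(X, Γ)^p`. -/
def frobError (σ : K ≃ₐ[ℚ_[p]] K) (Q : K[X][X]) : (PowerSeries K)[X] :=
  frobPoly p σ (toSeries Q) - toSeries Q ^ p

/-- The `n`-th term of the image of `(t / √Q^k) dX` under the Frobenius lift.  By definition
`X ↦ X^p`, `dX ↦ p X^(p-1) dX` and `√Q ↦ Q^(p/2) (1 + E / Q^p)^(1/2)` with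
`E = Q^σ(X^p, Γ^p) - Q^p`, so that `√Q^(-k)` is mapped to
`∑_n binom(-k/2, n) E^n / √Q^(pk + 2pn)`. -/
def frobTerm (σ : K ≃ₐ[ℚ_[p]] K) (Q : K[X][X]) (t : (PowerSeries K)[X]) (k : ℤ) (n : ℕ) :
    ℤ → (PowerSeries K)[X] :=
  frac Q
    (C (PowerSeries.C ((Ring.choose (-(k : ℚ) / 2) n : ℚ) : K)) *
      (frobPoly p σ t * ((p : (PowerSeries K)[X]) * X ^ (p - 1)) * frobError p σ Q ^ n))
    (p * k + 2 * p * n)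

/-- The Frobenius lift `F_p` on `T dX`.  The sum over `k` and `n` is taken `p`-adically in each
coefficient. -/
def frob (g : ℕ) (σ : K ≃ₐ[ℚ_[p]] K) (Q : K[X][X]) (t : ℤ → (PowerSeries K)[X]) :
    ℤ → (PowerSeries K)[X] :=
  fun m => ∑ i ∈ Finset.range (2 * g + 1), monomial i
    (PowerSeries.mk fun e =>
      ∑' x : ℤ × ℕ, PowerSeries.coeff e ((frobTerm p σ Q (t x.1) x.1 x.2 m).coeff i))

/-- `F` is the matrix of `F_p` on `H_MW⁻ = T₋ dX / d(T₋)` with respect to the basis `b_i`: its entries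
lie in `S`, and `F_p(b_i) = ∑_l F_il b_l` modulo `d(T₋)`. -/
structure IsFrobeniusMatrix (g : ℕ) (σ : K ≃ₐ[ℚ_[p]] K) (Q : K[X][X])
    (F : Matrix (Fin (2 * g)) (Fin (2 * g)) (PowerSeries K)) : Prop where
  mem_S : ∀ i l, F i l ∈ S (unitPart (res Q))
  frob_eq : ∀ i : Fin (2 * g), ∃ t ∈ Tminus g Q, ∀ k,
    frob p g σ Q (basisForm (i : ℕ)) k = (∑ l : Fin (2 * g), C (F i l) * basisForm (l : ℕ) k) + d Q t k

end Frobenius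

end

end HyperellipticFamily

namespace HyperellipticFamily

noncomputable section

open scoped NNReal

/-! ### Division by a monic polynomial and coefficientwise conditions -/

section Division

variable {A : Type*} [CommRing A]

/-! Estimates are made in `K⟦Γ⟧` with the Gauss norm. As `R` has unit leading and constant
coefficients, the order on `S` is the one given by this norm, and in `K⟦Γ⟧` the resultant `r` is an
integral unit.

The `n`-th term of the Frobenius series of `ω_i` has norm at most `p^-(n+1)` and involves only
`√Q^-k` with `|k| ≤ p(2n+1)`. Against this gain stands the cost of reduction to the basis: if `∑ W_k
/ √Q^k dX = ∑ c_l ω_l + dt` and each `W_k` has norm at most `β / ((2g+1)(|k|+2))`, then each `c_l`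
has norm at most `β` (`mem_gauss_of_eq_add_d`). The loss is linear in `|k|`, hence logarithmic in
valuation: although many integers are divided by in succession, the denominators do not multiply. At
the poles `Q = 0`, the base-`Q` digits of the primitive are peeled off in the form `g(ξ)`, where `ξ`
is a Hensel lift of the root `X` of `Q` modulo `Q`. Then `ξ' ≡ 0` modulo a high power of `Q`, so
`g(ξ)` behaves like a constant and is divided by a single odd integer (`exists_mem_pgauss_of_conn`).
At infinity the primitive is expanded along elements `η √Q` close to `X^(e+g+1/2)`, again with a
single odd integer for each (`mem_pgauss_of_conn_infinity`).

Applied to the whole series this bounds the matrix by `g p^2`, which is the statement on the order.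
Applied to the terms `n ≥ 2N+5` it gives an error at most `p^-N`, as `pg ≤ 2N+4`.

The terms `n ≤ 2N+4` have the common denominator `√Q^(2χ₁+1)`. Lowering the pole by one power of `Q`
uses `r A = Q u + Q' v`, and costs one factor `r` and at most `(4g+1)κ` in the degree in `Γ`. At
infinity the degree is controlled by a weight, `1` for `Γ` and `κ` for `X`, for which `Q` is no
heavier than its leading monomial. Hence `r^χ₁` times the coordinates of the finite part is
polynomial with the stated degree (`IsFamily.exists_reduction`). -/

lemma exists_div_mod_coeff_mem {Q : A[X]} (hQ : Q.Monic) (M : ℕ → AddSubgroup A)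
    (hM : ∀ j i, i < Q.natDegree → ∀ a ∈ M (j + Q.natDegree), a * Q.coeff i ∈ M (j + i))
    [Nontrivial A] (n : ℕ) : ∀ P : A[X], P.natDegree < n → (∀ j, P.coeff j ∈ M j) →
    ∃ q r : A[X], r + Q * q = P ∧ r.degree < Q.degree ∧
      (∀ j, q.coeff j ∈ M (j + Q.natDegree)) ∧ ∀ j, r.coeff j ∈ M j := by
  induction n with
  | zero => intro P h; omega
  | succ n ih =>
    intro P hn hP
    by_cases hlt : P.degree < Q.degree
    · exact ⟨0, P, by simp, hlt, fun j => by simp [(M _).zero_mem], hP⟩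
    have hd : Q.natDegree ≤ P.natDegree := natDegree_le_natDegree (not_lt.1 hlt)
    obtain ⟨e, he⟩ := Nat.exists_eq_add_of_le' hd
    set a := P.leadingCoeff with ha
    have haM : a ∈ M (e + Q.natDegree) := by rw [← he]; exact hP _
    -- The one multiple of `Q` subtracted in a step of the long division obeys the same coefficient
    -- conditions: this is `hM` below the leading term, and the choice of `a` at it.
    have hT : ∀ j, (monomial e a * Q).coeff j ∈ M j := by
      intro j
      rw [← C_mul_X_pow_eq_monomial, mul_assoc, coeff_C_mul, coeff_X_pow_mul', mul_ite, mul_zero]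
      split_ifs with hej
      · obtain ⟨i, rfl⟩ := Nat.exists_eq_add_of_le hej
        rw [Nat.add_sub_cancel_left]
        rcases lt_trichotomy i Q.natDegree with hi | hi | hi
        · exact hM e i hi a haM
        · rw [hi, hQ.coeff_natDegree, mul_one]; exact haM
        · rw [coeff_eq_zero_of_natDegree_lt hi, mul_zero]; exact (M _).zero_mem
      · exact (M _).zero_mem
    have hP' : ∀ j, (P - monomial e a * Q).coeff j ∈ M j := fun j => by
      rw [coeff_sub]; exact (M j).sub_mem (hP j) (hT j)
    have hP0 : P ≠ 0 := by
      rintro rfl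
      apply hlt; rw [degree_zero, bot_lt_iff_ne_bot, Ne, degree_eq_bot]; exact hQ.ne_zero
    have hdeg : (P - monomial e a * Q).degree < P.degree := by
      have hlead : (monomial e a * Q).leadingCoeff = a := by
        rw [leadingCoeff_mul_monic hQ, leadingCoeff_monomial]
      refine degree_sub_lt_left ?_ hP0 (by rw [hlead])
      rw [degree_mul' (by rw [leadingCoeff_monomial, hQ.leadingCoeff, mul_one, ha]; exact leadingCoeff_ne_zero.2 hP0), degree_monomial _ (leadingCoeff_ne_zero.2 hP0),
        degree_eq_natDegree hQ.ne_zero, degree_eq_natDegree hP0, he]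
      rfl
    by_cases hz : P - monomial e a * Q = 0
    · refine ⟨monomial e a, 0, by linear_combination -hz, ?_, fun j => ?_, fun j => by simp [(M _).zero_mem]⟩
      · rw [degree_zero, bot_lt_iff_ne_bot, Ne, degree_eq_bot]; exact hQ.ne_zero
      · rw [coeff_monomial]; split_ifs with h
        · rw [← h]; exact haM
        · exact (M _).zero_mem
    obtain ⟨q, r, h1, h2, h3, h4⟩ := ih _ (by
      have := natDegree_lt_natDegree hz hdeg
      omega) hP'
    refine ⟨q + monomial e a, r, by linear_combination h1, h2, fun j => ?_, h4⟩
    rw [coeff_add, coeff_monomial]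
    refine (M _).add_mem (h3 j) ?_
    split_ifs with h
    · rw [← h]; exact haM
    · exact (M _).zero_mem

/-- With `M` constant this says that division by an integral monic polynomial does not increase
Gauss norms; with `M` depending on the index it controls weights. -/
lemma coeff_div_mod_mem [Nontrivial A] {Q : A[X]} (hQ : Q.Monic) (M : ℕ → AddSubgroup A)
    (hM : ∀ j i, i < Q.natDegree → ∀ a ∈ M (j + Q.natDegree), a * Q.coeff i ∈ M (j + i))
    {P : A[X]} (hP : ∀ j, P.coeff j ∈ M j) :
    (∀ j, (P /ₘ Q).coeff j ∈ M (j + Q.natDegree)) ∧ ∀ j, (P %ₘ Q).coeff j ∈ M j := by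
  obtain ⟨q, r, h1, h2, h3, h4⟩ :=
    exists_div_mod_coeff_mem hQ M hM (P.natDegree + 1) P (Nat.lt_succ_self _) hP
  obtain ⟨e1, e2⟩ := div_modByMonic_unique q r hQ ⟨h1, h2⟩
  rw [e1, e2]
  exact ⟨h3, h4⟩

end Division

/-! ### Gauss norms -/

section Gauss

variable {K : Type*} [NormedField K] [IsUltrametricDist K]

/-- The closed ball of radius `c`. -/
def ball (K : Type*) [NormedField K] [IsUltrametricDist K] (c : ℝ≥0) : AddSubgroup K where
  carrier := {x | ‖x‖₊ ≤ c}
  zero_mem' := by simp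
  add_mem' {x y} hx hy := (IsUltrametricDist.nnnorm_add_le_max x y).trans (max_le hx hy)
  neg_mem' {x} hx := by simpa using hx

lemma mem_ball {c : ℝ≥0} {x : K} : x ∈ ball K c ↔ ‖x‖₊ ≤ c := Iff.rfl

lemma mul_mem_ball {a b : ℝ≥0} {x y : K} (hx : x ∈ ball K a) (hy : y ∈ ball K b) :
    x * y ∈ ball K (a * b) := by
  rw [mem_ball, nnnorm_mul]; exact mul_le_mul' hx hy

/-- Power series with Gauss norm at most `c`. -/
def gauss (K : Type*) [NormedField K] [IsUltrametricDist K] (c : ℝ≥0) :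
    AddSubgroup (PowerSeries K) where
  carrier := {s | ∀ n, PowerSeries.coeff n s ∈ ball K c}
  zero_mem' n := by simp [(ball K c).zero_mem]
  add_mem' {x y} hx hy n := by rw [map_add]; exact (ball K c).add_mem (hx n) (hy n)
  neg_mem' {x} hx n := by rw [map_neg]; exact (ball K c).neg_mem (hx n)

lemma gauss_mono {a b : ℝ≥0} (h : a ≤ b) : gauss K a ≤ gauss K b :=
  fun _ hs n => (hs n).trans h

lemma mul_mem_gauss {a b : ℝ≥0} {s t : PowerSeries K} (hs : s ∈ gauss K a) (ht : t ∈ gauss K b) :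
    s * t ∈ gauss K (a * b) := by
  intro n
  rw [PowerSeries.coeff_mul]
  exact (ball K _).sum_mem fun x _ => mul_mem_ball (hs _) (ht _)

lemma C_mem_gauss {c : ℝ≥0} {x : K} (hx : ‖x‖₊ ≤ c) : PowerSeries.C x ∈ gauss K c := by
  intro n
  rw [PowerSeries.coeff_C]
  split_ifs
  · exact hx
  · exact (ball K c).zero_mem

lemma one_mem_gauss : (1 : PowerSeries K) ∈ gauss K 1 := by
  simpa using C_mem_gauss (K := K) (x := 1) (c := 1) (by simp)

lemma pow_mem_gauss {s : PowerSeries K} (hs : s ∈ gauss K 1) (n : ℕ) : s ^ n ∈ gauss K 1 := by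
  induction n with
  | zero => simpa using one_mem_gauss
  | succ n ih => rw [pow_succ]; simpa using mul_mem_gauss ih hs

/-- The recursion for the coefficients of the inverse divides only by the constant coefficient, a
unit. -/
lemma inv_mem_gauss {s : PowerSeries K} (hs : s ∈ gauss K 1)
    (h0 : ‖PowerSeries.constantCoeff s‖ = 1) : s⁻¹ ∈ gauss K 1 := by
  have h0' : ‖(PowerSeries.constantCoeff s)⁻¹‖₊ ≤ 1 := by
    rw [nnnorm_inv, ← NNReal.coe_le_coe]; simp [h0]
  intro n
  induction n using Nat.strong_induction_on with
  | _ n ih =>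
    rw [PowerSeries.coeff_inv]
    split_ifs with hn
    · exact h0'
    · rw [neg_mul]
      refine (ball K 1).neg_mem ?_
      rw [← one_mul (1 : ℝ≥0)]
      refine mul_mem_ball h0' ((ball K 1).sum_mem fun x _ => ?_)
      split_ifs with hx
      · rw [← one_mul (1 : ℝ≥0)]
        exact mul_mem_ball (hs _) (ih _ hx)
      · exact (ball K 1).zero_mem

/-- Polynomials over power series with Gauss norm at most `c`. -/
def pgauss (K : Type*) [NormedField K] [IsUltrametricDist K] (c : ℝ≥0) :
    AddSubgroup (PowerSeries K)[X] where
  carrier := {P | ∀ j, P.coeff j ∈ gauss K c}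
  zero_mem' j := by simp [(gauss K c).zero_mem]
  add_mem' {x y} hx hy n := by rw [coeff_add]; exact (gauss K c).add_mem (hx n) (hy n)
  neg_mem' {x} hx n := by rw [coeff_neg]; exact (gauss K c).neg_mem (hx n)

lemma pgauss_mono {a b : ℝ≥0} (h : a ≤ b) : pgauss K a ≤ pgauss K b :=
  fun _ hs n => gauss_mono h (hs n)

lemma mul_mem_pgauss {a b : ℝ≥0} {P R : (PowerSeries K)[X]} (hP : P ∈ pgauss K a)
    (hR : R ∈ pgauss K b) : P * R ∈ pgauss K (a * b) := by
  intro n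
  rw [coeff_mul]
  exact (gauss K _).sum_mem fun x _ => mul_mem_gauss (hP _) (hR _)

lemma mul_mem_pgauss_of_left {b : ℝ≥0} {P R : (PowerSeries K)[X]} (hP : P ∈ pgauss K 1)
    (hR : R ∈ pgauss K b) : P * R ∈ pgauss K b := by
  simpa using mul_mem_pgauss hP hR

lemma monomial_mem_pgauss {c : ℝ≥0} {s : PowerSeries K} (hs : s ∈ gauss K c) (e : ℕ) :
    monomial e s ∈ pgauss K c := by
  intro n
  rw [coeff_monomial]
  split_ifs
  · exact hs
  · exact (gauss K c).zero_mem

lemma C_mem_pgauss {c : ℝ≥0} {s : PowerSeries K} (hs : s ∈ gauss K c) : C s ∈ pgauss K c :=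
  monomial_mem_pgauss hs 0

lemma one_mem_pgauss : (1 : (PowerSeries K)[X]) ∈ pgauss K 1 := by
  simpa using C_mem_pgauss (K := K) one_mem_gauss

lemma X_pow_mem_pgauss (e : ℕ) : (X ^ e : (PowerSeries K)[X]) ∈ pgauss K 1 := by
  rw [X_pow_eq_monomial]; exact monomial_mem_pgauss one_mem_gauss e

lemma X_mem_pgauss : (X : (PowerSeries K)[X]) ∈ pgauss K 1 := by
  simpa using X_pow_mem_pgauss (K := K) 1

lemma pow_mem_pgauss {P : (PowerSeries K)[X]} (hP : P ∈ pgauss K 1) (n : ℕ) :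
    P ^ n ∈ pgauss K 1 := by
  induction n with
  | zero => simpa using one_mem_pgauss
  | succ n ih => rw [pow_succ]; exact mul_mem_pgauss_of_left ih hP

lemma natCast_mem_gauss (n : ℕ) : (n : PowerSeries K) ∈ gauss K 1 := by
  rw [← map_natCast PowerSeries.C]
  exact C_mem_gauss (IsUltrametricDist.nnnorm_natCast_le_one K n)

lemma derivative_mem_pgauss {c : ℝ≥0} {P : (PowerSeries K)[X]} (hP : P ∈ pgauss K c) :
    derivative P ∈ pgauss K c := by
  intro n
  rw [coeff_derivative]
  have := mul_mem_gauss (hP (n + 1)) (natCast_mem_gauss (K := K) (n + 1))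
  simpa using this

lemma divByMonic_mem_pgauss {c : ℝ≥0} {P Q : (PowerSeries K)[X]} (hQ : Q.Monic)
    (hQ1 : Q ∈ pgauss K 1) (hP : P ∈ pgauss K c) : P /ₘ Q ∈ pgauss K c :=
  (coeff_div_mod_mem hQ (fun _ => gauss K c)
    (fun _ i _ a ha => by simpa using mul_mem_gauss ha (hQ1 i)) hP).1

lemma modByMonic_mem_pgauss {c : ℝ≥0} {P Q : (PowerSeries K)[X]} (hQ : Q.Monic)
    (hQ1 : Q ∈ pgauss K 1) (hP : P ∈ pgauss K c) : P %ₘ Q ∈ pgauss K c :=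
  (coeff_div_mod_mem hQ (fun _ => gauss K c)
    (fun _ i _ a ha => by simpa using mul_mem_gauss ha (hQ1 i)) hP).2

lemma comp_mem_pgauss {c : ℝ≥0} {P R : (PowerSeries K)[X]} (hP : P ∈ pgauss K c)
    (hR : R ∈ pgauss K 1) : P.comp R ∈ pgauss K c := by
  rw [comp, eval₂_eq_sum, sum_def]
  refine (pgauss K c).sum_mem fun i _ => ?_
  simpa using mul_mem_pgauss (C_mem_pgauss (hP i)) (pow_mem_pgauss hR i)

end Gauss

/-! ### Horizontal lifts and the poles at finite distance -/

section Operator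

variable {A : Type*} [CommRing A]

/-- The operator `G ↦ Q G' - μ Q' G`; for `μ = m / 2` it is `G ↦ √Q^(m + 2) (G / √Q^m)'`. -/
def conn (Q : A[X]) (μ : A) (G : A[X]) : A[X] :=
  Q * derivative G - C μ * (derivative Q * G)

lemma conn_add (Q : A[X]) (μ : A) (G G' : A[X]) :
    conn Q μ (G + G') = conn Q μ G + conn Q μ G' := by
  simp only [conn, derivative_add]; ring

lemma conn_zero (Q : A[X]) (μ : A) : conn Q μ 0 = 0 := by
  simp [conn]

lemma conn_sum (Q : A[X]) (μ : A) {ι : Type*} (s : Finset ι) (G : ι → A[X]) :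
    conn Q μ (∑ i ∈ s, G i) = ∑ i ∈ s, conn Q μ (G i) := by
  classical
  induction s using Finset.induction_on with
  | empty => simp [conn_zero]
  | insert a s ha ih => rw [Finset.sum_insert ha, Finset.sum_insert ha, conn_add, ih]

lemma conn_C_mul (Q : A[X]) (μ a : A) (G : A[X]) :
    conn Q μ (C a * G) = C a * conn Q μ G := by
  simp only [conn, derivative_C_mul]; ring

/-- Modulo `Q`, the digit at `Q^n` is multiplied by `(n - μ) Q'`. For `μ = s - 1/2` the scalar is
half an odd integer, so it never vanishes, and `Q'` is invertible modulo `Q`: digits can be solved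
for one after the other. -/
lemma conn_pow_mul (Q : A[X]) (μ : A) (n : ℕ) (W : A[X]) :
    conn Q μ (Q ^ n * W) =
      Q ^ n * (C (n - μ) * (derivative Q * W) + Q * derivative W) := by
  cases n with
  | zero => simp [conn]; ring
  | succ n =>
    simp only [conn, derivative_mul, derivative_pow, Nat.add_sub_cancel, C_sub, map_natCast]
    push_cast
    ring

lemma conn_map {B : Type*} [CommRing B] (f : A →+* B) (Q : A[X]) (μ : A) (G : A[X]) :
    (conn Q μ G).map f = conn (Q.map f) (f μ) (G.map f) := by
  simp [conn, derivative_map]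

lemma dvd_comp_sub_self {Q ξ : A[X]} (h : Q ∣ ξ - X) (P : A[X]) : Q ∣ P.comp ξ - P := by
  have := sub_dvd_eval_sub ξ X (P.map C)
  rw [eval_map, eval_map, ← comp, ← comp, comp_X] at this
  exact h.trans this

lemma exists_comp_add (P x y : A[X]) :
    ∃ k, P.comp (x + y) = P.comp x + (derivative P).comp x * y + k * y ^ 2 := by
  obtain ⟨k, hk⟩ := binomExpansion (P.map C) x y
  refine ⟨k, ?_⟩
  rw [derivative_map, eval_map, eval_map, eval_map] at hk
  exact hk

/-- Differentiating `Q(ξ) = Q^(s+1) e` gives `ξ' Q'(ξ) ≡ 0` modulo `Q^s`, and `Q'(ξ) ≡ Q'` is a unit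
modulo `Q`. Consequently `P(ξ)` is horizontal for every `P`: its derivative vanishes modulo `Q^s`.
-/
lemma pow_dvd_derivative_of_dvd_comp {Q ξ b : A[X]} (hb : Q ∣ b * derivative Q - 1)
    (hξ : Q ∣ ξ - X) {s : ℕ} (h : Q ^ (s + 1) ∣ Q.comp ξ) : Q ^ s ∣ derivative ξ := by
  have h1 : Q ^ s ∣ derivative ξ * (derivative Q).comp ξ := by
    rw [← derivative_comp]
    obtain ⟨e, he⟩ := h
    rw [he, derivative_mul, derivative_pow]
    simp only [Nat.add_sub_cancel]
    refine dvd_add ⟨C ((s + 1 : ℕ) : A) * derivative Q * e, by ring⟩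
      ⟨Q * derivative e, by ring⟩
  have h2 : IsCoprime Q ((derivative Q).comp ξ) := by
    obtain ⟨c, hc⟩ := hb
    obtain ⟨d, hd⟩ := dvd_comp_sub_self hξ (derivative Q)
    exact ⟨b * d * (-1) - c + 2 * b * d - 2 * b * d, b, by linear_combination hc + b * hd⟩
  exact h2.pow_left.dvd_of_dvd_mul_right h1

end Operator

/-! ### Hensel lifts and the base-`Q` digits of a primitive. -/

section Digits

variable {K : Type*} [NormedField K] [IsUltrametricDist K]

/-- Hensel lifting: the root `X` of `Q` modulo `Q` lifts to an integral root modulo powers of `Q`. -/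
lemma exists_horizontal {Q b : (PowerSeries K)[X]} (hQ : Q.Monic) (hQ1 : Q ∈ pgauss K 1)
    (hb1 : b ∈ pgauss K 1) (hb : Q ∣ b * derivative Q - 1) (s : ℕ) :
    ∃ ξ ∈ pgauss K 1, Q ∣ ξ - X ∧ Q ^ (s + 1) ∣ Q.comp ξ := by
  induction s with
  | zero => exact ⟨X, X_mem_pgauss, by simp, by simp⟩
  | succ s ih =>
    obtain ⟨ξ, h1, h2, h3⟩ := ih
    have hQs := hQ.pow (s + 1)
    set e := Q.comp ξ /ₘ Q ^ (s + 1) with he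
    have he1 : e ∈ pgauss K 1 :=
      divByMonic_mem_pgauss hQs (pow_mem_pgauss hQ1 _) (comp_mem_pgauss hQ1 h1)
    have he2 : Q ^ (s + 1) * e = Q.comp ξ := by
      rw [he]
      obtain ⟨u, hu⟩ := h3
      rw [hu, mul_divByMonic_cancel_left _ hQs]
    -- Newton step: `b` serves as inverse of `Q'(ξ)`, since `ξ ≡ X` modulo `Q`. Integrality persists
    -- because `e` is a quotient by a monic integral polynomial.
    refine ⟨ξ + Q ^ (s + 1) * (-(b * e)), ?_, ?_, ?_⟩
    · exact (pgauss K 1).add_mem h1 (mul_mem_pgauss_of_left (pow_mem_pgauss hQ1 _)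
        ((pgauss K 1).neg_mem (mul_mem_pgauss_of_left hb1 he1)))
    · obtain ⟨u, hu⟩ := h2
      exact ⟨u + Q ^ s * (-(b * e)), by linear_combination hu⟩
    · obtain ⟨k, hk⟩ := exists_comp_add Q ξ (Q ^ (s + 1) * (-(b * e)))
      obtain ⟨d, hd⟩ := dvd_comp_sub_self h2 (derivative Q)
      obtain ⟨c, hc⟩ := hb
      rw [hk]
      refine ⟨-(e * c) - d * b * e + k * Q ^ s * (b * e) ^ 2, ?_⟩
      linear_combination (-1) * he2 - Q ^ (s + 1) * b * e * hd - Q ^ (s + 1) * e * hc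

/-- Bounds on the successive digits in base `Q` of a solution of `Q G' - (s - 1/2) Q' G = ∑ A_i Q^i`
modulo `Q^s`. -/
lemma exists_mem_pgauss_of_conn [CharZero K] (h2 : ‖(2 : K)‖₊ ≤ 1)
    (hinv : ∀ j : ℕ, j ≠ 0 → ‖(j : K)⁻¹‖₊ ≤ j) {Q b ξ : (PowerSeries K)[X]} (hQ : Q.Monic)
    (hQ1 : Q ∈ pgauss K 1) (hb1 : b ∈ pgauss K 1) (hb : Q ∣ b * derivative Q - 1)
    (hξ1 : ξ ∈ pgauss K 1) (hξ : Q ∣ ξ - X) {s : ℕ} (hξ' : Q ^ s ∣ derivative ξ) (β : ℝ≥0)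
    (t : ℕ) : ∀ (n : ℕ), n + t = s → ∀ (W : (PowerSeries K)[X]) (A : ℕ → (PowerSeries K)[X]),
    (∀ i, n ≤ i → i < s → A i ∈ pgauss K (β / (2 * (s - i) - 1 : ℕ))) →
    Q ^ s ∣ conn Q (PowerSeries.C ((s : K) - 1 / 2)) (Q ^ n * W) -
      ∑ i ∈ Finset.Ico n s, Q ^ i * A i →
    ∃ Z ∈ pgauss K β, Q ^ s ∣ Q ^ n * W - Z := by
  induction t with
  | zero =>
    rintro n rfl W A - -
    exact ⟨0, (pgauss K β).zero_mem, W, by simp⟩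
  | succ t ih =>
    intro n hn W A hA hdvd
    have hns : n < s := by omega
    set μ : PowerSeries K := PowerSeries.C ((s : K) - 1 / 2) with hμ
    -- The only integer divided by at this digit: `n - μ = -j/2`. The hypothesis on `A n` provides
    -- exactly a factor `1 / j`.
    set j : ℕ := 2 * (s - n) - 1 with hj
    have hj0 : j ≠ 0 := by omega
    have hjK : (j : K) ≠ 0 := by exact_mod_cast hj0
    have hjs : (j : K) = 2 * (s - n) - 1 := by
      have : (j : ℤ) = 2 * ((s : ℤ) - n) - 1 := by omega
      exact_mod_cast congrArg (Int.cast : ℤ → K) this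
    have hγ : (n : PowerSeries K) - μ = PowerSeries.C (-(j : K) / 2) := by
      rw [hμ, hjs, ← map_natCast PowerSeries.C n, ← map_sub]
      congr 1; ring
    set γ : PowerSeries K := PowerSeries.C (-(j : K) / 2) with hγd
    set γ' : PowerSeries K := PowerSeries.C (-2 * (j : K)⁻¹) with hγ'
    have hγγ : C γ * C γ' = (1 : (PowerSeries K)[X]) := by
      rw [← C_mul, hγd, hγ', ← map_mul]
      have : -(j : K) / 2 * (-2 * (j : K)⁻¹) = 1 := by field_simp
      rw [this, map_one, map_one]
    have hAn := hA n le_rfl hns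
    rw [conn_pow_mul, hγ, Finset.sum_eq_sum_Ico_succ_bot hns] at hdvd
    -- the leading digit
    have hlead : Q ∣ C γ * (derivative Q * W) - A n := by
      have h1 : Q ^ (n + 1) ∣ Q ^ n * (C γ * (derivative Q * W) - A n) := by
        have h3 : Q ^ (n + 1) ∣ ∑ i ∈ Finset.Ico (n + 1) s, Q ^ i * A i :=
          Finset.dvd_sum fun i hi => Dvd.dvd.mul_right (pow_dvd_pow _ (Finset.mem_Ico.1 hi).1) _
        have h4 := (pow_dvd_pow Q hns).trans hdvd
        have h5 : Q ^ (n + 1) ∣ Q ^ (n + 1) * derivative W := dvd_mul_right _ _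
        convert dvd_sub (dvd_add h4 h3) h5 using 1
        ring
      obtain ⟨u, hu⟩ := h1
      refine ⟨u, ?_⟩
      have := (hQ.pow n).isRegular.left
      exact this (by simp only; rw [hu]; ring)
    -- `g₀` is the right side divided by `Q'`, and `g`, its multiple by `-2/j`, is the leading digit
    -- of `W`, now of norm at most `β`.
    set g₀ := (b * A n) %ₘ Q with hg₀
    have hg₀1 : g₀ ∈ pgauss K (β / j) :=
      modByMonic_mem_pgauss hQ hQ1 (mul_mem_pgauss_of_left hb1 hAn)
    set g := C γ' * g₀ with hg
    have hg1 : g ∈ pgauss K β := by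
      have h3 : γ' ∈ gauss K j := C_mem_gauss (by
        rw [nnnorm_mul, nnnorm_neg, ← one_mul (j : ℝ≥0)]
        exact mul_le_mul' h2 (hinv j hj0))
      have h4 := mul_mem_pgauss (C_mem_pgauss h3) hg₀1
      rwa [mul_div_cancel₀ _ (by exact_mod_cast hj0)] at h4
    have hgdvd : Q ∣ g₀ - b * A n := by
      have := modByMonic_add_div (b * A n) Q
      exact ⟨-(b * A n /ₘ Q), by linear_combination this⟩
    obtain ⟨u1, hu1⟩ := hlead
    obtain ⟨u2, hu2⟩ := hgdvd
    obtain ⟨u3, hu3⟩ := hb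
    obtain ⟨u4, hu4⟩ := dvd_comp_sub_self hξ g
    obtain ⟨u5, hu5⟩ := dvd_comp_sub_self hξ g₀
    -- The horizontal lift `g(ξ)` is split off instead of `g`. Its derivative vanishes modulo `Q^s`,
    -- so the only carry to the next digit is `A''`, the quotient of `A n - Q' g₀(ξ)` by `Q`, which
    -- involves no division by `j`.
    have hW : ∃ W₂, W = g.comp ξ + Q * W₂ := by
      refine ⟨C γ' * (b * u1 - u2 - C γ * u3 * W) - u4, ?_⟩
      rw [hg] at hu4 ⊢
      linear_combination (-W) * hγγ - hu4 - C γ' * hu2 + C γ' * b * hu1 - C γ' * C γ * W * hu3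
    obtain ⟨W₂, hW₂⟩ := hW
    have hA'' : ∃ A'' ∈ pgauss K (β / j), A n - derivative Q * g₀.comp ξ = Q * A'' := by
      have hmem : A n - derivative Q * g₀.comp ξ ∈ pgauss K (β / j) :=
        (pgauss K _).sub_mem hAn (mul_mem_pgauss_of_left (derivative_mem_pgauss hQ1)
          (comp_mem_pgauss hg₀1 hξ1))
      have hd : A n - derivative Q * g₀.comp ξ =
          Q * (-(A n * u3) - derivative Q * u2 - derivative Q * u5) := by
        linear_combination (-A n) * hu3 - derivative Q * hu2 - derivative Q * hu5
      refine ⟨_, divByMonic_mem_pgauss hQ hQ1 hmem, ?_⟩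
      rw [hd, mul_divByMonic_cancel_left _ hQ]
    obtain ⟨A'', hA''1, hA''2⟩ := hA''
    obtain ⟨u6, hu6⟩ := hξ'
    have hcomp : C γ * g.comp ξ = g₀.comp ξ := by
      rw [hg, mul_comp, C_comp, ← mul_assoc, hγγ, one_mul]
    have hstep : ∃ Z ∈ pgauss K β, Q ^ s ∣ Q ^ (n + 1) * W₂ - Z := by
      rcases Nat.eq_zero_or_pos t with rfl | ht
      · exact ⟨0, (pgauss K β).zero_mem, W₂, by rw [sub_zero, ← hn]⟩
      refine ih (n + 1) (by omega) W₂ (Function.update A (n + 1) (A (n + 1) + A'')) ?_ ?_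
      · intro i hi his
        by_cases hin : i = n + 1
        · subst hin
          rw [Function.update_self]
          -- The carry has norm at most `β / j`, stronger than what the next digit requires, since
          -- its odd integer is smaller than `j`. Hence the losses do not accumulate.
          refine (pgauss K _).add_mem (hA _ (by omega) his) (pgauss_mono ?_ hA''1)
          have h3 : ((2 * (s - (n + 1)) - 1 : ℕ) : ℝ≥0) ≤ j := by
            rw [hj]; exact_mod_cast (by omega)
          refine div_le_div_of_nonneg_left zero_le ?_ h3
          exact_mod_cast (by omega)
        · rw [Function.update_of_ne hin]
          exact hA i (by omega) his
      · have hs1 : n + 1 < s := by omega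
        have hsum : ∑ i ∈ Finset.Ico (n + 1) s,
            Q ^ i * Function.update A (n + 1) (A (n + 1) + A'') i =
            ∑ i ∈ Finset.Ico (n + 1) s, Q ^ i * A i + Q ^ (n + 1) * A'' := by
          rw [Finset.sum_eq_sum_Ico_succ_bot hs1, Finset.sum_eq_sum_Ico_succ_bot hs1,
            Function.update_self]
          have : ∑ k ∈ Finset.Ico (n + 1 + 1) s,
              Q ^ k * Function.update A (n + 1) (A (n + 1) + A'') k =
              ∑ k ∈ Finset.Ico (n + 1 + 1) s, Q ^ k * A k := by
            refine Finset.sum_congr rfl fun i hi => ?_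
            rw [Function.update_of_ne]
            have := (Finset.mem_Ico.1 hi).1
            omega
          rw [this]; ring
        rw [hsum]
        have hsplit : conn Q μ (Q ^ (n + 1) * W₂) =
            Q ^ n * (C γ * (derivative Q * W) + Q * derivative W) -
            Q ^ n * (C γ * (derivative Q * g.comp ξ) + Q * derivative (g.comp ξ)) := by
          rw [← hγ, ← conn_pow_mul, ← conn_pow_mul, hW₂, mul_add, conn_add]
          ring_nf
        obtain ⟨v, hv⟩ := hdvd
        refine ⟨v - Q ^ (n + 1) * u6 * (derivative g).comp ξ, ?_⟩
        rw [hsplit, derivative_comp]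
        linear_combination hv + Q ^ n * hA''2 - Q ^ n * derivative Q * hcomp -
          Q ^ (n + 1) * (derivative g).comp ξ * hu6
    obtain ⟨Z, hZ1, hZ2⟩ := hstep
    refine ⟨Z + Q ^ n * g.comp ξ, (pgauss K β).add_mem hZ1
      (mul_mem_pgauss_of_left (pow_mem_pgauss hQ1 _) (comp_mem_pgauss hg1 hξ1)), ?_⟩
    obtain ⟨v, hv⟩ := hZ2
    exact ⟨v, by rw [hW₂]; linear_combination hv⟩

end Digits

/-! ### The pole at infinity -/

section Infinity

lemma coeff_mul_eq_zero_of_lt {A : Type*} [CommRing A] {P R : A[X]} {a b m : ℕ}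
    (hP : ∀ i, a < i → P.coeff i = 0) (hR : ∀ j, b ≤ j → R.coeff j = 0) (h : a + b ≤ m) :
    (P * R).coeff m = 0 := by
  rw [coeff_mul]
  refine Finset.sum_eq_zero fun x hx => ?_
  have hx := Finset.HasAntidiagonal.mem_antidiagonal.1 hx
  by_cases h1 : a < x.1
  · rw [hP _ h1, zero_mul]
  · rw [hR _ (by omega), mul_zero]

lemma degree_conn_lt {A : Type*} [CommRing A] {Q V : A[X]} {g n : ℕ}
    (hQ : Q.natDegree = 2 * g + 1) (μ : A) (hV : V.degree < n) :
    (conn Q μ V).degree < (n + 2 * g : ℕ) := by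
  rw [degree_lt_iff_coeff_zero] at hV ⊢
  intro m hm
  rcases Nat.eq_zero_or_pos n with rfl | hn
  · have : V = 0 := by exact Polynomial.ext fun i => by simpa using hV i (Nat.zero_le i)
    rw [this, conn_zero, coeff_zero]
  have hQ0 : ∀ i, 2 * g + 1 < i → Q.coeff i = 0 := fun i hi =>
    coeff_eq_zero_of_natDegree_lt (by omega)
  rw [conn, coeff_sub, coeff_C_mul,
    coeff_mul_eq_zero_of_lt (a := 2 * g + 1) (b := n - 1) hQ0 (fun j hj => by
      rw [coeff_derivative, hV _ (by omega), zero_mul]) (by omega),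
    coeff_mul_eq_zero_of_lt (a := 2 * g) (b := n) (fun i hi => by
      rw [coeff_derivative, hQ0 _ (by omega), zero_mul]) hV (by omega)]
  simp

variable {K : Type*} [NormedField K] [IsUltrametricDist K]

/-- Polynomial approximations `η` of degree `e` to the series `X ^ (e + g + 1/2) / √Q` in `1 / X`. -/
lemma exists_sq_mul_sub_X_pow_degree_lt (h20 : (2 : K) ≠ 0) (h2 : ‖(2 : K)⁻¹‖₊ ≤ 1)
    {Q : (PowerSeries K)[X]} (hQ : Q.Monic) (hQ1 : Q ∈ pgauss K 1) {g : ℕ}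
    (hdeg : Q.natDegree = 2 * g + 1) (e : ℕ) :
    ∃ η ∈ pgauss K 1, η.Monic ∧ η.natDegree = e ∧
      (η ^ 2 * Q - X ^ (2 * e + 2 * g + 1)).degree < ((e + 2 * g + 1 : ℕ) : WithBot ℕ) := by
  have hmon : ∀ {P : (PowerSeries K)[X]} {n : ℕ}, P.Monic → P.natDegree = n →
      (P - X ^ n).degree < (n : WithBot ℕ) := by
    rintro P n hP rfl
    have := degree_sub_lt_left (p := P) (q := X ^ P.natDegree)
      (by rw [degree_X_pow, degree_eq_natDegree hP.ne_zero]) hP.ne_zero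
      (by rw [hP.leadingCoeff, (monic_X_pow _).leadingCoeff])
    rwa [degree_eq_natDegree hP.ne_zero] at this
  induction e with
  | zero =>
    refine ⟨1, one_mem_pgauss, monic_one, natDegree_one, ?_⟩
    simpa using hmon hQ hdeg
  | succ e ih =>
    obtain ⟨η, h1, h3, h4, h5⟩ := ih
    set D := η ^ 2 * Q - X ^ (2 * e + 2 * g + 1) with hD
    set δ := D.coeff (e + 2 * g) with hδ
    -- The coefficient of degree `e + 2g + 2` in `(Xη + c)^2 Q - X^(2e+2g+3)` is `δ + 2c`; this
    -- choice of `c` cancels it.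
    set c : PowerSeries K := PowerSeries.C (2 : K)⁻¹ * -δ with hc
    have h2c : 2 * c = -δ := by
      rw [hc, ← mul_assoc, ← map_ofNat PowerSeries.C 2, ← map_mul, mul_inv_cancel₀ h20, map_one,
        one_mul]
    have hD1 : D ∈ pgauss K 1 := (pgauss K 1).sub_mem
      (mul_mem_pgauss_of_left (pow_mem_pgauss h1 _) hQ1) (X_pow_mem_pgauss _)
    have hc1 : c ∈ gauss K 1 := by
      have := mul_mem_gauss (C_mem_gauss h2) ((gauss K 1).neg_mem (hD1 (e + 2 * g)))
      rwa [mul_one] at this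
    have hXη : (X * η).Monic := monic_X.mul h3
    have hXηd : (X * η).natDegree = e + 1 := by
      rw [monic_X.natDegree_mul h3, natDegree_X, h4, add_comm]
    have hlt : (C c : (PowerSeries K)[X]).degree < (X * η).degree := by
      rw [degree_eq_natDegree hXη.ne_zero, hXηd]
      exact degree_C_le.trans_lt (by exact_mod_cast Nat.succ_pos e)
    refine ⟨X * η + C c, (pgauss K 1).add_mem (mul_mem_pgauss_of_left X_mem_pgauss h1)
      (C_mem_pgauss hc1), hXη.add_of_left hlt, ?_, ?_⟩
    · rw [natDegree_add_eq_left_of_degree_lt hlt, hXηd]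
    · have e1 : (X * η + C c) ^ 2 * Q - X ^ (2 * (e + 1) + 2 * g + 1) =
          (X ^ 2 * D - C δ * X ^ (e + 2 * g + 2)) +
          C (2 * c) * (X * η * Q - X ^ (e + 2 * g + 2)) + C (c ^ 2) * Q := by
        have h2c' : C (2 * c) = -(C δ : (PowerSeries K)[X]) := by rw [h2c, C_neg]
        have h2c'' : 2 * C c = -(C δ : (PowerSeries K)[X]) := by
          rw [← h2c', C_mul (a := 2) (b := c), map_ofNat]
        rw [h2c', hD, C_pow]
        linear_combination (X * η * Q) * h2c''
      have d1 : (X ^ 2 * D - C δ * X ^ (e + 2 * g + 2)).degree <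
          ((e + 1 + 2 * g + 1 : ℕ) : WithBot ℕ) := by
        rw [degree_lt_iff_coeff_zero] at h5 ⊢
        intro m hm
        rw [coeff_sub, coeff_X_pow_mul', coeff_C_mul_X_pow, if_pos (by omega)]
        by_cases hm' : m = e + 2 * g + 2
        · rw [if_pos hm', hm', Nat.add_sub_cancel, sub_self]
        · rw [if_neg hm', h5 _ (by omega), sub_zero]
      have d2 : (C (2 * c) * (X * η * Q - X ^ (e + 2 * g + 2))).degree <
          ((e + 1 + 2 * g + 1 : ℕ) : WithBot ℕ) := by
        rw [← smul_eq_C_mul]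
        refine (degree_smul_le _ _).trans_lt ?_
        have := hmon (n := e + 2 * g + 2) (hXη.mul hQ)
          (by rw [hXη.natDegree_mul hQ, hXηd, hdeg]; ring)
        rwa [show e + 1 + 2 * g + 1 = e + 2 * g + 2 by ring]
      have d3 : (C (c ^ 2) * Q).degree <
          ((e + 1 + 2 * g + 1 : ℕ) : WithBot ℕ) := by
        rw [← smul_eq_C_mul]
        refine (degree_smul_le _ _).trans_lt ?_
        rw [degree_eq_natDegree hQ.ne_zero, hdeg]
        exact_mod_cast (by omega)
      rw [e1]
      exact (degree_add_le _ _).trans_lt (max_lt ((degree_add_le _ _).trans_lt (max_lt d1 d2)) d3)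

/-- The image of `η` is `√Q (η √Q)'`, so multiplied by `η` it is half the derivative of `η^2 Q`,
which is `X^(2e+2g+1)` up to low degree. Hence it is `(2e+2g+1)/2` times the quotient of `X^(2e+2g)`
by `η`, up to degree less than `2g`. All coefficients of high degree share the single odd integer
`2e+2g+1`. -/
lemma exists_conn_eq_add_degree_lt [CharZero K] (h2 : ‖(2 : K)⁻¹‖₊ ≤ 1)
    {Q : (PowerSeries K)[X]} (hQ : Q.Monic) (hQ1 : Q ∈ pgauss K 1) {g : ℕ}
    (hdeg : Q.natDegree = 2 * g + 1) (e : ℕ) :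
    ∃ η ∈ pgauss K 1, η.Monic ∧ η.natDegree = e ∧ ∃ Y ∈ pgauss K 1, Y.Monic ∧
      Y.natDegree = e + 2 * g ∧ (conn Q (PowerSeries.C (-1 / 2)) η -
        C (PowerSeries.C ((2 * e + 2 * g + 1 : ℕ) / 2 : K)) * Y).degree < (2 * g : ℕ) := by
  obtain ⟨η, h1, h3, h4, h5⟩ := exists_sq_mul_sub_X_pow_degree_lt two_ne_zero h2 hQ hQ1 hdeg e
  set D := η ^ 2 * Q - X ^ (2 * e + 2 * g + 1) with hD
  set Y : (PowerSeries K)[X] := X ^ (2 * e + 2 * g) /ₘ η with hY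
  have hηd : η.degree = e := by rw [degree_eq_natDegree h3.ne_zero, h4]
  have hle : η.degree ≤ (X ^ (2 * e + 2 * g) : (PowerSeries K)[X]).degree := by
    rw [degree_X_pow, hηd]; exact_mod_cast (by omega)
  have hmod := modByMonic_add_div (X ^ (2 * e + 2 * g)) η
  have hmodlt := degree_modByMonic_lt (X ^ (2 * e + 2 * g)) h3
  refine ⟨η, h1, h3, h4, Y, divByMonic_mem_pgauss h3 h1 (X_pow_mem_pgauss _), ?_, ?_, ?_⟩
  · rw [Monic, leadingCoeff_divByMonic_of_monic h3 hle]
    exact monic_X_pow _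
  · rw [natDegree_divByMonic _ h3, h4, natDegree_X_pow]; omega
  · set κ : PowerSeries K := PowerSeries.C ((2 * e + 2 * g + 1 : ℕ) / 2 : K) with hκ
    set h : PowerSeries K := PowerSeries.C (1 / 2 : K) with hh
    have hh2 : 2 * C h = (1 : (PowerSeries K)[X]) := by
      rw [hh, ← map_ofNat C 2, ← C_mul, ← map_ofNat PowerSeries.C 2, ← map_mul]
      norm_num
    have hneg : (PowerSeries.C (-1 / 2 : K) : PowerSeries K) = -h := by
      rw [hh, ← map_neg]; norm_num
    have hκh : (C κ : (PowerSeries K)[X]) = C h * ((2 * e + 2 * g + 1 : ℕ) : (PowerSeries K)[X]) := by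
      rw [hκ, hh, ← map_natCast C, ← C_mul, ← map_natCast PowerSeries.C, ← map_mul]
      congr 2; ring
    have key : (conn Q (PowerSeries.C (-1 / 2)) η - C κ * Y) * η =
        C h * derivative D + C κ * (X ^ (2 * e + 2 * g) %ₘ η) := by
      have hder : derivative D = 2 * η * derivative η * Q + η ^ 2 * derivative Q -
          ((2 * e + 2 * g + 1 : ℕ) : (PowerSeries K)[X]) * X ^ (2 * e + 2 * g) := by
        rw [hD, derivative_sub, derivative_mul, derivative_X_pow, derivative_sq]
        simp only [Nat.add_sub_cancel, map_natCast, map_ofNat]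
      rw [conn, hneg, C_neg, hder, hκh]
      linear_combination (-Q * derivative η * η) * hh2 -
        C h * ((2 * e + 2 * g + 1 : ℕ) : (PowerSeries K)[X]) * hmod
    have hlt : ((conn Q (PowerSeries.C (-1 / 2)) η - C κ * Y) * η).degree < (e + 2 * g : ℕ) := by
      rw [key, ← smul_eq_C_mul, ← smul_eq_C_mul]
      refine (degree_add_le _ _).trans_lt (max_lt ((degree_smul_le _ _).trans_lt ?_)
        ((degree_smul_le _ _).trans_lt ?_))
      · rw [degree_lt_iff_coeff_zero] at h5 ⊢
        intro m hm
        rw [coeff_derivative, h5 _ (by omega), zero_mul]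
      · refine hmodlt.trans_le ?_
        rw [hηd]; exact_mod_cast (by omega)
    by_cases hz : conn Q (PowerSeries.C (-1 / 2)) η - C κ * Y = 0
    · rw [hz, degree_zero]; exact WithBot.bot_lt_coe _
    · rw [degree_mul, hηd, degree_eq_natDegree hz] at hlt
      rw [degree_eq_natDegree hz]
      norm_cast at hlt ⊢
      omega

/-- Bound on the differential of degree less than `2g` to which a differential with poles at infinity
is reduced. -/
lemma mem_pgauss_of_conn_infinity [CharZero K] (hinv : ∀ j : ℕ, j ≠ 0 → ‖(j : K)⁻¹‖₊ ≤ j)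
    (h2 : ‖(2 : K)⁻¹‖₊ ≤ 1) {Q : (PowerSeries K)[X]} (hQ : Q.Monic) (hQ1 : Q ∈ pgauss K 1)
    {g : ℕ} (hdeg : Q.natDegree = 2 * g + 1) (β : ℝ≥0) (n : ℕ) :
    ∀ V c P : (PowerSeries K)[X], V.degree < n → c.degree < (2 * g : ℕ) →
    P = c + conn Q (PowerSeries.C (-1 / 2)) V →
    (∀ j, 2 * g ≤ j → P.coeff j ∈ gauss K (β / (2 * (j - g) + 1 : ℕ))) →
    (∀ j, j < 2 * g → P.coeff j ∈ gauss K β) → c ∈ pgauss K β := by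
  induction n with
  | zero =>
    intro V c P hV hc hP _ hlow j
    have hV0 : V = 0 := by
      rw [degree_lt_iff_coeff_zero] at hV
      exact Polynomial.ext fun i => by simpa using hV i (Nat.zero_le i)
    rw [hV0, conn_zero, add_zero] at hP
    by_cases hj : j < 2 * g
    · rw [← hP]; exact hlow j hj
    · rw [coeff_eq_zero_of_degree_lt (hc.trans_le (by exact_mod_cast not_lt.1 hj))]
      exact (gauss K β).zero_mem
  | succ n ih =>
    intro V c P hV hc hP hhigh hlow
    obtain ⟨η, h1, h3, h4, Y, hY1, hYm, hYd, hR⟩ :=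
      exists_conn_eq_add_degree_lt h2 hQ hQ1 hdeg n
    set E := conn Q (PowerSeries.C (-1 / 2)) η with hE
    set κ : PowerSeries K := PowerSeries.C ((2 * n + 2 * g + 1 : ℕ) / 2 : K) with hκ
    have hEhigh : ∀ j, 2 * g ≤ j → E.coeff j = κ * Y.coeff j := by
      intro j hj
      rw [degree_lt_iff_coeff_zero] at hR
      have := hR j hj
      rwa [coeff_sub, coeff_C_mul, sub_eq_zero] at this
    set a := V.coeff n with ha
    -- Subtracting `a η` rather than `a X^n` changes the coefficients of degree at least `2g` only
    -- by multiples of `a κ`, which is a coefficient of `P` and so already small.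
    set V₂ := V - C a * η with hV₂
    have hV₂d : V₂.degree < n := by
      rw [degree_lt_iff_coeff_zero] at hV ⊢
      intro m hm
      rw [hV₂, coeff_sub, coeff_C_mul]
      rcases hm.eq_or_lt with rfl | hm
      · rw [show η.coeff n = 1 by rw [← h4, h3.coeff_natDegree], ← ha, mul_one, sub_self]
      · rw [hV _ hm, coeff_eq_zero_of_natDegree_lt (by omega), mul_zero, sub_zero]
    have hVsplit : conn Q (PowerSeries.C (-1 / 2)) V =
        C a * E + conn Q (PowerSeries.C (-1 / 2)) V₂ := by
      rw [hE, ← conn_C_mul, ← conn_add, hV₂]; congr 1; ring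
    have hconn2 := degree_conn_lt hdeg (PowerSeries.C (-1 / 2 : K)) hV₂d
    have hEmem : E ∈ pgauss K 1 := by
      rw [hE, conn]
      refine (pgauss K 1).sub_mem (mul_mem_pgauss_of_left hQ1 (derivative_mem_pgauss h1))
        (mul_mem_pgauss_of_left (C_mem_pgauss (C_mem_gauss ?_))
        (mul_mem_pgauss_of_left (derivative_mem_pgauss hQ1) h1))
      rw [neg_div, nnnorm_neg, one_div]
      exact h2
    have hPn : P.coeff (n + 2 * g) = a * κ := by
      rw [hP, coeff_add, hVsplit, coeff_add, coeff_C_mul, hEhigh _ (by omega),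
        coeff_eq_zero_of_degree_lt hconn2,
        coeff_eq_zero_of_degree_lt (hc.trans_le (by exact_mod_cast Nat.le_add_left _ _)),
        ← hYd, hYm.coeff_natDegree]
      ring
    -- At the top degree `j = n + 2g` the allowed bound has denominator `2(j-g)+1 = 2n+2g+1`, just
    -- what is lost in passing from `a κ` to `a`.
    have hak : a * κ ∈ gauss K (β / (2 * n + 2 * g + 1 : ℕ)) := by
      have := hhigh (n + 2 * g) (by omega)
      rw [hPn] at this
      have e : 2 * (n + 2 * g - g) + 1 = 2 * n + 2 * g + 1 := by omega
      rwa [e] at this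
    have hne : ((2 * n + 2 * g + 1 : ℕ) : K) ≠ 0 := Nat.cast_ne_zero.2 (Nat.succ_ne_zero _)
    have haβ : a ∈ gauss K β := by
      have h5 : (PowerSeries.C (2 * ((2 * n + 2 * g + 1 : ℕ) : K)⁻¹) : PowerSeries K) ∈
          gauss K (2 * n + 2 * g + 1 : ℕ) := C_mem_gauss (by
        rw [nnnorm_mul]
        have h22 : ‖(2 : K)‖₊ ≤ 1 := by
          simpa using IsUltrametricDist.nnnorm_natCast_le_one K 2
        calc _ ≤ 1 * ((2 * n + 2 * g + 1 : ℕ) : ℝ≥0) :=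
              mul_le_mul' h22 (hinv _ (Nat.succ_ne_zero _))
          _ = _ := one_mul _)
      have h6 := mul_mem_gauss hak h5
      rw [div_mul_cancel₀ _ (by exact_mod_cast Nat.succ_ne_zero (2 * n + 2 * g)), hκ, mul_assoc, ← map_mul] at h6
      have : ((2 * n + 2 * g + 1 : ℕ) : K) / 2 * (2 * ((2 * n + 2 * g + 1 : ℕ) : K)⁻¹) = 1 := by
        field_simp
      rwa [this, map_one, mul_one] at h6
    refine ih V₂ c (P - C a * E) hV₂d hc (by rw [hP, hVsplit]; ring) ?_ ?_
    · intro j hj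
      rw [coeff_sub, coeff_C_mul, hEhigh j hj]
      refine (gauss K _).sub_mem (hhigh j hj) ?_
      by_cases hjn : j ≤ n + 2 * g
      · rw [← mul_assoc]
        have := mul_mem_gauss hak (hY1 j)
        rw [mul_one] at this
        refine gauss_mono ?_ this
        refine div_le_div_of_nonneg_left zero_le (by exact_mod_cast Nat.succ_pos _) ?_
        exact_mod_cast (by omega)
      · rw [coeff_eq_zero_of_natDegree_lt (by omega), mul_zero, mul_zero]
        exact (gauss K _).zero_mem
    · intro j hj
      rw [coeff_sub, coeff_C_mul]
      refine (gauss K _).sub_mem (hlow j hj) ?_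
      simpa using mul_mem_gauss haβ (hEmem j)

end Infinity

/-! ### Bounds for the reduction of a differential -/

section Reduction

lemma degree_sum_pow_mul_lt {A : Type*} [CommRing A] [Nontrivial A] {Q : A[X]} (hQ : Q.Monic)
    {g : ℕ} (hdeg : Q.natDegree = 2 * g + 1) {t : ℕ → A[X]} (ht : ∀ i, (t i).natDegree ≤ 2 * g)
    (s : ℕ) : (∑ i ∈ Finset.range s, Q ^ i * t i).degree < (((2 * g + 1) * s : ℕ) : WithBot ℕ) := by
  refine (degree_sum_le _ _).trans_lt ?_
  rw [Finset.sup_lt_iff (WithBot.bot_lt_coe _)]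
  intro i hi
  have hi := Finset.mem_range.1 hi
  have h1 : (Q ^ i * t i).natDegree ≤ i * (2 * g + 1) + 2 * g :=
    natDegree_mul_le_of_le (by rw [hQ.natDegree_pow, hdeg]) (ht i)
  refine (degree_le_of_natDegree_le h1).trans_lt ?_
  have : i * (2 * g + 1) + 2 * g < (2 * g + 1) * s := by nlinarith
  exact_mod_cast this

variable {K : Type*} [NormedField K] [IsUltrametricDist K] [CharZero K]

/-- The identity is cut at `Q^s`. The digits below are governed by the poles at finite distance and
bound the lower part `Gp` of the primitive. What remains, divided by `Q^s`, has its pole only at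
infinity. The factor `(2g+1)(|k|+2)` dominates both the integers `2(s-i)-1` met at finite distance
and the integers `2(j-g)+1` met at infinity, where a digit of index `s+i` reaches degrees `j ≤
i(2g+1)+2g`. -/
lemma mem_pgauss_of_sum_eq_conn (hinv : ∀ j : ℕ, j ≠ 0 → ‖(j : K)⁻¹‖₊ ≤ j)
    (h2 : ‖(2 : K)⁻¹‖₊ ≤ 1) {Q b : (PowerSeries K)[X]} (hQ : Q.Monic) (hQ1 : Q ∈ pgauss K 1)
    {g : ℕ} (hdeg : Q.natDegree = 2 * g + 1) (hb1 : b ∈ pgauss K 1)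
    (hb : Q ∣ b * derivative Q - 1) (β : ℝ≥0) {s L : ℕ} (hsL : s ≤ L)
    {t w : ℕ → (PowerSeries K)[X]} (ht : ∀ i, (t i).natDegree ≤ 2 * g)
    (hw : ∀ i, (w i).natDegree ≤ 2 * g)
    (hwβ : ∀ i : ℕ, w i ∈ pgauss K
      (β / ((2 * g + 1) * ((2 * s + 1 - 2 * i : ℤ).natAbs + 2) : ℕ)))
    {c : (PowerSeries K)[X]} (hc : c.degree < (2 * g : ℕ))
    (hid : ∑ i ∈ Finset.range (L + 1), Q ^ i * w i =
      Q ^ s * c + conn Q (PowerSeries.C ((s : K) - 1 / 2)) (∑ i ∈ Finset.range L, Q ^ i * t i)) :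
    c ∈ pgauss K β := by
  have h22 : ‖(2 : K)‖₊ ≤ 1 := by
    simpa using IsUltrametricDist.nnnorm_natCast_le_one K 2
  obtain ⟨ξ, hξ1, hξ, hξQ⟩ := exists_horizontal hQ hQ1 hb1 hb s
  have hξ' := pow_dvd_derivative_of_dvd_comp hb hξ hξQ
  set μ : PowerSeries K := PowerSeries.C ((s : K) - 1 / 2) with hμ
  obtain ⟨e, rfl⟩ := Nat.exists_eq_add_of_le hsL
  set Gp := ∑ i ∈ Finset.range s, Q ^ i * t i with hGp
  set V := ∑ i ∈ Finset.range e, Q ^ i * t (s + i) with hV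
  set Wp := ∑ i ∈ Finset.range s, Q ^ i * w i with hWp
  set P₁ := ∑ i ∈ Finset.range (e + 1), Q ^ i * w (s + i) with hP₁
  have hG : ∑ i ∈ Finset.range (s + e), Q ^ i * t i = Gp + Q ^ s * V := by
    rw [Finset.sum_range_add, hV, Finset.mul_sum]
    simp only [pow_add, mul_assoc]; rfl
  have hW : ∑ i ∈ Finset.range (s + e + 1), Q ^ i * w i = Wp + Q ^ s * P₁ := by
    rw [add_assoc, Finset.sum_range_add, hP₁, Finset.mul_sum]
    simp only [pow_add, mul_assoc]; rfl
  have hhalf : (s : PowerSeries K) - μ = -PowerSeries.C (-1 / 2 : K) := by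
    rw [hμ, ← map_natCast PowerSeries.C s, ← map_sub, ← map_neg]
    congr 1; ring
  have hconnV : conn Q μ (Q ^ s * V) = Q ^ s * conn Q (PowerSeries.C (-1 / 2)) V := by
    rw [conn_pow_mul, hhalf, conn, C_neg]; ring
  rw [hG, hW, conn_add, hconnV] at hid
  have hwβ' : ∀ (i : ℕ) (γ : ℕ), 0 < γ →
      γ ≤ (2 * g + 1) * ((2 * s + 1 - 2 * i : ℤ).natAbs + 2) → w i ∈ pgauss K (β / γ) := by
    intro i γ hγ hle
    refine pgauss_mono ?_ (hwβ i)
    exact div_le_div_of_nonneg_left zero_le (by exact_mod_cast hγ) (by exact_mod_cast hle)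
  have hwβ1 : ∀ i, w i ∈ pgauss K β := fun i => by
    simpa using hwβ' i 1 one_pos (Nat.mul_pos (Nat.succ_pos _) (Nat.succ_pos _))
  obtain ⟨Z, hZ1, hZ2⟩ := exists_mem_pgauss_of_conn h22 hinv hQ hQ1 hb1 hb hξ1 hξ hξ' β s 0
    (Nat.zero_add s) (Gp + Q ^ s * V) w (fun i _ his => hwβ' i _ (by omega) (by
      have : 2 * (s - i) - 1 ≤ (2 * s + 1 - 2 * i : ℤ).natAbs + 2 := by omega
      nlinarith)) (by
      refine ⟨P₁ - c, ?_⟩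
      rw [pow_zero, one_mul, conn_add, hconnV, ← Finset.range_eq_Ico, ← hWp]
      linear_combination -hid)
  have hQs := hQ.pow s
  have hQs1 := pow_mem_pgauss hQ1 s
  have hQsd : (Q ^ s).degree = (((2 * g + 1) * s : ℕ) : WithBot ℕ) := by
    rw [degree_eq_natDegree hQs.ne_zero, hQ.natDegree_pow, hdeg, mul_comm]
  have hGpd : Gp.degree < _ := degree_sum_pow_mul_lt hQ hdeg ht s
  have hWpd : Wp.degree < _ := degree_sum_pow_mul_lt hQ hdeg hw s
  have hGp1 : Gp ∈ pgauss K β := by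
    -- `Gp` has degree below that of `Q^s`, so it is the remainder of the bounded element `Z`
    -- congruent to it.
    have h3 : Z %ₘ Q ^ s = Gp := by
      rw [← (modByMonic_eq_self_iff hQs).2 (hGpd.trans_eq hQsd.symm)]
      refine modByMonic_eq_of_dvd_sub hQs ?_
      obtain ⟨v, hv⟩ := hZ2
      exact ⟨V - v, by rw [pow_zero, one_mul] at hv; linear_combination -hv⟩
    rw [← h3]
    exact modByMonic_mem_pgauss hQs hQs1 hZ1
  -- The carry from the finite part into the part at infinity: of norm at most `β`, and of degree
  -- less than `2g`, where the reduction at infinity tolerates norm `β`.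
  set P₂ := c + conn Q (PowerSeries.C (-1 / 2)) V - P₁ with hP₂
  have hP₂e : Wp - conn Q μ Gp = Q ^ s * P₂ := by
    rw [hP₂]; linear_combination hid
  have hμ1 : μ ∈ gauss K 1 := by
    refine C_mem_gauss ((ball K 1).sub_mem (IsUltrametricDist.nnnorm_natCast_le_one K s) ?_)
    rw [one_div]; exact h2
  have hP₂1 : P₂ ∈ pgauss K β := by
    rw [← mul_divByMonic_cancel_left P₂ hQs, ← hP₂e]
    refine divByMonic_mem_pgauss hQs hQs1 ((pgauss K β).sub_mem ?_ ?_)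
    · exact (pgauss K β).sum_mem fun i _ =>
        mul_mem_pgauss_of_left (pow_mem_pgauss hQ1 i) (hwβ1 i)
    · exact (pgauss K β).sub_mem (mul_mem_pgauss_of_left hQ1 (derivative_mem_pgauss hGp1))
        (mul_mem_pgauss_of_left (C_mem_pgauss hμ1)
        (mul_mem_pgauss_of_left (derivative_mem_pgauss hQ1) hGp1))
  have hP₂d : P₂.degree < (2 * g : ℕ) := by
    by_cases hz : P₂ = 0
    · rw [hz, degree_zero]; exact WithBot.bot_lt_coe _
    have h3 : (Q ^ s * P₂).degree < (((2 * g + 1) * s + 2 * g : ℕ) : WithBot ℕ) := by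
      rw [← hP₂e]
      refine (degree_sub_le _ _).trans_lt (max_lt (hWpd.trans_le ?_) (degree_conn_lt hdeg μ hGpd))
      exact_mod_cast Nat.le_add_right _ _
    rw [degree_mul, hQsd, degree_eq_natDegree hz] at h3
    rw [degree_eq_natDegree hz]
    norm_cast at h3 ⊢
    omega
  refine mem_pgauss_of_conn_infinity hinv h2 hQ hQ1 hdeg β (V.natDegree + 1) V c (P₂ + P₁)
    (degree_le_natDegree.trans_lt (by exact_mod_cast Nat.lt_succ_self _)) hc
    (by rw [hP₂]; ring) ?_ ?_
  · intro j hj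
    rw [coeff_add, coeff_eq_zero_of_degree_lt (hP₂d.trans_le (by exact_mod_cast hj)), zero_add,
      hP₁, finsetSum_coeff]
    refine (gauss K _).sum_mem fun i _ => ?_
    have h3 : (Q ^ i * w (s + i)).natDegree ≤ i * (2 * g + 1) + 2 * g :=
      natDegree_mul_le_of_le (by rw [hQ.natDegree_pow, hdeg]) (hw _)
    by_cases hji : j ≤ i * (2 * g + 1) + 2 * g
    · refine mul_mem_pgauss_of_left (pow_mem_pgauss hQ1 i) (hwβ' _ _ (Nat.succ_pos _) ?_) j
      have h4 : 2 * i + 1 ≤ (2 * s + 1 - 2 * (s + i : ℕ) : ℤ).natAbs + 2 := by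
        push_cast; omega
      calc 2 * (j - g) + 1 ≤ (2 * g + 1) * (2 * i + 1) := by
            have : j - g ≤ i * (2 * g + 1) + g := by omega
            nlinarith
        _ ≤ _ := Nat.mul_le_mul_left _ h4
    · rw [coeff_eq_zero_of_natDegree_lt (by omega)]
      exact (gauss K _).zero_mem
  · intro j _
    refine (pgauss K β).add_mem hP₂1 ((pgauss K β).sum_mem fun i _ => ?_) j
    exact mul_mem_pgauss_of_left (pow_mem_pgauss hQ1 i) (hwβ1 _)

end Reduction

/-! ### From series in `√Q` to polynomial identities. -/

section Differential

variable {K : Type*} [NormedField K]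

/-- The term `(k / 2) t Q'` in the differential of `t / √Q^k`. -/
def poleTerm (Q : K[X][X]) (k : ℤ) (t : (PowerSeries K)[X]) : (PowerSeries K)[X] :=
  C (PowerSeries.C ((k : K) / 2)) * (t * derivative (toSeries Q))

lemma d_apply (Q : K[X][X]) (t : ℤ → (PowerSeries K)[X]) (k : ℤ) :
    d Q t k = derivative (t k) - poleTerm Q k (t k) /ₘ toSeries Q -
      poleTerm Q (k - 2) (t (k - 2)) %ₘ toSeries Q := rfl

/-- Multiplied by a power of `√Q`, the differential of a finite sum becomes `conn`. -/
lemma sum_pow_mul_d [CharZero K] (Q : K[X][X]) (τ : ℤ → (PowerSeries K)[X]) (s L : ℕ)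
    (h1 : τ (2 * s + 1) = 0) (h2 : τ (2 * s - 1 - 2 * L) = 0) :
    ∑ i ∈ Finset.range (L + 1), toSeries Q ^ i * d Q τ (2 * s + 1 - 2 * i) =
      conn (toSeries Q) (PowerSeries.C ((s : K) - 1 / 2))
        (∑ i ∈ Finset.range L, toSeries Q ^ i * τ (2 * s - 1 - 2 * i)) := by
  set Q₁ := toSeries Q with hQ₁
  have hstep : ∀ i : ℕ, (2 * s + 1 - 2 * (i + 1 : ℕ) : ℤ) = 2 * s - 1 - 2 * i := fun i => by
    push_cast; ring
  have hd : ∀ i : ℕ, d Q τ (2 * s + 1 - 2 * i) =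
      (derivative (τ (2 * s + 1 - 2 * i)) -
        poleTerm Q (2 * s + 1 - 2 * i) (τ (2 * s + 1 - 2 * i)) /ₘ Q₁) -
      poleTerm Q (2 * s - 1 - 2 * i) (τ (2 * s - 1 - 2 * i)) %ₘ Q₁ := fun i => by
    rw [d_apply, show (2 * s + 1 - 2 * i - 2 : ℤ) = 2 * s - 1 - 2 * i by ring]
  have hL : poleTerm Q (2 * s - 1 - 2 * L) (τ (2 * s - 1 - 2 * L)) = 0 := by
    rw [h2]; simp [poleTerm]
  have h0 : poleTerm Q (2 * s + 1 - 2 * (0 : ℕ)) (τ (2 * s + 1 - 2 * (0 : ℕ))) = 0 := by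
    simp [poleTerm, h1]
  simp only [hd, mul_sub, Finset.sum_sub_distrib]
  -- The remainder of a pole term occurs with `Q^i` and its quotient with `Q^(i+1)`. Shifting one
  -- sum by one index reunites them; the two boundary terms vanish by `h1` and `h2`.
  rw [← Finset.sum_sub_distrib, Finset.sum_range_succ', Finset.sum_range_succ, hL, h0]
  simp only [hstep]
  rw [conn_sum]
  simp only [zero_divByMonic, zero_modByMonic, mul_zero, add_zero, Nat.cast_zero, sub_zero, h1,
    derivative_zero]
  rw [← Finset.sum_sub_distrib]
  refine Finset.sum_congr rfl fun i _ => ?_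
  rw [conn_pow_mul]
  have hm := modByMonic_add_div (poleTerm Q (2 * s - 1 - 2 * i) (τ (2 * s - 1 - 2 * i))) Q₁
  have hp : poleTerm Q (2 * s - 1 - 2 * i) (τ (2 * s - 1 - 2 * i)) =
      -C ((i : PowerSeries K) - PowerSeries.C ((s : K) - 1 / 2)) *
        (derivative Q₁ * τ (2 * s - 1 - 2 * i)) := by
    rw [poleTerm, ← C_neg, neg_sub, ← map_natCast PowerSeries.C i, ← map_sub,
      mul_comm (τ _)]
    congr 3
    push_cast; ring
  linear_combination (-Q₁ ^ i) * hm - Q₁ ^ i * hp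

lemma natDegree_d_le {Q : K[X][X]} (hQ : (toSeries Q).Monic) {g : ℕ}
    (hdeg : (toSeries Q).natDegree = 2 * g + 1) {τ : ℤ → (PowerSeries K)[X]}
    (hτ : ∀ k, (τ k).natDegree ≤ 2 * g) (k : ℤ) : (d Q τ k).natDegree ≤ 2 * g := by
  have hQne : toSeries Q ≠ 1 := by
    intro h; rw [h, natDegree_one] at hdeg; omega
  rw [d_apply]
  have h1 : (derivative (τ k)).natDegree ≤ 2 * g :=
    (natDegree_derivative_le _).trans ((Nat.sub_le _ _).trans (hτ k))
  have h2 : (poleTerm Q k (τ k) /ₘ toSeries Q).natDegree ≤ 2 * g := by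
    rw [natDegree_divByMonic _ hQ, hdeg]
    have : (poleTerm Q k (τ k)).natDegree ≤ 2 * g + 2 * g := by
      refine (natDegree_C_mul_le _ _).trans (natDegree_mul_le_of_le (hτ k) ?_)
      exact (natDegree_derivative_le _).trans (by omega)
    omega
  have h3 : (poleTerm Q (k - 2) (τ (k - 2)) %ₘ toSeries Q).natDegree ≤ 2 * g := by
    have := natDegree_modByMonic_lt (poleTerm Q (k - 2) (τ (k - 2))) hQ hQne
    omega
  exact (natDegree_sub_le_of_le (natDegree_sub_le_of_le h1 h2) h3).trans (by simp)

lemma sum_basisForm_of_ne {g : ℕ} (c : Fin (2 * g) → PowerSeries K) {k : ℤ} (hk : k ≠ 1) :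
    ∑ l, C (c l) * basisForm (l : ℕ) k = 0 :=
  Finset.sum_eq_zero fun l _ => by rw [basisForm, if_neg hk, mul_zero]

lemma sum_basisForm_one {g : ℕ} (c : Fin (2 * g) → PowerSeries K) :
    ∑ l, C (c l) * basisForm (l : ℕ) 1 = ∑ l, C (c l) * X ^ (l : ℕ) := by
  simp [basisForm]

lemma coeff_sum_C_mul_X_pow {g : ℕ} (c : Fin (2 * g) → PowerSeries K) (l : Fin (2 * g)) :
    (∑ l, C (c l) * X ^ (l : ℕ)).coeff l = c l := by
  rw [finsetSum_coeff, Finset.sum_eq_single l]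
  · simp
  · intro l' _ hl
    rw [coeff_C_mul_X_pow, if_neg (fun h => hl (Fin.ext h.symm))]
  · simp

lemma degree_sum_C_mul_X_pow_lt {g : ℕ} (c : Fin (2 * g) → PowerSeries K) :
    (∑ l, C (c l) * X ^ (l : ℕ)).degree < ((2 * g : ℕ) : WithBot ℕ) := by
  refine (degree_sum_le _ _).trans_lt ?_
  rw [Finset.sup_lt_iff (WithBot.bot_lt_coe _)]
  intro l _
  refine (degree_C_mul_X_pow_le _ _).trans_lt ?_
  exact_mod_cast l.2

variable [IsUltrametricDist K]

/-- Bounds for the coordinates of a cohomology class represented by `W`. -/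
lemma mem_gauss_of_eq_add_d [CharZero K] (hinv : ∀ j : ℕ, j ≠ 0 → ‖(j : K)⁻¹‖₊ ≤ j)
    (h2 : ‖(2 : K)⁻¹‖₊ ≤ 1) {Q : K[X][X]} {b : (PowerSeries K)[X]} (hQ : (toSeries Q).Monic)
    (hQ1 : toSeries Q ∈ pgauss K 1) {g : ℕ} (hdeg : (toSeries Q).natDegree = 2 * g + 1)
    (hb1 : b ∈ pgauss K 1) (hb : toSeries Q ∣ b * derivative (toSeries Q) - 1)
    {β : ℝ≥0} (hβ : 0 < β) {t W : ℤ → (PowerSeries K)[X]} {B θ : ℝ≥0} (hθ : θ < 1)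
    (ht : ∀ k, (t k).natDegree ≤ 2 * g) (htθ : ∀ k, t k ∈ pgauss K (B * θ ^ k.natAbs))
    (hWβ : ∀ k, W k ∈ pgauss K (β / ((2 * g + 1) * (k.natAbs + 2) : ℕ)))
    {c : Fin (2 * g) → PowerSeries K}
    (heq : ∀ k, W k = ∑ l, C (c l) * basisForm (l : ℕ) k + d Q t k) (l : Fin (2 * g)) :
    c l ∈ gauss K β := by
  -- a bound beyond which the tail of `t` is negligible
  obtain ⟨n, hn⟩ : ∃ n : ℕ, B * θ ^ n * ((2 * g + 1) * (n + 5) : ℕ) ≤ β := by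
    have h3 : Filter.Tendsto (fun n : ℕ => (B : ℝ) * (2 * g + 1) * (n ^ 1 * (θ : ℝ) ^ n) +
        (B : ℝ) * (2 * g + 1) * 5 * (θ : ℝ) ^ n) Filter.atTop (nhds 0) := by
      have h4 := tendsto_pow_const_mul_const_pow_of_abs_lt_one 1 (r := (θ : ℝ))
        (by rw [NNReal.abs_eq]; exact_mod_cast hθ)
      have h5 := tendsto_pow_atTop_nhds_zero_of_lt_one θ.2 (by exact_mod_cast hθ)
      simpa using (h4.const_mul ((B : ℝ) * (2 * g + 1))).add
        (h5.const_mul ((B : ℝ) * (2 * g + 1) * 5))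
    obtain ⟨n, hn⟩ := (h3.eventually (ge_mem_nhds (show (0 : ℝ) < β by exact_mod_cast hβ))).exists
    refine ⟨n, ?_⟩
    rw [← NNReal.coe_le_coe]
    push_cast
    refine le_trans (le_of_eq ?_) hn
    ring
  -- Truncating `t` at `|k| ≤ n + 1` disturbs the differential only at indices `|k| ≤ n + 3`, by
  -- terms of size at most `B θ^n`.
  have hsmall : ∀ (u : (PowerSeries K)[X]) (m k : ℕ), u ∈ pgauss K (B * θ ^ m) → n ≤ m →
      k ≤ n + 3 → u ∈ pgauss K (β / ((2 * g + 1) * (k + 2) : ℕ)) := by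
    intro u m k hu hm hk
    refine pgauss_mono ?_ hu
    rw [le_div_iff₀ (by exact_mod_cast Nat.mul_pos (Nat.succ_pos _) (Nat.succ_pos _))]
    refine le_trans ?_ hn
    refine mul_le_mul' (mul_le_mul' le_rfl (pow_le_pow_of_le_one zero_le hθ.le hm)) ?_
    exact_mod_cast Nat.mul_le_mul_left _ (by omega)
  -- The coordinates `c` stay fixed while `t` becomes a finite sum; the change is absorbed into the
  -- representative `W'`, which satisfies the same bounds as `W`.
  set τ : ℤ → (PowerSeries K)[X] := fun k => if k.natAbs ≤ n + 1 then t k else 0 with hτ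
  have hτ1 : ∀ k : ℤ, k.natAbs ≤ n + 1 → τ k = t k := fun k hk => if_pos hk
  have hτ0 : ∀ k : ℤ, ¬ k.natAbs ≤ n + 1 → τ k = 0 := fun k hk => if_neg hk
  have hpole : ∀ k, poleTerm Q k (t k) %ₘ toSeries Q ∈ pgauss K (B * θ ^ k.natAbs) := by
    intro k
    refine modByMonic_mem_pgauss hQ hQ1 (mul_mem_pgauss_of_left (C_mem_pgauss (C_mem_gauss ?_)) ?_)
    · rw [div_eq_mul_inv, nnnorm_mul]
      calc _ ≤ (1 : ℝ≥0) * 1 := mul_le_mul' (IsUltrametricDist.nnnorm_intCast_le_one K k) h2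
        _ = 1 := one_mul 1
    · rw [mul_comm (t k)]
      exact mul_mem_pgauss_of_left (derivative_mem_pgauss hQ1) (htθ k)
  have hp0 : ∀ k, poleTerm Q k 0 = 0 := fun k => by simp [poleTerm]
  set W' : ℤ → (PowerSeries K)[X] := fun k => ∑ l, C (c l) * basisForm (l : ℕ) k + d Q τ k with hW'
  have hW'β : ∀ k, W' k ∈ pgauss K (β / ((2 * g + 1) * (k.natAbs + 2) : ℕ)) := by
    intro k
    by_cases hk : k.natAbs ≤ n + 1
    · by_cases hk2 : (k - 2).natAbs ≤ n + 1
      · have : W' k = W k := by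
          rw [hW', heq]; simp only [d_apply]; rw [hτ1 _ hk, hτ1 _ hk2]
        rw [this]; exact hWβ k
      · have : W' k = W k + poleTerm Q (k - 2) (t (k - 2)) %ₘ toSeries Q := by
          rw [hW', heq]; simp only [d_apply]; rw [hτ1 _ hk, hτ0 _ hk2, hp0, zero_modByMonic]; ring
        rw [this]
        exact (pgauss K _).add_mem (hWβ k) (hsmall _ _ _ (hpole _) (by omega) (by omega))
    · have hω : ∑ l, C (c l) * basisForm (l : ℕ) k = 0 :=
        sum_basisForm_of_ne c (by rintro rfl; simp at hk)
      by_cases hk2 : (k - 2).natAbs ≤ n + 1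
      · have : W' k = -(poleTerm Q (k - 2) (t (k - 2)) %ₘ toSeries Q) := by
          rw [hW']; simp only [d_apply]
          rw [hω, hτ0 _ hk, hτ1 _ hk2, hp0, zero_divByMonic, derivative_zero]; ring
        rw [this]
        exact (pgauss K _).neg_mem (hsmall _ _ _ (hpole _) (by omega) (by omega))
      · have : W' k = 0 := by
          rw [hW']; simp only [d_apply]
          rw [hω, hτ0 _ hk, hτ0 _ hk2, hp0, hp0, zero_divByMonic, zero_modByMonic,
            derivative_zero]; ring
        rw [this]
        exact (pgauss K _).zero_mem
  have hτd : ∀ k, (τ k).natDegree ≤ 2 * g := by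
    intro k
    by_cases hk : k.natAbs ≤ n + 1
    · rw [hτ1 k hk]; exact ht k
    · rw [hτ0 k hk]; simp
  have hdd := natDegree_d_le hQ hdeg hτd
  have hcd := degree_sum_C_mul_X_pow_lt c
  have hW'd : ∀ k, (W' k).natDegree ≤ 2 * g := by
    intro k
    refine natDegree_add_le_of_degree_le (n := 2 * g) ?_ (hdd k)
    by_cases hk : k = 1
    · rw [hk, sum_basisForm_one]
      exact natDegree_le_of_degree_le hcd.le
    · rw [sum_basisForm_of_ne c hk]; simp
  -- Large enough that all odd indices in the support of `τ` lie strictly inside the window. Even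
  -- indices play no role, as `d` links `k` only with `k - 2`.
  set s := n + 2 with hs
  have hfin := mem_pgauss_of_sum_eq_conn hinv h2 hQ hQ1 hdeg hb1 hb β (s := s) (L := 2 * s + 1)
    (by omega) (t := fun i => τ (2 * s - 1 - 2 * i)) (w := fun i => W' (2 * s + 1 - 2 * i))
    (fun i => hτd _) (fun i => hW'd _) (fun i => hW'β _) hcd (by
      rw [← sum_pow_mul_d Q τ s (2 * s + 1) (hτ0 _ (by omega)) (hτ0 _ (by push_cast; omega))]
      simp only [hW', mul_add, Finset.sum_add_distrib]
      congr 1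
      rw [Finset.sum_eq_single s]
      · rw [show (2 * s + 1 - 2 * s : ℤ) = 1 by ring, sum_basisForm_one]
      · intro i _ hi
        rw [sum_basisForm_of_ne c (by omega), mul_zero]
      · intro h; exact absurd (Finset.mem_range.2 (by omega)) h)
  rw [← coeff_sum_C_mul_X_pow c l]
  exact hfin l

end Differential

/-! ### The resultant -/

section Sylvester

variable {R : Type*} [CommRing R] {𝓕 : ℕ → AddSubgroup R}

/-- The filtration is left abstract so that Cramer's rule for the Sylvester matrix yields both
degree bounds in `Γ` and integrality. -/
lemma prod_mem_filtration (h1 : ∀ n, (1 : R) ∈ 𝓕 n)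
    (hmul : ∀ a b x y, x ∈ 𝓕 a → y ∈ 𝓕 b → x * y ∈ 𝓕 (a + b)) {ι : Type*} (s : Finset ι)
    {f : ι → R} {κ : ℕ} (hf : ∀ i, f i ∈ 𝓕 κ) : ∏ i ∈ s, f i ∈ 𝓕 (s.card * κ) := by
  classical
  induction s using Finset.induction_on with
  | empty => simpa using h1 _
  | insert a s ha ih =>
    rw [Finset.prod_insert ha, Finset.card_insert_of_notMem ha, add_mul, one_mul, add_comm]
    exact hmul _ _ _ _ (hf a) ih

lemma det_mem_filtration (h1 : ∀ n, (1 : R) ∈ 𝓕 n)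
    (hmul : ∀ a b x y, x ∈ 𝓕 a → y ∈ 𝓕 b → x * y ∈ 𝓕 (a + b)) {n κ : ℕ}
    {M : Matrix (Fin n) (Fin n) R} (hM : ∀ i j, M i j ∈ 𝓕 κ) : M.det ∈ 𝓕 (n * κ) := by
  rw [Matrix.det_apply]
  refine (𝓕 _).sum_mem fun σ _ => ?_
  rw [Units.smul_def]
  refine (𝓕 _).zsmul_mem ?_ _
  simpa using prod_mem_filtration h1 hmul Finset.univ (f := fun i => M (σ i) i) (κ := κ)
    (fun i => hM _ _)

lemma adjugate_mem_filtration (h1 : ∀ n, (1 : R) ∈ 𝓕 n)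
    (hmul : ∀ a b x y, x ∈ 𝓕 a → y ∈ 𝓕 b → x * y ∈ 𝓕 (a + b)) {n κ : ℕ}
    {M : Matrix (Fin n) (Fin n) R} (hM : ∀ i j, M i j ∈ 𝓕 κ) (i j : Fin n) :
    M.adjugate i j ∈ 𝓕 (n * κ) := by
  rw [Matrix.adjugate_apply]
  refine det_mem_filtration h1 hmul fun a b => ?_
  rw [Matrix.updateRow_apply]
  split_ifs
  · rw [Pi.single_apply]
    split_ifs
    · exact h1 _
    · exact (𝓕 κ).zero_mem
  · exact hM a b

lemma sylvester_mem_filtration {f g : R[X]} {m n κ : ℕ} (hf : ∀ i, f.coeff i ∈ 𝓕 κ)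
    (hg : ∀ i, g.coeff i ∈ 𝓕 κ) (i j : Fin (m + n)) : sylvester f g m n i j ∈ 𝓕 κ := by
  induction j using Fin.addCases with
  | left j =>
    simp only [sylvester, Matrix.of_apply, Fin.addCases_left]
    split_ifs
    · exact hg _
    · exact (𝓕 κ).zero_mem
  | right j =>
    simp only [sylvester, Matrix.of_apply, Fin.addCases_right]
    split_ifs
    · exact hf _
    · exact (𝓕 κ).zero_mem

/-- Bézout's identity with control on the coefficients. -/
lemma exists_bezout_mem_filtration (h1 : ∀ n, (1 : R) ∈ 𝓕 n)
    (hmul : ∀ a b x y, x ∈ 𝓕 a → y ∈ 𝓕 b → x * y ∈ 𝓕 (a + b)) {f g : R[X]} {m n κ : ℕ}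
    (hfm : f.natDegree ≤ m) (hgn : g.natDegree ≤ n) (hf : ∀ i, f.coeff i ∈ 𝓕 κ)
    (hg : ∀ i, g.coeff i ∈ 𝓕 κ) {A : R[X]} (hA : A.degree < (m + n : ℕ)) {D : ℕ}
    (hAD : ∀ i, A.coeff i ∈ 𝓕 D) :
    ∃ u v : R[X], u.degree < n ∧ v.degree < m ∧ C (resultant f g m n) * A = f * u + g * v ∧
      (∀ i, u.coeff i ∈ 𝓕 ((m + n) * κ + D)) ∧ ∀ i, v.coeff i ∈ 𝓕 ((m + n) * κ + D) := by
  set A' : degreeLT R (m + n) := ⟨A, mem_degreeLT.2 hA⟩ with hA'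
  -- The adjugate Sylvester matrix applied to the coefficient vector of `A`: a Bézout pair for `Res
  -- · A` whose coefficients are visibly polynomial in those of `f`, `g` and `A`.
  set Y := adjSylvester (m := m) (n := n) f g A' with hY
  have hid : (sylvesterMap f g hfm hgn Y).1 = _ :=
    congr(($(sylveserMap_comp_adjSylvester f g hfm hgn) A').1)
  have hmv := LinearMap.toMatrix_mulVec_repr (degreeLT.basis R (m + n))
    (((degreeLT.basis R m).prod (degreeLT.basis R n)).reindex finSumFinEquiv)
    (adjSylvester (m := m) (n := n) f g) A'
  have hY2 : adjSylvester (m := m) (n := n) f g A' = Y := rfl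
  rw [hY2, adjSylvester, LinearMap.toMatrix_toLin] at hmv
  have hmem : ∀ i, ((sylvester f g m n).adjugate.mulVec
      ((degreeLT.basis R (m + n)).repr A')) i ∈ 𝓕 ((m + n) * κ + D) := by
    intro i
    simp only [Matrix.mulVec, dotProduct]
    refine (𝓕 _).sum_mem fun j _ => hmul _ _ _ _
      (adjugate_mem_filtration h1 hmul (sylvester_mem_filtration hf hg) i j) ?_
    rw [degreeLT.basis_repr]
    exact hAD j
  rw [hmv] at hmem
  refine ⟨Y.2, Y.1, mem_degreeLT.1 Y.2.2, mem_degreeLT.1 Y.1.2, ?_, fun i => ?_, fun i => ?_⟩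
  · have : f * Y.2.1 + g * Y.1.1 = _ := hid
    rw [this]
    simp [Algebra.smul_def, hA']
  · by_cases hi : i < n
    · have := hmem (finSumFinEquiv (Sum.inr ⟨i, hi⟩))
      rwa [Module.Basis.repr_reindex_apply, Equiv.symm_apply_apply, Module.Basis.prod_repr_inr,
        degreeLT.basis_repr] at this
    · rw [coeff_eq_zero_of_degree_lt ((mem_degreeLT.1 Y.2.2).trans_le
        (by exact_mod_cast not_lt.1 hi))]
      exact (𝓕 _).zero_mem
  · by_cases hi : i < m
    · have := hmem (finSumFinEquiv (Sum.inl ⟨i, hi⟩))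
      rwa [Module.Basis.repr_reindex_apply, Equiv.symm_apply_apply, Module.Basis.prod_repr_inl,
        degreeLT.basis_repr] at this
    · rw [coeff_eq_zero_of_degree_lt ((mem_degreeLT.1 Y.1.2).trans_le
        (by exact_mod_cast not_lt.1 hi))]
      exact (𝓕 _).zero_mem

end Sylvester

/-! ### Degree and integrality of the resultant and of Bézout coefficients. -/

section Family

variable {K : Type*} [NormedField K]

/-- The filtration of `K[Γ]` by the degree. -/
def degFiltration (K : Type*) [NormedField K] (n : ℕ) : AddSubgroup K[X] :=
  (degreeLE K n).toAddSubgroup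

lemma mem_degFiltration {n : ℕ} {p : K[X]} : p ∈ degFiltration K n ↔ p.natDegree ≤ n := by
  rw [natDegree_le_iff_degree_le]; exact mem_degreeLE

lemma degFiltration_mono {m n : ℕ} (h : m ≤ n) : degFiltration K m ≤ degFiltration K n :=
  fun _ hp => mem_degFiltration.2 ((mem_degFiltration.1 hp).trans h)

/-- Polynomials in `Γ` with integral coefficients. -/
def integralPoly (K : Type*) [NormedField K] [IsUltrametricDist K] : AddSubgroup K[X] where
  carrier := {p | ∀ n, p.coeff n ∈ ball K 1}
  zero_mem' n := by simp [(ball K 1).zero_mem]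
  add_mem' {x y} hx hy n := by rw [coeff_add]; exact (ball K 1).add_mem (hx n) (hy n)
  neg_mem' {x} hx n := by rw [coeff_neg]; exact (ball K 1).neg_mem (hx n)

lemma mul_mem_integralPoly [IsUltrametricDist K] {x y : K[X]} (hx : x ∈ integralPoly K)
    (hy : y ∈ integralPoly K) : x * y ∈ integralPoly K := by
  intro n
  rw [coeff_mul]
  exact (ball K _).sum_mem fun z _ => by simpa using mul_mem_ball (hx z.1) (hy z.2)

lemma one_mem_integralPoly [IsUltrametricDist K] : (1 : K[X]) ∈ integralPoly K := by
  intro n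
  rw [coeff_one]
  split_ifs
  · simp [mem_ball]
  · exact (ball K 1).zero_mem

lemma derivative_coeff_mem_integralPoly [IsUltrametricDist K] {Q : K[X][X]}
    (h : ∀ i, Q.coeff i ∈ integralPoly K) (i : ℕ) : (derivative Q).coeff i ∈ integralPoly K := by
  rw [coeff_derivative]
  refine mul_mem_integralPoly (h _) ?_
  have : ((i : K[X]) + 1) = ((i + 1 : ℕ) : K[X]) := by push_cast; rfl
  rw [this, ← nsmul_one]
  exact (integralPoly K).nsmul_mem one_mem_integralPoly _

lemma natDegree_coeff_le_degΓ (Q : K[X][X]) (i : ℕ) : (Q.coeff i).natDegree ≤ degΓ Q := by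
  by_cases h : Q.coeff i = 0
  · rw [h]; simp
  · exact Finset.le_sup (f := fun i => (Q.coeff i).natDegree) (mem_support_iff.2 h)

lemma natDegree_coeff_derivative_le_degΓ (Q : K[X][X]) (i : ℕ) :
    ((derivative Q).coeff i).natDegree ≤ degΓ Q := by
  rw [coeff_derivative]
  refine (natDegree_mul_le_of_le (natDegree_coeff_le_degΓ Q _) (n := 0) ?_)
  exact_mod_cast (natDegree_natCast (i + 1)).le

variable {g : ℕ} {Q : K[X][X]} (hQ : IsFamily g Q)
include hQ

lemma IsFamily.natDegree_derivative [CharZero K] : (derivative Q).natDegree = 2 * g := by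
  rw [Polynomial.natDegree_derivative, hQ.natDegree_eq, Nat.add_sub_cancel]

lemma IsFamily.res_eq [CharZero K] :
    res Q = resultant Q (derivative Q) (2 * g + 1) (2 * g) := by
  rw [res, hQ.natDegree_derivative, hQ.natDegree_eq]

/-- `r A` lies in the ideal generated by `Q` and `Q'`, with bounded degrees in `Γ`. -/
lemma IsFamily.exists_bezout_natDegree_le [CharZero K] {A : K[X][X]} (hA : A.natDegree ≤ 2 * g)
    {D : ℕ} (hD : ∀ i, (A.coeff i).natDegree ≤ D) :
    ∃ u v : K[X][X], u.degree < ((2 * g : ℕ) : WithBot ℕ) ∧ v.natDegree ≤ 2 * g ∧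
      C (res Q) * A = Q * u + derivative Q * v ∧
      (∀ i, (u.coeff i).natDegree ≤ (4 * g + 1) * degΓ Q + D) ∧
      ∀ i, (v.coeff i).natDegree ≤ (4 * g + 1) * degΓ Q + D := by
  obtain ⟨u, v, h1, h2, h3, h4, h5⟩ := exists_bezout_mem_filtration (𝓕 := degFiltration K)
    (f := Q) (g := derivative Q) (m := 2 * g + 1) (n := 2 * g) (κ := degΓ Q) (A := A) (D := D)
    (fun n => mem_degFiltration.2 (by simp))
    (fun a b x y hx hy => mem_degFiltration.2
      (natDegree_mul_le_of_le (mem_degFiltration.1 hx) (mem_degFiltration.1 hy)))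
    hQ.natDegree_eq.le hQ.natDegree_derivative.le
    (fun i => mem_degFiltration.2 (natDegree_coeff_le_degΓ Q i))
    (fun i => mem_degFiltration.2 (natDegree_coeff_derivative_le_degΓ Q i))
    ((degree_le_of_natDegree_le hA).trans_lt (by exact_mod_cast (by omega)))
    (fun i => mem_degFiltration.2 (hD i))
  have e : 2 * g + 1 + 2 * g = 4 * g + 1 := by ring
  rw [e] at h4 h5
  refine ⟨u, v, h1, ?_, by rw [hQ.res_eq]; exact h3, fun i => mem_degFiltration.1 (h4 i),
    fun i => mem_degFiltration.1 (h5 i)⟩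
  refine natDegree_le_iff_degree_le.2 (Order.le_of_lt_succ ?_)
  exact h2

lemma IsFamily.natDegree_res_le [CharZero K] : (res Q).natDegree ≤ (4 * g + 1) * degΓ Q := by
  rw [hQ.res_eq, resultant, ← mem_degFiltration]
  have := det_mem_filtration (𝓕 := degFiltration K) (κ := degΓ Q)
    (fun n => mem_degFiltration.2 (by simp))
    (fun a b x y hx hy => mem_degFiltration.2
      (natDegree_mul_le_of_le (mem_degFiltration.1 hx) (mem_degFiltration.1 hy)))
    (sylvester_mem_filtration (m := 2 * g + 1) (n := 2 * g) (f := Q) (g := derivative Q)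
      (fun i => mem_degFiltration.2 (natDegree_coeff_le_degΓ Q i))
      (fun i => mem_degFiltration.2 (natDegree_coeff_derivative_le_degΓ Q i)))
  refine degFiltration_mono ?_ this
  exact Nat.mul_le_mul_right _ (by omega)

variable [IsUltrametricDist K]

lemma IsFamily.coeff_mem_integralPoly (i : ℕ) : Q.coeff i ∈ integralPoly K :=
  fun j => hQ.integral i j

lemma IsFamily.res_mem_integralPoly [CharZero K] : res Q ∈ integralPoly K := by
  rw [hQ.res_eq, resultant]
  exact det_mem_filtration (𝓕 := fun _ => integralPoly K) (κ := 0)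
    (fun _ => one_mem_integralPoly) (fun _ _ _ _ => mul_mem_integralPoly)
    (sylvester_mem_filtration (𝓕 := fun _ => integralPoly K) (κ := 0) hQ.coeff_mem_integralPoly
      (derivative_coeff_mem_integralPoly hQ.coeff_mem_integralPoly))

lemma IsFamily.exists_bezout_integral [CharZero K] :
    ∃ u v : K[X][X], C (res Q) = Q * u + derivative Q * v ∧
      ∀ i, v.coeff i ∈ integralPoly K := by
  obtain ⟨u, v, h1, h2, h3, h4, h5⟩ := exists_bezout_mem_filtration
    (𝓕 := fun _ => integralPoly K) (A := 1) (D := 0) (κ := 0)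
    (f := Q) (g := derivative Q) (m := 2 * g + 1) (n := 2 * g)
    (fun _ => one_mem_integralPoly) (fun _ _ _ _ => mul_mem_integralPoly)
    hQ.natDegree_eq.le hQ.natDegree_derivative.le hQ.coeff_mem_integralPoly
    (derivative_coeff_mem_integralPoly hQ.coeff_mem_integralPoly)
    (degree_one_le.trans_lt (by exact_mod_cast (by omega)))
    (fun i => by
      rw [coeff_one]; split_ifs
      · exact one_mem_integralPoly
      · exact (integralPoly K).zero_mem)
  exact ⟨u, v, by rw [hQ.res_eq, ← h3, mul_one], h5⟩

omit hQ in
lemma toSeries_mem_pgauss {P : K[X][X]} (h : ∀ i, P.coeff i ∈ integralPoly K) :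
    toSeries P ∈ pgauss K 1 := by
  intro i n
  rw [toSeries, coeff_map, coeToPowerSeries.ringHom_apply, coeff_coe]
  exact h i n

omit hQ [IsUltrametricDist K] in
lemma derivative_toSeries (P : K[X][X]) : derivative (toSeries P) = toSeries (derivative P) := by
  rw [toSeries, derivative_map]; rfl

lemma IsFamily.toSeries_mem_pgauss : toSeries Q ∈ pgauss K 1 :=
  HyperellipticFamily.toSeries_mem_pgauss hQ.coeff_mem_integralPoly

omit [IsUltrametricDist K] in
lemma IsFamily.monic_toSeries : (toSeries Q).Monic := hQ.monic.map _

omit [IsUltrametricDist K] in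
lemma IsFamily.natDegree_toSeries : (toSeries Q).natDegree = 2 * g + 1 := by
  rw [toSeries, hQ.monic.natDegree_map, hQ.natDegree_eq]

lemma IsFamily.res_coe_mem_gauss [CharZero K] : (res Q : PowerSeries K) ∈ gauss K 1 := by
  intro n
  rw [coeff_coe]
  exact hQ.res_mem_integralPoly n

omit [IsUltrametricDist K] in
lemma IsFamily.norm_constantCoeff_res :
    ‖PowerSeries.constantCoeff (res Q : PowerSeries K)‖ = 1 := by
  rw [constantCoeff_coe, coeff_zero_eq_eval_zero]; exact hQ.res_zero

omit [IsUltrametricDist K] in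
lemma IsFamily.res_mul_inv :
    (res Q : PowerSeries K) * (res Q : PowerSeries K)⁻¹ = 1 :=
  PowerSeries.mul_inv_cancel _ (by
    intro h
    have := hQ.norm_constantCoeff_res
    rw [h, norm_zero] at this
    exact zero_ne_one this)

lemma IsFamily.res_inv_mem_gauss [CharZero K] : (res Q : PowerSeries K)⁻¹ ∈ gauss K 1 :=
  inv_mem_gauss hQ.res_coe_mem_gauss hQ.norm_constantCoeff_res

/-- `Q'` is invertible modulo `Q`. -/
lemma IsFamily.exists_inverse_derivative [CharZero K] :
    ∃ b ∈ pgauss K 1, toSeries Q ∣ b * derivative (toSeries Q) - 1 := by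
  obtain ⟨u, v, h1, h2⟩ := hQ.exists_bezout_integral
  set ρ := (res Q : PowerSeries K)⁻¹ with hρ
  refine ⟨C ρ * toSeries v, mul_mem_pgauss_of_left (C_mem_pgauss hQ.res_inv_mem_gauss)
    (HyperellipticFamily.toSeries_mem_pgauss h2), -(C ρ * toSeries u), ?_⟩
  have h3 : C (res Q : PowerSeries K) =
      toSeries Q * toSeries u + toSeries (derivative Q) * toSeries v := by
    have := congrArg (Polynomial.map coeToPowerSeries.ringHom) h1
    rw [map_C, Polynomial.map_add, Polynomial.map_mul, Polynomial.map_mul] at this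
    exact this
  have h4 : C (res Q : PowerSeries K) * C ρ = 1 := by
    rw [← C_mul, hQ.res_mul_inv, map_one]
  rw [derivative_toSeries]
  linear_combination h4 - C ρ * h3

end Family

/-! ### Expansions in base `Q` -/

section Digits

variable {A : Type*} [CommRing A] [Nontrivial A] {Q : A[X]}

lemma add_divByMonic (hQ : Q.Monic) (P R : A[X]) : (P + R) /ₘ Q = P /ₘ Q + R /ₘ Q := by
  refine (div_modByMonic_unique (P /ₘ Q + R /ₘ Q) (P %ₘ Q + R %ₘ Q) hQ ⟨?_, ?_⟩).1
  · linear_combination modByMonic_add_div P Q + modByMonic_add_div R Q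
  · exact (degree_add_le _ _).trans_lt
      (max_lt (degree_modByMonic_lt _ hQ) (degree_modByMonic_lt _ hQ))

lemma pow_mul_divByMonic_pow_add (hQ : Q.Monic) (P : A[X]) (i j : ℕ) :
    (Q ^ j * P) /ₘ Q ^ (j + i) = P /ₘ Q ^ i := by
  refine (div_modByMonic_unique (P /ₘ Q ^ i) (Q ^ j * (P %ₘ Q ^ i)) (hQ.pow _) ⟨?_, ?_⟩).1
  · rw [pow_add]; linear_combination Q ^ j * modByMonic_add_div P (Q ^ i)
  · rw [pow_add, (hQ.pow i).degree_mul, mul_comm, (hQ.pow j).degree_mul, add_comm (degree _)]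
    by_cases hz : P %ₘ Q ^ i = 0
    · rw [hz, degree_zero, WithBot.add_bot, degree_eq_natDegree (hQ.pow j).ne_zero,
        degree_eq_natDegree (hQ.pow i).ne_zero]
      exact WithBot.bot_lt_coe _
    · have := degree_modByMonic_lt P (hQ.pow i)
      rw [degree_eq_natDegree hz, degree_eq_natDegree (hQ.pow i).ne_zero] at this
      rw [degree_eq_natDegree hz, degree_eq_natDegree (hQ.pow j).ne_zero,
        degree_eq_natDegree (hQ.pow i).ne_zero]
      norm_cast at this ⊢
      omega

lemma divByMonic_pow_divByMonic (hQ : Q.Monic) (P : A[X]) (n : ℕ) :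
    (P /ₘ Q ^ n) /ₘ Q = P /ₘ Q ^ (n + 1) := by
  have h1 := modByMonic_add_div P (Q ^ n)
  have h2 : (P %ₘ Q ^ n) /ₘ Q ^ (n + 1) = 0 := by
    rw [divByMonic_eq_zero_iff (hQ.pow _)]
    refine (degree_modByMonic_lt _ (hQ.pow n)).trans_le ?_
    rw [degree_eq_natDegree (hQ.pow n).ne_zero, degree_eq_natDegree (hQ.pow _).ne_zero,
      hQ.natDegree_pow, hQ.natDegree_pow]
    exact_mod_cast Nat.mul_le_mul_right _ (Nat.le_succ n)
  conv_rhs => rw [← h1, add_divByMonic (hQ.pow _), h2, zero_add,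
    pow_mul_divByMonic_pow_add hQ _ 1 n, pow_one]

lemma digit_sum (hQ : Q.Monic) {g : ℕ} (hdeg : Q.natDegree = 2 * g + 1) {e : ℕ → A[X]}
    (he : ∀ i, (e i).natDegree ≤ 2 * g) {n i : ℕ} (hi : i < n) :
    ((∑ j ∈ Finset.range n, Q ^ j * e j) /ₘ Q ^ i) %ₘ Q = e i := by
  obtain ⟨m, rfl⟩ := Nat.exists_eq_add_of_lt hi
  have h1 : ∑ j ∈ Finset.range (i + m + 1), Q ^ j * e j =
      ∑ j ∈ Finset.range i, Q ^ j * e j +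
        Q ^ i * (e i + Q * ∑ j ∈ Finset.range m, Q ^ j * e (i + (j + 1))) := by
    rw [add_assoc, Finset.sum_range_add, Finset.sum_range_succ', mul_add, Finset.mul_sum,
      Finset.mul_sum]
    simp only [pow_add, mul_assoc, pow_one, add_zero]
    rw [add_comm (Q ^ i * e i)]
    congr 2
    exact Finset.sum_congr rfl fun j _ => by ring
  have h2 := degree_sum_pow_mul_lt hQ hdeg he i
  rw [h1, add_divByMonic (hQ.pow i), mul_divByMonic_cancel_left _ (hQ.pow i),
    (divByMonic_eq_zero_iff (hQ.pow i)).2, zero_add, add_modByMonic,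
    (modByMonic_eq_zero_iff_dvd hQ).2 (dvd_mul_right _ _), add_zero,
    (modByMonic_eq_self_iff hQ).2]
  · refine (degree_le_of_natDegree_le (he i)).trans_lt ?_
    rw [degree_eq_natDegree hQ.ne_zero, hdeg]
    exact_mod_cast Nat.lt_succ_self _
  · rw [degree_eq_natDegree (hQ.pow i).ne_zero, hQ.natDegree_pow, hdeg, mul_comm]
    exact h2

lemma sum_digits_add (hQ : Q.Monic) (P : A[X]) (n : ℕ) :
    ∑ j ∈ Finset.range n, Q ^ j * ((P /ₘ Q ^ j) %ₘ Q) + Q ^ n * (P /ₘ Q ^ n) = P := by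
  induction n with
  | zero => simp
  | succ n ih =>
    rw [Finset.sum_range_succ, ← divByMonic_pow_divByMonic hQ]
    conv_rhs => rw [← ih]
    rw [pow_succ]
    linear_combination Q ^ n * modByMonic_add_div (P /ₘ Q ^ n) Q

lemma divByMonic_pow_eq_zero (hQ : Q.Monic) {P : A[X]} {d n : ℕ} (hd : d ≤ Q.natDegree)
    (h : P.natDegree < d * n) : P /ₘ Q ^ n = 0 := by
  rw [divByMonic_eq_zero_iff (hQ.pow n), degree_eq_natDegree (hQ.pow n).ne_zero, hQ.natDegree_pow]
  refine degree_le_natDegree.trans_lt ?_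
  have : d * n ≤ n * Q.natDegree := by rw [mul_comm]; exact Nat.mul_le_mul_left _ hd
  exact_mod_cast h.trans_le this

end Digits

/-! ### Fractions `B / √Q^m` and their differentials. -/

section Frac

variable {K : Type*} [NormedField K] {Q : K[X][X]}

lemma frac_of_lt (B : (PowerSeries K)[X]) {m k : ℤ} (h : m < k) : frac Q B m k = 0 := by
  rw [frac, if_neg]; omega

lemma frac_of_not_even (B : (PowerSeries K)[X]) {m k : ℤ} (h : ¬ Even (m - k)) :
    frac Q B m k = 0 := by
  rw [frac, if_neg (fun h' => h h'.2)]

lemma frac_sub_two_mul (B : (PowerSeries K)[X]) (m : ℤ) (i : ℕ) :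
    frac Q B m (m - 2 * i) = (B /ₘ toSeries Q ^ i) %ₘ toSeries Q := by
  rw [frac, if_pos ⟨by omega, by simp⟩]
  congr 3
  omega

lemma frac_cases (m k : ℤ) : m < k ∨ ¬ Even (m - k) ∨ ∃ i : ℕ, k = m - 2 * i := by
  by_cases h1 : m < k
  · exact Or.inl h1
  by_cases h2 : Even (m - k)
  · obtain ⟨j, hj⟩ := h2
    exact Or.inr (Or.inr ⟨j.toNat, by omega⟩)
  · exact Or.inr (Or.inl h2)

lemma frac_add (hQ : (toSeries Q).Monic) (B B' : (PowerSeries K)[X]) (m : ℤ) :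
    frac Q (B + B') m = frac Q B m + frac Q B' m := by
  funext k
  rw [Pi.add_apply, frac, frac, frac]
  split_ifs
  · rw [add_divByMonic (hQ.pow _), add_modByMonic]
  · rw [add_zero]

lemma frac_sum (hQ : (toSeries Q).Monic) {ι : Type*} (s : Finset ι)
    (B : ι → (PowerSeries K)[X]) (m k : ℤ) :
    frac Q (∑ i ∈ s, B i) m k = ∑ i ∈ s, frac Q (B i) m k := by
  classical
  induction s using Finset.induction_on with
  | empty => simp [frac]
  | insert a s ha ih =>
    rw [Finset.sum_insert ha, Finset.sum_insert ha, frac_add hQ, Pi.add_apply, ih]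

lemma frac_pow_mul (hQ : (toSeries Q).Monic) (B : (PowerSeries K)[X]) (m : ℤ) (j : ℕ) (k : ℤ) :
    frac Q (toSeries Q ^ j * B) (m + 2 * j) k = frac Q B m k := by
  rcases frac_cases (m + 2 * j) k with h | h | ⟨i, rfl⟩
  · rw [frac_of_lt _ h, frac_of_lt _ (by omega)]
  · rw [frac_of_not_even _ h, frac_of_not_even]
    rintro ⟨a, ha⟩
    exact h ⟨a + j, by omega⟩
  · rw [frac_sub_two_mul]
    by_cases hij : i < j
    · rw [frac_of_lt _ (by omega)]
      obtain ⟨e, rfl⟩ := Nat.exists_eq_add_of_lt hij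
      rw [show toSeries Q ^ (i + e + 1) * B = toSeries Q ^ i * (toSeries Q * (toSeries Q ^ e * B))
        by ring, mul_divByMonic_cancel_left _ (hQ.pow i)]
      exact (modByMonic_eq_zero_iff_dvd hQ).2 (dvd_mul_right _ _)
    · obtain ⟨e, rfl⟩ := Nat.exists_eq_add_of_le (not_lt.1 hij)
      rw [pow_mul_divByMonic_pow_add hQ, show m + 2 * j - 2 * (j + e : ℕ) = m - 2 * (e : ℤ) by
        push_cast; ring, frac_sub_two_mul]

lemma natDegree_frac_le (hQ : (toSeries Q).Monic) {g : ℕ}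
    (hdeg : (toSeries Q).natDegree = 2 * g + 1) (B : (PowerSeries K)[X]) (m k : ℤ) :
    (frac Q B m k).natDegree ≤ 2 * g := by
  have hQne : toSeries Q ≠ 1 := by
    intro h; rw [h, natDegree_one] at hdeg; omega
  rw [frac]
  split_ifs
  · have := natDegree_modByMonic_lt (B /ₘ toSeries Q ^ ((m - k) / 2).toNat) hQ hQne
    omega
  · simp

lemma frac_mem_pgauss [IsUltrametricDist K] (hQ : (toSeries Q).Monic)
    (hQ1 : toSeries Q ∈ pgauss K 1) {c : ℝ≥0} {B : (PowerSeries K)[X]} (hB : B ∈ pgauss K c)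
    (m k : ℤ) : frac Q B m k ∈ pgauss K c := by
  rw [frac]
  split_ifs
  · exact modByMonic_mem_pgauss hQ hQ1 (divByMonic_mem_pgauss (hQ.pow _) (pow_mem_pgauss hQ1 _) hB)
  · exact (pgauss K c).zero_mem

/-- The differential of a finite sum, expanded in base `Q`. -/
lemma d_frac [CharZero K] (hQ : (toSeries Q).Monic) {g : ℕ}
    (hdeg : (toSeries Q).natDegree = 2 * g + 1) (G : (PowerSeries K)[X]) (s : ℕ) (k : ℤ) :
    d Q (frac Q G (2 * s - 1)) k =
      frac Q (conn (toSeries Q) (PowerSeries.C ((s : K) - 1 / 2)) G) (2 * s + 1) k := by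
  have h0 : ∀ k, poleTerm Q k 0 = 0 := fun k => by simp [poleTerm]
  rcases frac_cases (2 * s + 1) k with h | h | ⟨i, rfl⟩
  · rw [frac_of_lt _ h, d_apply, frac_of_lt _ (by omega), frac_of_lt _ (by omega), h0, h0,
      zero_divByMonic, zero_modByMonic, derivative_zero, sub_zero, sub_zero]
  · have h1 : ¬ Even ((2 * s - 1 : ℤ) - k) := by
      rintro ⟨a, ha⟩; exact h ⟨a + 1, by omega⟩
    have h2 : ¬ Even ((2 * s - 1 : ℤ) - (k - 2)) := by
      rintro ⟨a, ha⟩; exact h ⟨a, by omega⟩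
    rw [frac_of_not_even _ h, d_apply, frac_of_not_even _ h1, frac_of_not_even _ h2, h0, h0,
      zero_divByMonic, zero_modByMonic, derivative_zero, sub_zero, sub_zero]
  · set τ := frac Q G (2 * s - 1) with hτ
    have hτd : ∀ k, (τ k).natDegree ≤ 2 * g := natDegree_frac_le hQ hdeg G _
    -- Exceeds both the number of base-`Q` digits of `G` and the index `i` of the digit to be
    -- compared.
    set L := G.natDegree + 1 + i with hL
    have hdiv : G /ₘ toSeries Q ^ L = 0 :=
      divByMonic_pow_eq_zero hQ (d := 1) (by omega) (by omega)
    have h3 := sum_pow_mul_d Q τ s L (frac_of_lt _ (by omega)) (by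
      rw [hτ, frac_sub_two_mul, hdiv, zero_modByMonic])
    have h4 : ∑ i ∈ Finset.range L, toSeries Q ^ i * τ (2 * s - 1 - 2 * i) = G := by
      have := sum_digits_add hQ G L
      rw [hdiv, mul_zero, add_zero] at this
      conv_rhs => rw [← this]
      exact Finset.sum_congr rfl fun i _ => by rw [hτ, frac_sub_two_mul]
    rw [h4] at h3
    rw [frac_sub_two_mul, ← h3, digit_sum hQ hdeg (fun i => natDegree_d_le hQ hdeg hτd _)
      (by omega)]

/-- A reduction of polynomials gives a reduction of differentials. -/
lemma frac_eq_sum_add_d [CharZero K] (hQ : (toSeries Q).Monic) {g : ℕ}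
    (hdeg : (toSeries Q).natDegree = 2 * g + 1) {U G c : (PowerSeries K)[X]} {s : ℕ}
    (hc : c.degree < (2 * g : ℕ))
    (h : U = toSeries Q ^ s * c + conn (toSeries Q) (PowerSeries.C ((s : K) - 1 / 2)) G) (k : ℤ) :
    frac Q U (2 * s + 1) k = ∑ l : Fin (2 * g), C (c.coeff l) * basisForm (l : ℕ) k +
      d Q (frac Q G (2 * s - 1)) k := by
  rw [h, frac_add hQ, Pi.add_apply, d_frac hQ hdeg]
  congr 1
  rw [show (2 * s + 1 : ℤ) = 1 + 2 * s by ring, frac_pow_mul hQ]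
  by_cases hk : k = 1
  · subst hk
    rw [sum_basisForm_one]
    have h1 := frac_sub_two_mul (Q := Q) c 1 0
    rw [Nat.cast_zero, mul_zero, sub_zero, pow_zero, divByMonic_one] at h1
    rw [h1, (modByMonic_eq_self_iff hQ).2]
    · refine Polynomial.ext fun j => ?_
      by_cases hj : j < 2 * g
      · exact (coeff_sum_C_mul_X_pow (fun l => c.coeff l) ⟨j, hj⟩).symm
      · have hj' : ((2 * g : ℕ) : WithBot ℕ) ≤ j := by exact_mod_cast not_lt.1 hj
        rw [coeff_eq_zero_of_degree_lt (hc.trans_le hj'),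
          coeff_eq_zero_of_degree_lt ((degree_sum_C_mul_X_pow_lt _).trans_le hj')]
    · refine hc.trans ?_
      rw [degree_eq_natDegree hQ.ne_zero, hdeg]
      exact_mod_cast Nat.lt_succ_self _
  · rw [sum_basisForm_of_ne _ hk]
    rcases frac_cases 1 k with h | h | ⟨i, rfl⟩
    · exact frac_of_lt _ h
    · exact frac_of_not_even _ h
    · rw [frac_sub_two_mul, (divByMonic_eq_zero_iff (hQ.pow i)).2, zero_modByMonic]
      refine hc.trans_le ?_
      rw [degree_eq_natDegree (hQ.pow i).ne_zero, hQ.natDegree_pow, hdeg]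
      have hi : 1 ≤ i := by
        rcases Nat.eq_zero_or_pos i with rfl | h
        · simp at hk
        · exact h
      have : 2 * g ≤ i * (2 * g + 1) := by nlinarith
      exact_mod_cast this

end Frac

/-! ### Reduction of polynomial differentials with control on the degree in `Γ` -/

section Weight

variable {K : Type*} [NormedField K]

/-- Polynomials `p` in `Γ` such that `p X^j` has weight at most `W`, where `Γ` has weight `1` and `X`
has weight `κ`. -/
def weightCoeff (K : Type*) [NormedField K] (κ : ℕ) (W : ℤ) (j : ℕ) : AddSubgroup K[X] where
  carrier := {p | ∀ e : ℕ, W < e + κ * j → p.coeff e = 0}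
  zero_mem' e _ := coeff_zero e
  add_mem' {x y} hx hy e he := by rw [coeff_add, hx e he, hy e he, add_zero]
  neg_mem' {x} hx e he := by rw [coeff_neg, hx e he, neg_zero]

/-- Polynomials in `X` and `Γ` of weight at most `W`. -/
def weight (K : Type*) [NormedField K] (κ : ℕ) (W : ℤ) : AddSubgroup K[X][X] where
  carrier := {P | ∀ j, P.coeff j ∈ weightCoeff K κ W j}
  zero_mem' j := by simp [(weightCoeff K κ W j).zero_mem]
  add_mem' {x y} hx hy n := by rw [coeff_add]; exact (weightCoeff K κ W n).add_mem (hx n) (hy n)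
  neg_mem' {x} hx n := by rw [coeff_neg]; exact (weightCoeff K κ W n).neg_mem (hx n)

variable {κ : ℕ}

lemma weight_mono {W W' : ℤ} (h : W ≤ W') : weight K κ W ≤ weight K κ W' :=
  fun _ hP j e he => hP j e (h.trans_lt he)

lemma mul_mem_weightCoeff {W W' : ℤ} {i j : ℕ} {p q : K[X]} (hp : p ∈ weightCoeff K κ W i)
    (hq : q ∈ weightCoeff K κ W' j) : p * q ∈ weightCoeff K κ (W + W') (i + j) := by
  intro e he
  rw [coeff_mul]
  refine Finset.sum_eq_zero fun x hx => ?_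
  have hx := Finset.HasAntidiagonal.mem_antidiagonal.1 hx
  by_cases h1 : W < x.1 + κ * i
  · rw [hp _ h1, zero_mul]
  · rw [hq _ (by push_cast at he; have : (x.1 : ℤ) + x.2 = e := by exact_mod_cast hx
                 linarith), mul_zero]

lemma mul_mem_weight {W W' : ℤ} {P R : K[X][X]} (hP : P ∈ weight K κ W)
    (hR : R ∈ weight K κ W') : P * R ∈ weight K κ (W + W') := by
  intro n
  rw [coeff_mul]
  refine (weightCoeff K κ _ n).sum_mem fun x hx => ?_
  have hx := Finset.HasAntidiagonal.mem_antidiagonal.1 hx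
  rw [← hx]
  exact mul_mem_weightCoeff (hP _) (hR _)

lemma monomial_mem_weight {W : ℤ} {n : ℕ} {p : K[X]} (h : p ∈ weightCoeff K κ W n) :
    monomial n p ∈ weight K κ W := by
  intro j
  rw [coeff_monomial]
  split_ifs with hj
  · rw [← hj]; exact h
  · exact (weightCoeff K κ W j).zero_mem

lemma C_C_mem_weight (a : K) : (C (C a) : K[X][X]) ∈ weight K κ 0 := by
  refine monomial_mem_weight (n := 0) fun e he => ?_
  rw [coeff_C, if_neg]
  rintro rfl
  simp at he

lemma one_mem_weight : (1 : K[X][X]) ∈ weight K κ 0 := by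
  simpa using C_C_mem_weight (κ := κ) (1 : K)

lemma X_pow_mem_weight (n : ℕ) : (X ^ n : K[X][X]) ∈ weight K κ (κ * n) := by
  rw [X_pow_eq_monomial]
  refine monomial_mem_weight fun e he => ?_
  rw [coeff_one, if_neg]
  rintro rfl
  simp at he

lemma pow_mem_weight {W : ℤ} {P : K[X][X]} (hP : P ∈ weight K κ W) (n : ℕ) :
    P ^ n ∈ weight K κ (n * W) := by
  induction n with
  | zero => simpa using one_mem_weight
  | succ n ih =>
    rw [pow_succ]
    refine weight_mono (le_of_eq ?_) (mul_mem_weight ih hP)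
    push_cast; ring

lemma derivative_mem_weight {W : ℤ} {P : K[X][X]} (hP : P ∈ weight K κ W) :
    derivative P ∈ weight K κ (W - κ) := by
  intro j e he
  rw [coeff_derivative, ← Nat.cast_succ, ← C_eq_natCast, mul_comm, coeff_C_mul,
    hP (j + 1) e (by push_cast; linarith), mul_zero]

lemma natDegree_coeff_le_of_mem_weight {W : ℕ} {P : K[X][X]} (hP : P ∈ weight K κ W) (j : ℕ) :
    (P.coeff j).natDegree ≤ W := by
  rw [natDegree_le_iff_coeff_eq_zero]
  intro e he
  refine hP j e ?_
  have : (W : ℤ) < e := by exact_mod_cast he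
  have : (0 : ℤ) ≤ κ * j := by positivity
  linarith

variable {g : ℕ} {Q : K[X][X]}

/-- A term of `X`-degree `i ≤ 2g` weighs at most `κ + κ i ≤ κ(2g+1)`, the weight of the leading
monomial. -/
lemma IsFamily.mem_weight (hQ : IsFamily g Q) :
    Q ∈ weight K (degΓ Q) (degΓ Q * (2 * g + 1 : ℕ)) := by
  intro i
  rcases lt_trichotomy i (2 * g + 1) with hi | hi | hi
  · intro e he
    refine coeff_eq_zero_of_natDegree_lt ((natDegree_coeff_le_degΓ Q i).trans_lt ?_)
    have h1 : (degΓ Q : ℤ) * (i + 1 : ℕ) ≤ degΓ Q * (2 * g + 1 : ℕ) :=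
      mul_le_mul_of_nonneg_left (by exact_mod_cast hi) (by positivity)
    have : (degΓ Q : ℤ) < e := by push_cast at h1 he; linarith
    exact_mod_cast this
  · have := hQ.monic.coeff_natDegree
    rw [hi, ← hQ.natDegree_eq, this]
    intro e he
    rw [coeff_one, if_neg]
    rintro rfl
    simp at he
  · rw [coeff_eq_zero_of_natDegree_lt (by rw [hQ.natDegree_eq]; exact hi)]
    exact (weightCoeff K _ _ i).zero_mem

/-- No term of `Q` outweighs `X^(2g+1)`, so long division never raises the weight. The quotient even
loses `κ(2g+1)`, which is given away here. -/
lemma IsFamily.div_mod_mem_weight (hQ : IsFamily g Q) {W : ℤ} {P : K[X][X]}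
    (hP : P ∈ weight K (degΓ Q) W) :
    P /ₘ Q ∈ weight K (degΓ Q) W ∧ P %ₘ Q ∈ weight K (degΓ Q) W := by
  obtain ⟨h1, h2⟩ := coeff_div_mod_mem hQ.monic (weightCoeff K (degΓ Q) W) (P := P) (by
    intro j i hi a ha
    have h3 : Q.coeff i ∈ weightCoeff K (degΓ Q) (degΓ Q * Q.natDegree) i := by
      rw [hQ.natDegree_eq]; exact hQ.mem_weight i
    have h4 := mul_mem_weightCoeff ha h3
    intro e he
    refine h4 e ?_
    push_cast at he ⊢
    linarith) hP
  refine ⟨fun j e he => h1 j e ?_, h2⟩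
  have : (0 : ℤ) ≤ degΓ Q * Q.natDegree := by positivity
  push_cast
  linarith

/-- Reduction at infinity. -/
lemma IsFamily.exists_reduction_infinity [CharZero K] (hQ : IsFamily g Q) (W : ℤ) (n : ℕ) :
    ∀ H ∈ weight K (degΓ Q) W, H.degree < ((2 * g + n : ℕ) : WithBot ℕ) →
    ∃ c ∈ weight K (degΓ Q) W, ∃ V, c.degree < ((2 * g : ℕ) : WithBot ℕ) ∧
      H = c + conn Q (C (-1 / 2)) V := by
  induction n with
  | zero => exact fun H hH hd => ⟨H, hH, 0, hd, by rw [conn_zero, add_zero]⟩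
  | succ n ih =>
    intro H hH hd
    set κ := degΓ Q with hκ
    set a := H.coeff (2 * g + n) with ha
    -- The leading coefficient of the image of `X^n` is `n + (2g+1)/2`. Only its nonvanishing
    -- matters: norms play no role in this reduction.
    set γ : K := ((2 * n + 2 * g + 1 : ℕ) / 2 : K)⁻¹ with hγ
    have hγ0 : ((2 * n + 2 * g + 1 : ℕ) : K) ≠ 0 := Nat.cast_ne_zero.2 (Nat.succ_ne_zero _)
    set V₀ : K[X][X] := monomial n (C γ * a) with hV₀
    have hVw : V₀ ∈ weight K κ (W - κ * (2 * g : ℕ)) := by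
      refine monomial_mem_weight fun e he => ?_
      rw [coeff_C_mul, hH _ e (by push_cast at he ⊢; linarith), mul_zero]
    have hcw : conn Q (C (-1 / 2)) V₀ ∈ weight K κ W := by
      refine (weight K κ W).sub_mem ?_ ?_
      · refine weight_mono (le_of_eq ?_) (mul_mem_weight hQ.mem_weight (derivative_mem_weight hVw))
        push_cast; ring
      · refine weight_mono (le_of_eq ?_) (mul_mem_weight (C_C_mem_weight _)
          (mul_mem_weight (derivative_mem_weight hQ.mem_weight) hVw))
        push_cast; ring
    have hVd : V₀.degree < ((n + 1 : ℕ) : WithBot ℕ) :=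
      (degree_monomial_le _ _).trans_lt (by exact_mod_cast Nat.lt_succ_self n)
    have hcd := degree_conn_lt hQ.natDegree_eq (C (-1 / 2 : K)) hVd
    have hlead : (conn Q (C (-1 / 2)) V₀).coeff (2 * g + n) = a := by
      have h1 : (derivative Q * V₀).coeff (2 * g + n) = (2 * g + 1 : ℕ) * (C γ * a) := by
        have h3 : Q.coeff (2 * g + 1) = 1 := by
          rw [← hQ.natDegree_eq]; exact hQ.monic.coeff_natDegree
        rw [hV₀, coeff_mul_monomial, coeff_derivative, h3, one_mul]
        push_cast; ring
      have h2 : (Q * derivative V₀).coeff (2 * g + n) = n * (C γ * a) := by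
        rw [hV₀, derivative_monomial]
        cases n with
        | zero => simp
        | succ n =>
          have h3 : Q.coeff (2 * g + 1) = 1 := by
            rw [← hQ.natDegree_eq]; exact hQ.monic.coeff_natDegree
          rw [Nat.add_sub_cancel, show 2 * g + (n + 1) = 2 * g + 1 + n by ring,
            coeff_mul_monomial, h3]
          push_cast; ring
      have h3 : (C (-1 / 2 : K) : K[X]) * (2 * g + 1 : ℕ) = (n : K[X]) - C γ⁻¹ := by
        rw [← C_eq_natCast, ← C_eq_natCast, ← C_mul, ← C_sub, hγ, inv_inv]
        congr 1; push_cast; ring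
      have h4 : (C γ⁻¹ : K[X]) * C γ = 1 := by
        rw [← C_mul, inv_mul_cancel₀ (inv_ne_zero (div_ne_zero hγ0 two_ne_zero)), C_1]
      rw [conn, coeff_sub, coeff_C_mul, h1, h2]
      linear_combination (-C γ * a) * h3 + a * h4
    obtain ⟨c, hc1, V, hc2, hc3⟩ := ih (H - conn Q (C (-1 / 2)) V₀)
      ((weight K κ W).sub_mem hH hcw) (by
        rw [degree_lt_iff_coeff_zero] at hd hcd ⊢
        intro m hm
        rw [coeff_sub]
        rcases hm.eq_or_lt with rfl | hm
        · rw [hlead, ← ha, sub_self]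
        · rw [hd _ (by omega), hcd _ (by omega), sub_zero])
    exact ⟨c, hc1, V + V₀, hc2, by rw [conn_add]; linear_combination hc3⟩

lemma natDegree_coeff_C_mul_le {a : K[X]} {P : K[X][X]} {m n : ℕ} (ha : a.natDegree ≤ m)
    (hP : ∀ j, (P.coeff j).natDegree ≤ n) (j : ℕ) : ((C a * P).coeff j).natDegree ≤ m + n := by
  rw [coeff_C_mul]; exact natDegree_mul_le_of_le ha (hP j)

lemma natDegree_coeff_add_le {P R : K[X][X]} {n : ℕ} (hP : ∀ j, (P.coeff j).natDegree ≤ n)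
    (hR : ∀ j, (R.coeff j).natDegree ≤ n) (j : ℕ) : ((P + R).coeff j).natDegree ≤ n := by
  rw [coeff_add]; exact natDegree_add_le_of_degree_le (hP j) (hR j)

/-- Reduction of the pole order along `Q = 0` by `i` steps. -/
lemma IsFamily.exists_reduction_step [CharZero K] (hQ : IsFamily g Q) {W s : ℕ} {U : K[X][X]}
    (hU : U ∈ weight K (degΓ Q) W) (i : ℕ) (hi : i ≤ s) :
    ∃ L B G : K[X][X], L.degree < ((2 * g : ℕ) : WithBot ℕ) ∧ B ∈ weight K (degΓ Q) W ∧
      (∀ j, (L.coeff j).natDegree ≤ i * ((4 * g + 1) * degΓ Q) + W) ∧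
      C (res Q ^ i) * U = Q ^ i * (L + C (res Q ^ i) * B) + conn Q (C ((s : K) - 1 / 2)) G := by
  induction i with
  | zero => exact ⟨0, U, 0, by rw [degree_zero]; exact WithBot.bot_lt_coe _, hU,
      by simp, by simp [conn_zero]⟩
  | succ i ih =>
    obtain ⟨L, B, G, h1, h2, h3, h4⟩ := ih (by omega)
    set ν := (4 * g + 1) * degΓ Q with hν
    obtain ⟨hB1, hB2⟩ := hQ.div_mod_mem_weight h2
    have hr : (res Q ^ i).natDegree ≤ i * ν :=
      natDegree_pow_le_of_le i hQ.natDegree_res_le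
    -- The current lowest digit, with numerator of degree at most `2g`. Keeping `r^i B` apart from
    -- `L` leaves the weight of `B` untouched, so that only `L` grows in `Γ`-degree, by at most
    -- `(4g+1)κ` per step.
    set A := L + C (res Q ^ i) * (B %ₘ Q) with hA
    have hAD : ∀ j, (A.coeff j).natDegree ≤ i * ν + W :=
      natDegree_coeff_add_le h3 (natDegree_coeff_C_mul_le hr (natDegree_coeff_le_of_mem_weight hB2))
    have hQne : Q ≠ 1 := by
      intro h; have := hQ.natDegree_eq; rw [h, natDegree_one] at this; omega
    have hAd : A.natDegree ≤ 2 * g := by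
      refine natDegree_add_le_of_degree_le (natDegree_le_of_degree_le h1.le) ?_
      refine (natDegree_C_mul_le _ _).trans ?_
      have := natDegree_modByMonic_lt B hQ.monic hQne
      rw [hQ.natDegree_eq] at this
      omega
    obtain ⟨u, v, hu, hv, huv, hud, hvd⟩ := hQ.exists_bezout_natDegree_le hAd hAD
    rw [← hν] at hud hvd
    set ε : K := (i : K) - ((s : K) - 1 / 2) with hε
    have hε0 : ε ≠ 0 := by
      intro h
      have h5 : (2 * s : K) = (2 * i + 1 : ℕ) := by
        rw [hε] at h; push_cast; linear_combination (-2) * h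
      have h6 : 2 * s = 2 * i + 1 := by exact_mod_cast h5
      omega
    have hεC : C ((i : K[X]) - C ((s : K) - 1 / 2)) * C (C ε⁻¹) = (1 : K[X][X]) := by
      rw [← C_eq_natCast, ← C_sub, ← hε, ← C_mul, ← C_mul, mul_inv_cancel₀ hε0, C_1, C_1]
    have hder : derivative (C (C ε⁻¹) * v) = C (C ε⁻¹) * derivative v := derivative_C_mul _ _
    -- From `r A = Q u + Q' v`, the part `Q^i Q' v` is the image of `Q^i ε⁻¹ v` minus `Q^(i+1) ε⁻¹
    -- v'`. Here `ε`, a half-integer, is nonzero.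
    refine ⟨u - C (C ε⁻¹) * derivative v, B /ₘ Q, C (res Q) * G + Q ^ i * (C (C ε⁻¹) * v),
      ?_, hB1, ?_, ?_⟩
    · rw [degree_lt_iff_coeff_zero] at hu ⊢
      intro m hm
      rw [coeff_sub, hu m hm, coeff_C_mul, coeff_derivative,
        coeff_eq_zero_of_natDegree_lt (show v.natDegree < m + 1 by omega)]
      simp
    · intro j
      have e : (i + 1) * ν + W = ν + (i * ν + W) := by ring
      rw [e, coeff_sub, coeff_C_mul, coeff_derivative]
      refine (natDegree_sub_le_of_le (hud j) (n := ν + (i * ν + W)) ?_).trans (by simp)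
      refine (natDegree_C_mul_le _ _).trans ?_
      refine natDegree_mul_le_of_le (hvd (j + 1)) (n := 0) ?_
      exact_mod_cast (natDegree_natCast (j + 1)).le
    · have hBm := modByMonic_add_div B Q
      rw [conn_add, conn_C_mul, conn_pow_mul, hder, pow_succ (res Q), C_mul]
      rw [hA] at huv
      linear_combination C (res Q) * h4 + Q ^ i * huv - C (res Q) * Q ^ i * C (res Q ^ i) * hBm -
        Q ^ i * (derivative Q * v) * hεC

/-- Reduction of a differential with polynomial coefficients, with control on the degree in `Γ`. -/
lemma IsFamily.exists_reduction [CharZero K] (hQ : IsFamily g Q) {W : ℕ} {U : K[X][X]}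
    (hU : U ∈ weight K (degΓ Q) W) (s : ℕ) :
    ∃ c G : K[X][X], c.degree < ((2 * g : ℕ) : WithBot ℕ) ∧
      (∀ j, (c.coeff j).natDegree ≤ s * ((4 * g + 1) * degΓ Q) + W) ∧
      C (res Q ^ s) * U = Q ^ s * c + conn Q (C ((s : K) - 1 / 2)) G := by
  obtain ⟨L, B, G, h1, h2, h3, h4⟩ := hQ.exists_reduction_step hU s le_rfl
  -- Only `B` can have degree `2g` or more in `X`, so it alone is reduced at infinity, before
  -- multiplication by `r^s`.
  obtain ⟨c, hc1, V, hc2, hc3⟩ := hQ.exists_reduction_infinity W (B.natDegree + 1) B h2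
    (degree_le_natDegree.trans_lt (by exact_mod_cast (by omega)))
  have hr : (res Q ^ s).natDegree ≤ s * ((4 * g + 1) * degΓ Q) :=
    natDegree_pow_le_of_le s hQ.natDegree_res_le
  refine ⟨L + C (res Q ^ s) * c, G + Q ^ s * (C (res Q ^ s) * V), ?_,
    natDegree_coeff_add_le h3 (natDegree_coeff_C_mul_le hr (natDegree_coeff_le_of_mem_weight hc1)),
    ?_⟩
  · refine (degree_add_le _ _).trans_lt (max_lt h1 ?_)
    rw [← smul_eq_C_mul]
    exact (degree_smul_le _ _).trans_lt hc2
  · have hhalf : (s : K[X]) - C ((s : K) - 1 / 2) = -C (-1 / 2 : K) := by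
      rw [← C_eq_natCast, ← C_sub, ← C_neg]; congr 1; ring
    rw [h4, conn_add, conn_pow_mul, hhalf, derivative_C_mul, hc3, C_neg]
    simp only [conn]
    ring

end Weight

/-! ### The Frobenius lift -/

section Norms

variable (p : ℕ) [Fact p.Prime] (K : Type*) [NormedField K] [NormedAlgebra ℚ_[p] K]

include p

lemma charZero_of_normedAlgebra_padic : CharZero K :=
  charZero_of_injective_algebraMap (algebraMap ℚ_[p] K).injective

lemma nnnorm_natCast_eq_padic (n : ℕ) : ‖(n : K)‖₊ = ‖(n : ℚ_[p])‖₊ := by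
  rw [← map_natCast (algebraMap ℚ_[p] K), nnnorm_algebraMap']

lemma isUltrametricDist_of_normedAlgebra_padic : IsUltrametricDist K := by
  refine IsUltrametricDist.isUltrametricDist_of_forall_norm_natCast_le_one fun n => ?_
  have := nnnorm_natCast_eq_padic p K n
  rw [← coe_nnnorm, this, coe_nnnorm]
  exact_mod_cast Padic.norm_int_le_one (p := p) n

lemma nnnorm_prime : ‖(p : K)‖₊ = (p : ℝ≥0)⁻¹ := by
  rw [nnnorm_natCast_eq_padic p]
  ext
  simp

lemma nnnorm_natCast_of_not_dvd {n : ℕ} (h : ¬ p ∣ n) : ‖(n : K)‖₊ = 1 := by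
  rw [nnnorm_natCast_eq_padic p]
  ext
  rw [coe_nnnorm, NNReal.coe_one, Padic.norm_natCast_eq_one_iff]
  exact (Nat.Prime.coprime_iff_not_dvd Fact.out).2 h

/-- The power of `p` dividing `n` is at most `n`. This is the source of the logarithm in the final
bound on the order. -/
lemma nnnorm_natCast_inv_le {n : ℕ} (hn : n ≠ 0) : ‖(n : K)⁻¹‖₊ ≤ n := by
  obtain ⟨v, m, hm, rfl⟩ := Nat.exists_eq_pow_mul_and_not_dvd hn p (Fact.out : p.Prime).ne_one
  rw [nnnorm_inv, Nat.cast_mul, Nat.cast_pow, nnnorm_mul, nnnorm_pow, nnnorm_prime,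
    nnnorm_natCast_of_not_dvd p K hm, mul_one, inv_pow, inv_inv]
  have hm0 : 1 ≤ m := Nat.one_le_iff_ne_zero.2 (by rintro rfl; simp at hm)
  exact_mod_cast Nat.le_mul_of_pos_right _ hm0

lemma nnnorm_two_inv_le (hp : p ≠ 2) : ‖(2 : K)⁻¹‖₊ ≤ 1 := by
  have h := nnnorm_natCast_of_not_dvd p K (n := 2) (fun h =>
    hp ((Nat.prime_dvd_prime_iff_eq Fact.out Nat.prime_two).1 h))
  rw [nnnorm_inv, show (2 : K) = (2 : ℕ) by norm_num, h, inv_one]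

omit p [Fact p.Prime] [NormedAlgebra ℚ_[p] K] in
-- Since `4` is a unit for odd `p`, this makes the coefficients of `(1 + x)^(-1/2)` integral.
lemma four_pow_mul_choose_neg_half (n : ℕ) :
    (4 : ℚ) ^ n * Ring.choose (-1 / 2 : ℚ) n = (-1) ^ n * n.centralBinom := by
  induction n with
  | zero => simp
  | succ n ih =>
    have h1 : ((n : ℚ) + 1) * Ring.choose (-1 / 2 : ℚ) (n + 1) =
        (-1 / 2 - n) * Ring.choose (-1 / 2 : ℚ) n := by
      have h2 := Ring.choose_smul_choose (-1 / 2 : ℚ) (Nat.le_succ n)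
      simp only [Nat.succ_eq_add_one, Nat.choose_succ_self_right, Nat.add_sub_cancel_left,
        Ring.choose_one_right, nsmul_eq_mul] at h2
      push_cast at h2
      rw [h2]; ring
    have h3 : ((n : ℚ) + 1) * (n + 1).centralBinom = 2 * (2 * n + 1) * n.centralBinom := by
      exact_mod_cast Nat.succ_mul_centralBinom_succ n
    have h4 : ((n : ℚ) + 1) ≠ 0 := by positivity
    refine mul_left_cancel₀ h4 ?_
    rw [pow_succ, pow_succ]
    linear_combination (4 : ℚ) ^ n * 4 * h1 + 4 * (-1 / 2 - n) * ih + (-1) ^ n * h3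

lemma nnnorm_choose_neg_half_le (hp : p ≠ 2) (n : ℕ) :
    ‖((Ring.choose (-1 / 2 : ℚ) n : ℚ) : K)‖₊ ≤ 1 := by
  have := charZero_of_normedAlgebra_padic p K
  have := isUltrametricDist_of_normedAlgebra_padic p K
  have h4 : ‖(4 : K)‖₊ = 1 := by
    have := nnnorm_natCast_of_not_dvd p K (n := 2 ^ 2) (fun h =>
      hp ((Nat.prime_dvd_prime_iff_eq Fact.out Nat.prime_two).1
        ((Fact.out : p.Prime).dvd_of_dvd_pow h)))
    simpa using this
  have h := congrArg (fun x : ℚ => ‖(x : K)‖₊) (four_pow_mul_choose_neg_half n)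
  simp only [Rat.cast_mul, Rat.cast_pow, Rat.cast_neg, Rat.cast_one, Rat.cast_natCast,
    Rat.cast_ofNat, nnnorm_mul, nnnorm_pow, nnnorm_neg, nnnorm_one, one_pow, one_mul, h4] at h
  rw [h]
  exact IsUltrametricDist.nnnorm_natCast_le_one K _

end Norms

/-! ### Divisibility of `Q^σ(X^p, Γ^p) - Q^p` by `p`. -/

section FrobPoly

variable (p : ℕ) [Fact p.Prime] {K : Type*} [NormedField K] [NormedAlgebra ℚ_[p] K]
  (σ : K ≃ₐ[ℚ_[p]] K)

/-- The Frobenius substitution on polynomials as a ring homomorphism. -/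
def frobHom : (PowerSeries K)[X] →+* (PowerSeries K)[X] :=
  (Polynomial.expand (PowerSeries K) p).toRingHom.comp
    (mapRingHom ((PowerSeries.expand p (Fact.out : p.Prime).ne_zero).toRingHom.comp
      (PowerSeries.map (σ : K →+* K))))

lemma frobPoly_eq (B : (PowerSeries K)[X]) : frobPoly p σ B = frobHom p σ B := rfl

lemma frobHom_X : frobHom p σ X = X ^ p := by
  simp [frobHom]

lemma frobHom_C (s : PowerSeries K) : frobHom p σ (C s) =
    C (PowerSeries.expand p (Fact.out : p.Prime).ne_zero (PowerSeries.map (σ : K →+* K) s)) := by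
  simp [frobHom]

/-- The polynomial `Q^σ(X^p, Γ^p) - Q(X, Γ)^p` over `K`. -/
def frobErrorPoly (Q : K[X][X]) : K[X][X] :=
  Polynomial.expand K[X] p (Q.map ((Polynomial.expand K p).toRingHom.comp
    (mapRingHom (σ : K →+* K)))) - Q ^ p

lemma toSeries_frobErrorPoly (Q : K[X][X]) :
    toSeries (frobErrorPoly p σ Q) = frobError p σ Q := by
  have hcomp : (coeToPowerSeries.ringHom (R := K)).comp ((Polynomial.expand K p).toRingHom.comp
      (mapRingHom (σ : K →+* K))) =
      ((PowerSeries.expand p (Fact.out : p.Prime).ne_zero).toRingHom.comp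
      (PowerSeries.map (σ : K →+* K))).comp (coeToPowerSeries.ringHom (R := K)) := by
    refine RingHom.ext fun q => PowerSeries.ext fun n => ?_
    simp [PowerSeries.coeff_expand, Polynomial.coeff_expand (Fact.out : p.Prime).pos]
  rw [frobErrorPoly, frobError, frobPoly, toSeries, toSeries, Polynomial.map_sub,
    Polynomial.map_pow, Polynomial.map_expand, Polynomial.map_map, Polynomial.map_map, hcomp]

variable [IsUltrametricDist K]

lemma add_pow_sub_mem_pgauss {x y : (PowerSeries K)[X]} (hx : x ∈ pgauss K 1)
    (hy : y ∈ pgauss K 1) : (x + y) ^ p - x ^ p - y ^ p ∈ pgauss K (p : ℝ≥0)⁻¹ := by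
  have hp1 : ((p : ℕ) : (PowerSeries K)[X]) ∈ pgauss K (p : ℝ≥0)⁻¹ := by
    rw [← map_natCast C, ← map_natCast PowerSeries.C]
    exact C_mem_pgauss (C_mem_gauss (nnnorm_prime p K).le)
  rw [add_pow_prime_eq (Fact.out : p.Prime) x y, add_assoc, add_sub_cancel_left,
    add_sub_cancel_left, mul_assoc, mul_assoc, mul_comm]
  refine mul_mem_pgauss_of_left (mul_mem_pgauss_of_left hx (mul_mem_pgauss_of_left hy ?_)) hp1
  refine (pgauss K 1).sum_mem fun k _ => ?_
  refine mul_mem_pgauss_of_left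
    (mul_mem_pgauss_of_left (pow_mem_pgauss hx _) (pow_mem_pgauss hy _)) ?_
  rw [← map_natCast C]
  exact C_mem_pgauss (natCast_mem_gauss _)

/-- The integral polynomials on which `frobHom` reduces to the `p`-th power. -/
def IsFrobLift (x : (PowerSeries K)[X]) : Prop :=
  x ∈ pgauss K 1 ∧ frobHom p σ x - x ^ p ∈ pgauss K (p : ℝ≥0)⁻¹

variable {p σ}

lemma IsFrobLift.add {x y : (PowerSeries K)[X]} (hx : IsFrobLift p σ x) (hy : IsFrobLift p σ y) :
    IsFrobLift p σ (x + y) := by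
  refine ⟨(pgauss K 1).add_mem hx.1 hy.1, ?_⟩
  have := (pgauss K _).sub_mem ((pgauss K _).add_mem hx.2 hy.2)
    (add_pow_sub_mem_pgauss p hx.1 hy.1)
  convert this using 1
  rw [map_add]; ring

lemma IsFrobLift.mul {x y : (PowerSeries K)[X]} (hx : IsFrobLift p σ x) (hy : IsFrobLift p σ y) :
    IsFrobLift p σ (x * y) := by
  refine ⟨mul_mem_pgauss_of_left hx.1 hy.1, ?_⟩
  have hp : (p : ℝ≥0)⁻¹ ≤ 1 :=
    inv_le_one_of_one_le₀ (by exact_mod_cast (Fact.out : p.Prime).one_le)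
  have h1 : frobHom p σ x ∈ pgauss K 1 := by
    have := (pgauss K 1).add_mem (pgauss_mono hp hx.2) (pow_mem_pgauss hx.1 p)
    rwa [sub_add_cancel] at this
  have := (pgauss K _).add_mem (mul_mem_pgauss_of_left h1 hy.2)
    (mul_mem_pgauss_of_left (pow_mem_pgauss hy.1 p) hx.2)
  convert this using 1
  rw [map_mul]; ring

lemma isFrobLift_zero : IsFrobLift p σ (0 : (PowerSeries K)[X]) := by
  refine ⟨(pgauss K 1).zero_mem, ?_⟩
  rw [map_zero, zero_pow (Fact.out : p.Prime).ne_zero, sub_zero]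
  exact (pgauss K _).zero_mem

lemma isFrobLift_one : IsFrobLift p σ (1 : (PowerSeries K)[X]) := by
  refine ⟨one_mem_pgauss, ?_⟩
  rw [map_one, one_pow, sub_self]
  exact (pgauss K _).zero_mem

lemma IsFrobLift.pow {x : (PowerSeries K)[X]} (hx : IsFrobLift p σ x) (n : ℕ) :
    IsFrobLift p σ (x ^ n) := by
  induction n with
  | zero => simpa using isFrobLift_one
  | succ n ih => rw [pow_succ]; exact ih.mul hx

lemma IsFrobLift.sum {ι : Type*} {s : Finset ι} {x : ι → (PowerSeries K)[X]}
    (hx : ∀ i, IsFrobLift p σ (x i)) : IsFrobLift p σ (∑ i ∈ s, x i) := by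
  classical
  induction s using Finset.induction_on with
  | empty => simpa using isFrobLift_zero
  | insert a s ha ih => rw [Finset.sum_insert ha]; exact (hx a).add ih

lemma isFrobLift_X : IsFrobLift p σ (X : (PowerSeries K)[X]) := by
  refine ⟨X_mem_pgauss, ?_⟩
  rw [frobHom_X, sub_self]
  exact (pgauss K _).zero_mem

lemma isFrobLift_C_X : IsFrobLift p σ (C (PowerSeries.X : PowerSeries K)) := by
  refine ⟨C_mem_pgauss fun n => ?_, ?_⟩
  · rw [PowerSeries.coeff_X]
    split_ifs
    · simp [mem_ball]
    · exact (ball K 1).zero_mem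
  · rw [frobHom_C, PowerSeries.map_X, PowerSeries.expand_X, ← C_pow, sub_self]
    exact (pgauss K _).zero_mem

/-- The only place where `K` must be unramified: a norm less than `1` is then at most `p⁻¹`. -/
lemma isFrobLift_C_C (hK : IsUnramified p K) (hσ : IsFrobenius p σ) {a : K} (ha : ‖a‖ ≤ 1) :
    IsFrobLift p σ (C (PowerSeries.C a)) := by
  refine ⟨C_mem_pgauss (C_mem_gauss ha), ?_⟩
  have : frobHom p σ (C (PowerSeries.C a)) - C (PowerSeries.C a) ^ p =
      C (PowerSeries.C (σ a - a ^ p)) := by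
    rw [frobHom_C, PowerSeries.map_C, PowerSeries.expand_C]; simp
  rw [this]
  refine C_mem_pgauss (C_mem_gauss ?_)
  rw [← NNReal.coe_le_coe]
  simpa using hK _ (hσ a ha)

lemma isFrobLift_C_coe (hK : IsUnramified p K) (hσ : IsFrobenius p σ) {q : K[X]}
    (hq : q ∈ integralPoly K) : IsFrobLift p σ (C (q : PowerSeries K)) := by
  have : C (q : PowerSeries K) = ∑ j ∈ Finset.range (q.natDegree + 1),
      C (PowerSeries.C (q.coeff j)) * C (PowerSeries.X : PowerSeries K) ^ j := by
    conv_lhs => rw [q.as_sum_range_C_mul_X_pow]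
    rw [← coeToPowerSeries.ringHom_apply, map_sum, map_sum]
    simp
  rw [this]
  exact IsFrobLift.sum fun j => (isFrobLift_C_C hK hσ (hq j)).mul (isFrobLift_C_X.pow j)

lemma isFrobLift_toSeries (hK : IsUnramified p K) (hσ : IsFrobenius p σ) {Q : K[X][X]}
    (hQ : ∀ i, Q.coeff i ∈ integralPoly K) : IsFrobLift p σ (toSeries Q) := by
  have : toSeries Q = ∑ i ∈ Finset.range (Q.natDegree + 1),
      C (Q.coeff i : PowerSeries K) * X ^ i := by
    conv_lhs => rw [Q.as_sum_range_C_mul_X_pow]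
    rw [toSeries, Polynomial.map_sum]
    simp
  rw [this]
  exact IsFrobLift.sum fun i => (isFrobLift_C_coe hK hσ (hQ i)).mul (isFrobLift_X.pow i)

/-- The elements on which the Frobenius lift is the `p`-th power modulo `p` are closed under sums
and products; they contain `X`, `Γ` and the integral constants, hence `Q`. -/
lemma frobError_mem_pgauss (hK : IsUnramified p K) (hσ : IsFrobenius p σ) {Q : K[X][X]}
    (hQ : ∀ i, Q.coeff i ∈ integralPoly K) : frobError p σ Q ∈ pgauss K (p : ℝ≥0)⁻¹ :=
  (isFrobLift_toSeries hK hσ hQ).2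

end FrobPoly

/-! ### Norm, weight and pole order of the terms of the Frobenius series. -/

section FrobTerm

variable (p : ℕ) [Fact p.Prime] {K : Type*} [NormedField K] [NormedAlgebra ℚ_[p] K]
  (σ : K ≃ₐ[ℚ_[p]] K)

/-- The numerator of the `n`-th term of the image of `X^i dX / √Q` under the Frobenius lift. -/
def frobNum (Q : K[X][X]) (i n : ℕ) : K[X][X] :=
  C (C ((Ring.choose (-1 / 2 : ℚ) n : ℚ) : K)) *
    (X ^ (p * i) * ((p : K[X][X]) * X ^ (p - 1)) * frobErrorPoly p σ Q ^ n)

lemma frobTerm_basisForm (Q : K[X][X]) (i n : ℕ) :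
    frobTerm p σ Q (basisForm i 1) 1 n =
      frac Q (toSeries (frobNum p σ Q i n)) (p * (2 * n + 1 : ℕ)) := by
  have h1 : toSeries (frobNum p σ Q i n) =
      C (PowerSeries.C ((Ring.choose (-1 / 2 : ℚ) n : ℚ) : K)) *
      (X ^ (p * i) * ((p : (PowerSeries K)[X]) * X ^ (p - 1)) * frobError p σ Q ^ n) := by
    rw [← toSeries_frobErrorPoly, frobNum]
    simp [toSeries]
  have h2 : frobPoly p σ (basisForm i 1) = X ^ (p * i) := by
    rw [frobPoly_eq, basisForm, if_pos rfl, map_pow, frobHom_X, pow_mul]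
  rw [frobTerm, h1, h2]
  congr 1
  push_cast
  ring

lemma frobTerm_zero (Q : K[X][X]) (k : ℤ) (n : ℕ) (m : ℤ) : frobTerm p σ Q 0 k n m = 0 := by
  rw [frobTerm, frobPoly_eq, map_zero, zero_mul, zero_mul, mul_zero, frac]
  simp

variable {p} {σ}

/-- One factor `p` comes from `dX ↦ p X^(p-1) dX` and `n` factors from the `n`-th power of the
error. -/
lemma frobNum_mem_pgauss [IsUltrametricDist K] (hp : p ≠ 2) (hK : IsUnramified p K)
    (hσ : IsFrobenius p σ) {Q : K[X][X]} (hQ : ∀ i, Q.coeff i ∈ integralPoly K) (i n : ℕ) :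
    toSeries (frobNum p σ Q i n) ∈ pgauss K ((p : ℝ≥0)⁻¹ ^ (n + 1)) := by
  have h1 : toSeries (frobNum p σ Q i n) =
      C (PowerSeries.C ((Ring.choose (-1 / 2 : ℚ) n : ℚ) : K)) * (X ^ (p * i) * X ^ (p - 1)) *
      (C (PowerSeries.C (p : K)) * frobError p σ Q ^ n) := by
    rw [← toSeries_frobErrorPoly, frobNum]
    simp only [toSeries, Polynomial.map_mul, Polynomial.map_pow, map_X, map_C,
      Polynomial.map_natCast, coeToPowerSeries.ringHom_apply, coe_C, map_natCast]
    ring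
  have h2 : ∀ n, frobError p σ Q ^ n ∈ pgauss K ((p : ℝ≥0)⁻¹ ^ n) := by
    intro n
    induction n with
    | zero => simpa using one_mem_pgauss
    | succ n ih =>
      rw [pow_succ, pow_succ]
      exact mul_mem_pgauss ih (frobError_mem_pgauss hK hσ hQ)
  rw [h1, pow_succ, mul_comm ((p : ℝ≥0)⁻¹ ^ n)]
  refine mul_mem_pgauss_of_left (mul_mem_pgauss_of_left
    (C_mem_pgauss (C_mem_gauss (nnnorm_choose_neg_half_le p K hp n)))
    (mul_mem_pgauss_of_left (X_pow_mem_pgauss _) (X_pow_mem_pgauss _)))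
    (mul_mem_pgauss (C_mem_pgauss (C_mem_gauss (nnnorm_prime p K).le)) (h2 n))

variable {g : ℕ} {Q : K[X][X]} (hQ : IsFamily g Q)
include hQ

lemma IsFamily.frobErrorPoly_mem_weight :
    frobErrorPoly p σ Q ∈ weight K (degΓ Q) (p * (degΓ Q * (2 * g + 1 : ℕ))) := by
  refine (weight K _ _).sub_mem ?_ (pow_mem_weight hQ.mem_weight p)
  have hp0 : 0 < p := (Fact.out : p.Prime).pos
  intro j e he
  rw [Polynomial.coeff_expand hp0]
  split_ifs with hj
  · obtain ⟨j, rfl⟩ := hj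
    rw [Nat.mul_div_cancel_left _ hp0, coeff_map, RingHom.comp_apply]
    change (Polynomial.expand K p (mapRingHom (σ : K →+* K) (Q.coeff j))).coeff e = 0
    rw [Polynomial.coeff_expand hp0]
    split_ifs with he'
    · obtain ⟨e, rfl⟩ := he'
      rw [Nat.mul_div_cancel_left _ hp0, coe_mapRingHom, coeff_map, hQ.mem_weight j e, map_zero]
      have h1 : (0 : ℤ) < p := by exact_mod_cast hp0
      refine lt_of_mul_lt_mul_left (a := (p : ℤ)) ?_ h1.le
      push_cast at he ⊢
      linarith
    · rfl
  · exact coeff_zero e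

lemma IsFamily.natDegree_frobErrorPoly_le :
    (frobErrorPoly p σ Q).natDegree ≤ p * (2 * g + 1) := by
  refine (natDegree_sub_le_of_le (m := p * (2 * g + 1)) (n := p * (2 * g + 1)) ?_ ?_).trans
    (by simp)
  · rw [natDegree_expand, mul_comm]
    exact Nat.mul_le_mul_left _ (natDegree_map_le.trans hQ.natDegree_eq.le)
  · rw [hQ.monic.natDegree_pow, hQ.natDegree_eq]

lemma IsFamily.frobNum_mem_weight {i : ℕ} (n : ℕ) :
    frobNum p σ Q i n ∈ weight K (degΓ Q)
      (degΓ Q * (p * i + (p - 1) + n * (p * (2 * g + 1)) : ℕ)) := by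
  have h1 : ((p : ℕ) : K[X][X]) ∈ weight K (degΓ Q) 0 := by
    rw [← map_natCast C, ← map_natCast C]; exact C_C_mem_weight _
  refine weight_mono (le_of_eq ?_) (mul_mem_weight (C_C_mem_weight _) (mul_mem_weight
    (mul_mem_weight (X_pow_mem_weight (p * i)) (mul_mem_weight h1 (X_pow_mem_weight (p - 1))))
    (pow_mem_weight hQ.frobErrorPoly_mem_weight n)))
  push_cast; ring

lemma IsFamily.natDegree_frobNum_le {i : ℕ} (n : ℕ) :
    (frobNum p σ Q i n).natDegree ≤ p * i + (p - 1) + n * (p * (2 * g + 1)) := by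
  refine (natDegree_C_mul_le _ _).trans (natDegree_mul_le_of_le (natDegree_mul_le_of_le
    (natDegree_X_pow_le _) ?_) (natDegree_pow_le_of_le n hQ.natDegree_frobErrorPoly_le))
  rw [← map_natCast C]
  exact (natDegree_C_mul_le _ _).trans (natDegree_X_pow_le _)

/-- The numerator has `X`-degree less than `(2g+1) p (n+1)`, so digits of index `p(2n+1)` or more
vanish. The `j`-th digit belongs to `k = p(2n+1) - 2j`, hence `|k| ≤ p(2n+1)` for every surviving
term. -/
lemma IsFamily.frac_frobNum_eq_zero {i : ℕ} (hi : i < 2 * g) (n : ℕ) {k : ℤ}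
    (hk : p * (2 * n + 1) < k.natAbs) :
    frac Q (toSeries (frobNum p σ Q i n)) (p * (2 * n + 1 : ℕ)) k = 0 := by
  rcases frac_cases (p * (2 * n + 1 : ℕ)) k with h | h | ⟨j, hj⟩
  · exact frac_of_lt _ h
  · exact frac_of_not_even _ h
  · have hp0 : 0 < p := (Fact.out : p.Prime).pos
    rw [hj, frac_sub_two_mul, divByMonic_pow_eq_zero hQ.monic_toSeries
      (d := 2 * g + 1) hQ.natDegree_toSeries.ge, zero_modByMonic]
    have hj' : p * (2 * n + 1) ≤ j := by
      zify at hk ⊢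
      rcases abs_cases k with h | h <;> push_cast at hj <;> linarith
    refine (natDegree_map_le.trans (hQ.natDegree_frobNum_le n)).trans_lt ?_
    refine lt_of_lt_of_le ?_ (Nat.mul_le_mul_left _ hj')
    have h1 : p * i + (p - 1) < p * (2 * g + 1) := by
      have := Nat.mul_le_mul_left p (Nat.succ_le_of_lt hi)
      rw [Nat.mul_succ] at this
      have h2 : p * (2 * g + 1) = p * (2 * g) + p := by ring
      omega
    nlinarith [Nat.zero_le (n * (p * (2 * g + 1)))]

end FrobTerm

/-! ### Summation of the Frobenius series and its tail. -/

section Frob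

variable {p : ℕ} [Fact p.Prime] {K : Type*} [NormedField K] [NormedAlgebra ℚ_[p] K]
  {σ : K ≃ₐ[ℚ_[p]] K}

lemma hasSum_mem_ball [IsUltrametricDist K] {c : ℝ≥0} {ι : Type*} {f : ι → K} {a : K}
    (h : HasSum f a) (hf : ∀ i, f i ∈ ball K c) : a ∈ ball K c := by
  have hclosed : IsClosed ((ball K c : AddSubgroup K) : Set K) :=
    isClosed_le continuous_nnnorm continuous_const
  exact hclosed.mem_of_tendsto h (Filter.Eventually.of_forall fun s =>
    (ball K c).sum_mem fun i _ => hf i)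

lemma tsum_mem_ball [IsUltrametricDist K] {c : ℝ≥0} {ι : Type*} {f : ι → K}
    (hf : ∀ i, f i ∈ ball K c) : ∑' i, f i ∈ ball K c := by
  by_cases h : Summable f
  · exact hasSum_mem_ball h.hasSum hf
  · rw [tsum_eq_zero_of_not_summable h]; exact (ball K c).zero_mem

lemma natDegree_frob_le (g : ℕ) (Q : K[X][X]) (t : ℤ → (PowerSeries K)[X]) (m : ℤ) :
    (frob p g σ Q t m).natDegree ≤ 2 * g := by
  refine natDegree_sum_le_of_forall_le _ _ fun i hi => ?_
  exact (natDegree_monomial_le _).trans (Nat.lt_succ_iff.1 (Finset.mem_range.1 hi))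

lemma coeff_frob_basisForm {g : ℕ} {Q : K[X][X]} {i j : ℕ} (hj : j ≤ 2 * g) (m : ℤ) (e : ℕ) :
    PowerSeries.coeff e ((frob p g σ Q (basisForm i) m).coeff j) =
      ∑' n : ℕ, PowerSeries.coeff e
        ((frac Q (toSeries (frobNum p σ Q i n)) (p * (2 * n + 1 : ℕ)) m).coeff j) := by
  rw [frob, finsetSum_coeff, Finset.sum_eq_single j]
  · rw [coeff_monomial, if_pos rfl, PowerSeries.coeff_mk]
    -- A basis form lives at `k = 1` only, so the sum over pairs collapses to a sum over `n`.
    have hinj : Function.Injective (fun n : ℕ => ((1 : ℤ), n)) := fun a b h => (Prod.ext_iff.1 h).2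
    rw [← hinj.tsum_eq]
    · simp only [frobTerm_basisForm]
    · rintro ⟨k, n⟩ hk
      by_cases hk1 : k = 1
      · exact ⟨n, by rw [hk1]⟩
      · exfalso
        apply hk
        simp only [basisForm, if_neg hk1, frobTerm_zero, coeff_zero, map_zero]
  · intro b _ hb
    rw [coeff_monomial, if_neg hb]
  · intro h
    exact absurd (Finset.mem_range.2 (Nat.lt_succ_of_le hj)) h

/-- The tail of the series that defines the Frobenius lift. -/
lemma IsFamily.frob_sub_sum_mem_pgauss [CompleteSpace K] [IsUltrametricDist K] (hp : p ≠ 2)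
    (hK : IsUnramified p K) (hσ : IsFrobenius p σ) {g : ℕ} {Q : K[X][X]} (hQ : IsFamily g Q)
    {i : ℕ} (m : ℤ) (n₁ : ℕ) {c : ℝ≥0}
    (hc : ∀ n, n₁ ≤ n → frac Q (toSeries (frobNum p σ Q i n)) (p * (2 * n + 1 : ℕ)) m ∈
      pgauss K c) :
    frob p g σ Q (basisForm i) m - ∑ n ∈ Finset.range n₁,
      frac Q (toSeries (frobNum p σ Q i n)) (p * (2 * n + 1 : ℕ)) m ∈ pgauss K c := by
  intro j
  by_cases hj : j ≤ 2 * g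
  · intro e
    set f : ℕ → K := fun n => PowerSeries.coeff e
        ((frac Q (toSeries (frobNum p σ Q i n)) (p * (2 * n + 1 : ℕ)) m).coeff j) with hf
    have hfb : ∀ n, ‖f n‖ ≤ ((p : ℝ)⁻¹) ^ (n + 1) := fun n => by
      have h1 := frac_mem_pgauss hQ.monic_toSeries hQ.toSeries_mem_pgauss
        (frobNum_mem_pgauss hp hK hσ hQ.coeff_mem_integralPoly i n) (p * (2 * n + 1 : ℕ)) m j e
      exact_mod_cast NNReal.coe_le_coe.2 h1
    have hsum : Summable f := by
      have hp1 : (p : ℝ)⁻¹ < 1 :=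
        inv_lt_one_of_one_lt₀ (by exact_mod_cast (Fact.out : p.Prime).one_lt)
      exact Summable.of_norm_bounded
        ((summable_nat_add_iff 1).2 (summable_geometric_of_lt_one (by positivity) hp1)) hfb
    have h2 : PowerSeries.coeff e ((frob p g σ Q (basisForm i) m - ∑ n ∈ Finset.range n₁,
        frac Q (toSeries (frobNum p σ Q i n)) (p * (2 * n + 1 : ℕ)) m).coeff j) =
        ∑' n, f (n + n₁) := by
      rw [coeff_sub, map_sub, coeff_frob_basisForm hj, finsetSum_coeff, map_sum,
        ← hsum.sum_add_tsum_nat_add n₁, add_sub_cancel_left]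
    rw [h2]
    exact tsum_mem_ball fun n => hc _ (Nat.le_add_left _ _) j e
  · have h1 : ∀ P : (PowerSeries K)[X], P.natDegree ≤ 2 * g → P.coeff j = 0 := fun P hP =>
      coeff_eq_zero_of_natDegree_lt (by omega)
    rw [coeff_sub, h1 _ (natDegree_frob_le g Q _ m), finsetSum_coeff, Finset.sum_eq_zero, sub_zero]
    · exact (gauss K c).zero_mem
    · exact fun n _ => h1 _ (natDegree_frac_le hQ.monic_toSeries hQ.natDegree_toSeries _ _ _)

end Frob

/-! ### The ring `S` and its Gauss norm -/

section UnitPart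

variable {K : Type*} [NormedField K]

/-- An integral polynomial with unit leading coefficient and unit constant coefficient. -/
structure IsUnitPoly (R : K[X]) : Prop where
  integral : ∀ n, ‖R.coeff n‖ ≤ 1
  leading : ‖R.coeff R.natDegree‖ = 1
  constant : ‖R.coeff 0‖ = 1

lemma coeff_unitPart (r : K[X]) (n : ℕ) :
    (unitPart r).coeff n = if n ≤ unitDegree r then r.coeff n else 0 := by
  rw [unitPart, finsetSum_coeff]
  simp only [coeff_monomial, Finset.sum_ite_eq', Finset.mem_range, Nat.lt_succ_iff]

/-- As `r(0)` is a unit, the set of unit coefficients is nonempty and its largest index is attained,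
so the cut-off polynomial has a unit leading coefficient. -/
lemma isUnitPoly_unitPart {r : K[X]} (h : ∀ n, ‖r.coeff n‖ ≤ 1) (h0 : ‖r.coeff 0‖ = 1) :
    IsUnitPoly (unitPart r) := by
  classical
  have hmem : ‖r.coeff (unitDegree r)‖ = 1 := by
    have hne : (r.support.filter fun i => ‖r.coeff i‖ = 1).Nonempty := by
      refine ⟨0, Finset.mem_filter.2 ⟨mem_support_iff.2 ?_, h0⟩⟩
      intro h; rw [h, norm_zero] at h0; exact zero_ne_one h0
    obtain ⟨i, hi, hi'⟩ := Finset.exists_mem_eq_sup _ hne id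
    have : unitDegree r = i := by
      rw [unitDegree]
      convert hi'
      rfl
    rw [this]
    exact (Finset.mem_filter.1 hi).2
  have hc : (unitPart r).coeff (unitDegree r) = r.coeff (unitDegree r) := by
    rw [coeff_unitPart, if_pos le_rfl]
  have hdeg : (unitPart r).natDegree = unitDegree r := by
    refine le_antisymm (natDegree_le_iff_coeff_eq_zero.2 fun n hn => ?_)
      (le_natDegree_of_ne_zero ?_)
    · rw [coeff_unitPart, if_neg (by omega)]
    · rw [hc]; intro h; rw [h, norm_zero] at hmem; exact zero_ne_one hmem
  refine ⟨fun n => ?_, by rw [hdeg, hc, hmem], by rw [coeff_unitPart, if_pos (Nat.zero_le _), h0]⟩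
  rw [coeff_unitPart]
  split_ifs
  · exact h n
  · simp

end UnitPart

/-! ### The order on `S` is the order of the Gauss norm. -/

section Expansion

variable {K : Type*} [NormedField K] {R : K[X]} {C₀ θ : ℝ} {a : ℕ → K} {b : ℕ → K[X]}
  {s : PowerSeries K}

lemma HasExpansion.const_nonneg (h : HasExpansion R C₀ θ a b s) : 0 ≤ C₀ := by
  have := (norm_nonneg _).trans (h.norm_a_le 0)
  simpa using this

variable [IsUltrametricDist K]

lemma coe_mem_gauss {q : K[X]} {c : ℝ≥0} (h : ∀ n, q.coeff n ∈ ball K c) :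
    (q : PowerSeries K) ∈ gauss K c := by
  intro n
  rw [coeff_coe]
  exact h n

lemma IsUnitPoly.mem_gauss (hR : IsUnitPoly R) : (R : PowerSeries K) ∈ gauss K 1 :=
  coe_mem_gauss fun n => hR.integral n

lemma IsUnitPoly.inv_mem_gauss (hR : IsUnitPoly R) : (R : PowerSeries K)⁻¹ ∈ gauss K 1 :=
  HyperellipticFamily.inv_mem_gauss hR.mem_gauss (by
    rw [constantCoeff_coe]; exact hR.constant)

omit [IsUltrametricDist K] in
lemma IsUnitPoly.mul_inv (hR : IsUnitPoly R) :
    (R : PowerSeries K) * (R : PowerSeries K)⁻¹ = 1 :=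
  PowerSeries.mul_inv_cancel _ (by
    rw [constantCoeff_coe]
    intro h
    have := hR.constant
    rw [h, norm_zero] at this
    exact zero_ne_one this)

lemma IsUnitPoly.mul_inv_pow_mem_gauss (hR : IsUnitPoly R) {q : K[X]} {c : ℝ≥0}
    (h : ∀ n, q.coeff n ∈ ball K c) (j : ℕ) :
    (q : PowerSeries K) * ((R : PowerSeries K)⁻¹) ^ j ∈ gauss K c := by
  simpa using mul_mem_gauss (coe_mem_gauss h) (pow_mem_gauss hR.inv_mem_gauss j)

/-- The Gauss norm of a series is bounded by the coefficients of its expansion. -/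
lemma HasExpansion.mem_gauss (hR : IsUnitPoly R) (h : HasExpansion R C₀ θ a b s) {c : ℝ≥0}
    (ha : ∀ i, ‖a i‖ ≤ c) (hb : ∀ j m, ‖(b j).coeff m‖ ≤ c) : s ∈ gauss K c := by
  intro n
  have h1 := hasSum_mem_ball (h.hasSum n)
    (fun j => hR.mul_inv_pow_mem_gauss (fun m => hb j m) (j + 1) n)
  have := (ball K c).add_mem h1 (show a n ∈ ball K c from ha n)
  rwa [sub_add_cancel] at this

/-- After division of `R` by its unit leading coefficient, `q` (up to a unit) and `t` are quotient
and remainder by a monic integral polynomial. -/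
lemma IsUnitPoly.coeff_mem_of_mul_add (hR : IsUnitPoly R) {q t : K[X]} {c : ℝ≥0}
    (ht : t.degree < (R.natDegree : WithBot ℕ)) (h : ∀ n, (q * R + t).coeff n ∈ ball K c) :
    (∀ n, q.coeff n ∈ ball K c) ∧ ∀ n, t.coeff n ∈ ball K c := by
  set l := R.coeff R.natDegree with hl
  have hl0 : l ≠ 0 := by
    intro h0; have := hR.leading; rw [← hl, h0, norm_zero] at this; exact zero_ne_one this
  have hli : ‖l⁻¹‖₊ ≤ 1 := by
    rw [← NNReal.coe_le_coe, coe_nnnorm, norm_inv, hl, hR.leading]; simp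
  set R' := C l⁻¹ * R with hR'
  have hmon : R'.Monic := by
    rw [Monic, hR', leadingCoeff_mul, leadingCoeff_C]
    exact inv_mul_cancel₀ hl0
  have hR'd : R'.degree = R.natDegree := by
    rw [hR', degree_C_mul (inv_ne_zero hl0), degree_eq_natDegree]
    rintro rfl
    simp [hl] at hl0
  have hG : t + R' * (C l * q) = q * R + t := by
    have : (C l⁻¹ : K[X]) * C l = 1 := by rw [← C_mul, inv_mul_cancel₀ hl0, C_1]
    rw [hR']
    linear_combination q * R * this
  obtain ⟨e1, e2⟩ := div_modByMonic_unique (C l * q) t hmon ⟨hG, by rw [hR'd]; exact ht⟩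
  obtain ⟨h1, h2⟩ := coeff_div_mod_mem hmon (fun _ => ball K c) (P := q * R + t) (by
    intro _ i _ x hx
    have h3 : R'.coeff i ∈ ball K (1 * 1) := by
      rw [hR', coeff_C_mul]; exact mul_mem_ball hli (hR.integral i)
    simpa using mul_mem_ball hx h3) h
  rw [e1] at h1
  rw [e2] at h2
  refine ⟨fun n => ?_, h2⟩
  have h4 := mul_mem_ball (show l⁻¹ ∈ ball K 1 from hli) (h1 n)
  rwa [coeff_C_mul, ← mul_assoc, inv_mul_cancel₀ hl0, one_mul, one_mul] at h4

/-- Uniqueness of the `R`-adic expansion with norms. -/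
lemma IsUnitPoly.coeff_mem_of_sum (hR : IsUnitPoly R)
    (hb : ∀ j, (b j).degree < (R.natDegree : WithBot ℕ)) {c : ℝ≥0} {A : K[X]} (J : ℕ)
    (h : (A : PowerSeries K) + ∑ j ∈ Finset.range J,
      (b j : PowerSeries K) * ((R : PowerSeries K)⁻¹) ^ (j + 1) ∈ gauss K c) :
    (∀ n, A.coeff n ∈ ball K c) ∧ ∀ j < J, ∀ n, (b j).coeff n ∈ ball K c := by
  have hpow : ∀ j, (R : PowerSeries K) ^ j * ((R : PowerSeries K)⁻¹) ^ j = 1 := fun j => by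
    rw [← mul_pow, hR.mul_inv, one_pow]
  -- Clearing denominators by Horner's scheme: `G (J + 1) = G J * R + b J`. Repeated division by `R`
  -- then recovers the `b j` from the last one down, and finally `A`.
  obtain ⟨G, hG⟩ : ∃ G : ℕ → K[X], ∀ J, (G J : PowerSeries K) = (R : PowerSeries K) ^ J *
      ((A : PowerSeries K) + ∑ j ∈ Finset.range J,
      (b j : PowerSeries K) * ((R : PowerSeries K)⁻¹) ^ (j + 1)) := by
    refine ⟨fun J => Nat.rec A (fun J q => q * R + b J) J, fun J => ?_⟩
    induction J with
    | zero => simp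
    | succ J ih =>
      have h1 := hpow (J + 1)
      rw [coe_add, coe_mul, ih, Finset.sum_range_succ, pow_succ]
      rw [pow_succ] at h1
      linear_combination -(b J : PowerSeries K) * h1
  have hstep : ∀ J, G (J + 1) = G J * R + b J := fun J => by
    have h1 := hpow (J + 1)
    rw [← coe_inj, hG, coe_add, coe_mul, hG, Finset.sum_range_succ, pow_succ]
    rw [pow_succ] at h1
    linear_combination (b J : PowerSeries K) * h1
  have key : ∀ J, (∀ n, (G J).coeff n ∈ ball K c) →
      (∀ n, A.coeff n ∈ ball K c) ∧ ∀ j < J, ∀ n, (b j).coeff n ∈ ball K c := by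
    intro J
    induction J with
    | zero =>
      intro hGc
      have h0 := hG 0
      rw [Finset.sum_range_zero, pow_zero, one_mul, add_zero, coe_inj] at h0
      exact ⟨h0 ▸ hGc, fun j hj => absurd hj (Nat.not_lt_zero j)⟩
    | succ J ih =>
      intro hGc
      rw [hstep] at hGc
      obtain ⟨h1, h2⟩ := hR.coeff_mem_of_mul_add (hb J) hGc
      obtain ⟨h3, h4⟩ := ih h1
      refine ⟨h3, fun j hj => ?_⟩
      rcases Nat.lt_succ_iff_lt_or_eq.1 hj with hj | rfl
      · exact h4 j hj
      · exact h2
  refine key J fun n => ?_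
  rw [← coeff_coe, hG]
  have := mul_mem_gauss (pow_mem_gauss hR.mem_gauss J) h n
  rwa [one_mul] at this

/-- The coefficients of the expansion of a series are bounded by its Gauss norm. -/
lemma HasExpansion.coeff_mem_ball (hR : IsUnitPoly R) (h : HasExpansion R C₀ θ a b s) (hθ0 : 0 < θ)
    (hθ1 : θ < 1) {c : ℝ≥0} (hc : 0 < c) (hs : s ∈ gauss K c) :
    (∀ i, a i ∈ ball K c) ∧ ∀ j m, (b j).coeff m ∈ ball K c := by
  -- Beyond `J` all coefficients of the expansion are already at most `c`. Removing them leaves a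
  -- finite expansion of Gauss norm at most `c`.
  obtain ⟨J, hJ⟩ : ∃ J : ℕ, ∀ j, J ≤ j → C₀ * θ ^ j ≤ c := by
    have h1 : Filter.Tendsto (fun j : ℕ => C₀ * θ ^ j) Filter.atTop (nhds 0) := by
      simpa using (tendsto_pow_atTop_nhds_zero_of_lt_one hθ0.le hθ1).const_mul C₀
    exact Filter.eventually_atTop.1 (h1.eventually (ge_mem_nhds (by exact_mod_cast hc)))
  have ha : ∀ i, J ≤ i → a i ∈ ball K c := fun i hi => (h.norm_a_le i).trans (hJ i hi)
  have hb : ∀ j, J ≤ j → ∀ m, (b j).coeff m ∈ ball K c := fun j hj m =>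
    (h.norm_b_le j m).trans (hJ (j + 1) (by omega))
  suffices H : ∀ I, J ≤ I → (∀ i < I, a i ∈ ball K c) ∧
      ∀ j < I, ∀ m, (b j).coeff m ∈ ball K c by
    refine ⟨fun i => (H (max J (i + 1)) (le_max_left _ _)).1 i
      (lt_of_lt_of_le (Nat.lt_succ_self i) (le_max_right _ _)), fun j m =>
      (H (max J (j + 1)) (le_max_left _ _)).2 j
      (lt_of_lt_of_le (Nat.lt_succ_self j) (le_max_right _ _)) m⟩
  intro I hI
  set A : K[X] := ∑ i ∈ Finset.range I, monomial i (a i) with hA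
  have hAc : ∀ n, A.coeff n = if n < I then a n else 0 := fun n => by
    rw [hA, finsetSum_coeff]
    simp only [coeff_monomial, Finset.sum_ite_eq', Finset.mem_range]
  have hmain : (A : PowerSeries K) + ∑ j ∈ Finset.range I,
      (b j : PowerSeries K) * ((R : PowerSeries K)⁻¹) ^ (j + 1) ∈ gauss K c := by
    intro n
    set f : ℕ → K := fun j => PowerSeries.coeff n
      ((b j : PowerSeries K) * ((R : PowerSeries K)⁻¹) ^ (j + 1)) with hf
    have h2 : HasSum (fun j => f (j + I)) (PowerSeries.coeff n s - a n -
        ∑ j ∈ Finset.range I, f j) := (hasSum_nat_add_iff' I).2 (h.hasSum n)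
    have h3 := hasSum_mem_ball h2 (fun j => hR.mul_inv_pow_mem_gauss
      (fun m => hb (j + I) (by omega) m) (j + I + 1) n)
    have h4 : A.coeff n - a n ∈ ball K c := by
      rw [hAc]
      split_ifs with hn
      · rw [sub_self]; exact (ball K c).zero_mem
      · rw [zero_sub]; exact (ball K c).neg_mem (ha n (by omega))
    have h5 := (ball K c).add_mem ((ball K c).sub_mem (hs n) h3) h4
    rw [map_add, map_sum, coeff_coe]
    convert h5 using 1
    simp only [hf]
    ring
  obtain ⟨h1, h2⟩ := hR.coeff_mem_of_sum h.degree_lt I hmain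
  refine ⟨fun i hi => ?_, h2⟩
  have := h1 i
  rwa [hAc, if_pos hi] at this

/-- With its converse below, the dictionary by which statements on `ord` become Gauss-norm
estimates; membership in `S` has to be supplied separately. -/
lemma ordGE_of_mem_gauss {p : ℕ} [Fact p.Prime] (hR : IsUnitPoly R) {x : ℝ} (hs : s ∈ S R)
    (h : s ∈ gauss K ((p : ℝ≥0) ^ (-x))) : OrdGE p R x s := by
  obtain ⟨C₀, θ, hθ0, hθ1, a, b, hex⟩ := hs
  have hp : (0 : ℝ≥0) < p := by exact_mod_cast (Fact.out : p.Prime).pos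
  obtain ⟨h1, h2⟩ := hex.coeff_mem_ball hR hθ0 hθ1 (NNReal.rpow_pos hp) h
  refine ⟨C₀, θ, hθ0, hθ1, a, b, hex, fun i => ?_, fun j m => ?_⟩
  · simpa using NNReal.coe_le_coe.2 (h1 i)
  · simpa using NNReal.coe_le_coe.2 (h2 j m)

lemma mem_gauss_of_ordGE {p : ℕ} [Fact p.Prime] (hR : IsUnitPoly R) {x : ℝ}
    (h : OrdGE p R x s) : s ∈ gauss K ((p : ℝ≥0) ^ (-x)) := by
  obtain ⟨C₀, θ, hθ0, hθ1, a, b, hex, h1, h2⟩ := h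
  exact hex.mem_gauss hR (fun i => by simpa using h1 i) (fun j m => by simpa using h2 j m)

end Expansion

/-! ### `S` is stable under sums and under multiplication by polynomials in `Γ`. -/

section Ring

variable {K : Type*} [NormedField K] {R : K[X]}

lemma coe_mem_S (P : K[X]) : (P : PowerSeries K) ∈ S R := by
  refine ⟨∑ i ∈ P.support, ‖P.coeff i‖ * 2 ^ i, 1 / 2, by norm_num, by norm_num, P.coeff,
    fun _ => 0, ⟨fun j => ?_, fun n => ?_, fun i => ?_, fun j m => ?_⟩⟩
  · rw [degree_zero]; exact WithBot.bot_lt_coe _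
  · simp
  · by_cases hi : P.coeff i = 0
    · rw [hi, norm_zero]; positivity
    · have h1 := Finset.single_le_sum (f := fun i => ‖P.coeff i‖ * 2 ^ i)
        (fun i _ => by positivity) (mem_support_iff.2 hi)
      calc ‖P.coeff i‖ = ‖P.coeff i‖ * 2 ^ i * (1 / 2) ^ i := by
            rw [mul_assoc, ← mul_pow]; norm_num
        _ ≤ _ := mul_le_mul_of_nonneg_right h1 (by positivity)
  · rw [coeff_zero, norm_zero]; positivity

lemma add_mem_S {s t : PowerSeries K} (hs : s ∈ S R) (ht : t ∈ S R) : s + t ∈ S R := by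
  obtain ⟨C₁, θ₁, h10, h11, a₁, b₁, h1⟩ := hs
  obtain ⟨C₂, θ₂, h20, h21, a₂, b₂, h2⟩ := ht
  have e : ∀ n : ℕ, C₁ * θ₁ ^ n + C₂ * θ₂ ^ n ≤ (C₁ + C₂) * max θ₁ θ₂ ^ n := fun n => by
    rw [add_mul]
    exact add_le_add
      (mul_le_mul_of_nonneg_left (pow_le_pow_left₀ h10.le (le_max_left _ _) n) h1.const_nonneg)
      (mul_le_mul_of_nonneg_left (pow_le_pow_left₀ h20.le (le_max_right _ _) n) h2.const_nonneg)
  refine ⟨C₁ + C₂, max θ₁ θ₂, lt_max_of_lt_left h10, max_lt h11 h21, a₁ + a₂, b₁ + b₂,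
    ⟨fun j => ?_, fun n => ?_, fun i => ?_, fun j m => ?_⟩⟩
  · exact (degree_add_le _ _).trans_lt (max_lt (h1.degree_lt j) (h2.degree_lt j))
  · convert (h1.hasSum n).add (h2.hasSum n) using 1
    · funext j
      rw [Pi.add_apply, coe_add, add_mul, map_add]
    · rw [map_add, Pi.add_apply]; ring
  · exact (norm_add_le _ _).trans ((add_le_add (h1.norm_a_le i) (h2.norm_a_le i)).trans (e i))
  · rw [Pi.add_apply, coeff_add]
    exact (norm_add_le _ _).trans
      ((add_le_add (h1.norm_b_le j m) (h2.norm_b_le j m)).trans (e (j + 1)))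

lemma C_mul_mem_S (x : K) {s : PowerSeries K} (hs : s ∈ S R) : PowerSeries.C x * s ∈ S R := by
  obtain ⟨C₁, θ₁, h10, h11, a, b, h⟩ := hs
  refine ⟨‖x‖ * C₁, θ₁, h10, h11, fun i => x * a i, fun j => C x * b j,
    ⟨fun j => ?_, fun n => ?_, fun i => ?_, fun j m => ?_⟩⟩
  · rw [← smul_eq_C_mul]
    exact (degree_smul_le _ _).trans_lt (h.degree_lt j)
  · have h1 := (h.hasSum n).mul_left x
    rw [mul_sub] at h1
    simpa only [coe_mul, coe_C, mul_assoc, PowerSeries.coeff_C_mul] using h1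
  · rw [norm_mul, mul_assoc]
    exact mul_le_mul_of_nonneg_left (h.norm_a_le i) (norm_nonneg x)
  · rw [coeff_C_mul, norm_mul, mul_assoc]
    exact mul_le_mul_of_nonneg_left (h.norm_b_le j m) (norm_nonneg x)

lemma sub_mem_S {s t : PowerSeries K} (hs : s ∈ S R) (ht : t ∈ S R) : s - t ∈ S R := by
  have : s - t = s + PowerSeries.C (-1) * t := by rw [map_neg, map_one]; ring
  rw [this]
  exact add_mem_S hs (C_mul_mem_S _ ht)

variable [IsUltrametricDist K] [CompleteSpace K]

/-- `Γ b_j` may reach the degree of `R`. Its leading part `c_j R` is moved to the preceding fraction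
as `c_j / R^j`; for `j = 0` it becomes the new constant term. Since the `a_i` also move up by one
index, the constant grows to `C₁ / θ`. -/
lemma X_mul_mem_S (hR : IsUnitPoly R) {s : PowerSeries K} (hs : s ∈ S R) :
    PowerSeries.X * s ∈ S R := by
  obtain ⟨C₁, θ, h0, h1, a, b, h⟩ := hs
  have hC := h.const_nonneg
  set ρ := R.natDegree with hρ
  set c : ℕ → K := fun j => (b j).coeff (ρ - 1) * (R.coeff ρ)⁻¹ with hc
  have hl0 : R.coeff ρ ≠ 0 := by
    intro h0; have := hR.leading; rw [← hρ, h0, norm_zero] at this; exact zero_ne_one this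
  have hcn : ∀ j, ‖c j‖ ≤ C₁ * θ ^ (j + 1) := fun j => by
    simp only [hc]
    rw [norm_mul, norm_inv, hρ, hR.leading, inv_one, mul_one]
    exact h.norm_b_le j _
  have hle : ∀ n : ℕ, C₁ * θ ^ n ≤ C₁ / θ * θ ^ n := fun n => by
    refine mul_le_mul_of_nonneg_right ?_ (by positivity)
    rw [le_div_iff₀ h0]
    nlinarith
  have hbd : ∀ j m, ρ ≤ m → (b j).coeff m = 0 := fun j m hm =>
    coeff_eq_zero_of_degree_lt ((h.degree_lt j).trans_le (by exact_mod_cast hm))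
  refine ⟨C₁ / θ, θ, h0, h1, fun i => Nat.casesOn i (c 0) a,
    fun j => X * b j - C (c j) * R + C (c (j + 1)), ⟨fun j => ?_, fun n => ?_, fun i => ?_,
    fun j m => ?_⟩⟩
  · rw [degree_lt_iff_coeff_zero]
    intro m hm
    rw [coeff_add, coeff_sub, coeff_C_mul, coeff_C]
    rcases Nat.eq_zero_or_pos ρ with hz | hpos
    · have hb0 : ∀ j, b j = 0 := fun j => Polynomial.ext fun m => by
        rw [hbd j m (by omega), coeff_zero]
      simp [hc, hb0]
    · obtain ⟨m, rfl⟩ := Nat.exists_eq_add_of_le' (hpos.trans_le hm)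
      rw [coeff_X_mul, if_neg (by omega), add_zero]
      by_cases hm' : m + 1 = ρ
      · rw [hm', hc]
        simp only
        rw [mul_assoc, inv_mul_cancel₀ hl0, mul_one, ← hm', Nat.add_sub_cancel, sub_self]
      · rw [hbd j m (by omega), coeff_eq_zero_of_natDegree_lt (p := R) (by omega), mul_zero,
          sub_zero]
  · set f : ℕ → K := fun j => PowerSeries.coeff n
      (PowerSeries.C (c j) * ((R : PowerSeries K)⁻¹) ^ j) with hf
    have hfs : Summable f := by
      refine Summable.of_norm_bounded (g := fun j => C₁ * θ ^ (j + 1))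
        (((summable_nat_add_iff 1).2 (summable_geometric_of_lt_one h0.le h1)).mul_left C₁) fun j => ?_
      rw [hf]
      simp only
      rw [PowerSeries.coeff_C_mul, norm_mul]
      have h2 : ‖PowerSeries.coeff n (((R : PowerSeries K)⁻¹) ^ j)‖ ≤ 1 :=
        pow_mem_gauss hR.inv_mem_gauss j n
      calc _ ≤ C₁ * θ ^ (j + 1) * 1 :=
            mul_le_mul (hcn j) h2 (norm_nonneg _) (by positivity)
        _ = _ := mul_one _
    -- The parts moved between neighbouring fractions telescope, leaving only the one that joins the
    -- polynomial part.
    have htel : HasSum (fun j => f (j + 1) - f j) (-f 0) := by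
      have h2 := ((hasSum_nat_add_iff' 1).2 hfs.hasSum).sub hfs.hasSum
      simpa using h2
    have hXb : HasSum (fun j => PowerSeries.coeff n (PowerSeries.X * ((b j : PowerSeries K) *
        ((R : PowerSeries K)⁻¹) ^ (j + 1))))
        (PowerSeries.coeff n (PowerSeries.X * s) - Nat.casesOn n 0 a) := by
      cases n with
      | zero => simp
      | succ n =>
        simp only [PowerSeries.coeff_succ_X_mul]
        exact h.hasSum n
    have hf0 : (Nat.casesOn n (c 0) a : K) = f 0 + Nat.casesOn n 0 a := by
      cases n with
      | zero => simp [hf]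
      | succ n => simp [hf]
    convert hXb.add htel using 1
    · funext j
      simp only [hf]
      rw [← map_sub, ← map_add]
      congr 1
      have h2 : (R : PowerSeries K) * ((R : PowerSeries K)⁻¹) ^ (j + 1) =
          ((R : PowerSeries K)⁻¹) ^ j := by
        rw [pow_succ']; linear_combination ((R : PowerSeries K)⁻¹) ^ j * hR.mul_inv
      rw [coe_add, coe_sub, coe_mul, coe_mul, coe_X, coe_C, coe_C]
      linear_combination (-PowerSeries.C (c j)) * h2
    · rw [hf0]; ring
  · cases i with
    | zero =>
      refine (hcn 0).trans ?_
      rw [zero_add, pow_one, pow_zero, mul_one, le_div_iff₀ h0]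
      nlinarith [mul_le_mul_of_nonneg_left (mul_le_one₀ h1.le h0.le h1.le) hC]
    | succ i =>
      refine (h.norm_a_le i).trans (le_of_eq ?_)
      field_simp
      rw [pow_succ]; ring
  · refine le_trans ?_ (hle (j + 1))
    set B : ℝ≥0 := ⟨C₁ * θ ^ (j + 1), by positivity⟩ with hB
    have hcB : c j ∈ ball K B := hcn j
    have hcB' : c (j + 1) ∈ ball K B := by
      refine (hcn (j + 1)).trans ?_
      rw [pow_succ θ (j + 1), ← mul_assoc]
      exact mul_le_of_le_one_right (by positivity) h1.le
    have hmem : (X * b j - C (c j) * R + C (c (j + 1))).coeff m ∈ ball K B := by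
      rw [coeff_add, coeff_sub, coeff_C_mul, coeff_C]
      refine (ball K B).add_mem ((ball K B).sub_mem ?_ ?_) ?_
      · cases m with
        | zero => simp [(ball K B).zero_mem]
        | succ m => rw [coeff_X_mul]; exact h.norm_b_le j m
      · simpa using mul_mem_ball hcB (show R.coeff m ∈ ball K 1 from hR.integral m)
      · split_ifs
        · exact hcB'
        · exact (ball K B).zero_mem
    exact hmem

lemma coe_mul_mem_S (hR : IsUnitPoly R) (P : K[X]) {s : PowerSeries K} (hs : s ∈ S R) :
    (P : PowerSeries K) * s ∈ S R := by
  induction P using Polynomial.induction_on' with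
  | add P P' h1 h2 => rw [coe_add, add_mul]; exact add_mem_S h1 h2
  | monomial n x =>
    rw [← C_mul_X_pow_eq_monomial, coe_mul, coe_C, coe_pow, coe_X, mul_assoc]
    refine C_mul_mem_S x ?_
    induction n with
    | zero => simpa using hs
    | succ n ih => rw [pow_succ', mul_assoc]; exact X_mul_mem_S hR ih

end Ring

/-! ### The Frobenius matrix -/

section Differential

variable {K : Type*} [NormedField K] {Q : K[X][X]}

lemma sub_divByMonic (hQ : (toSeries Q).Monic) (P R : (PowerSeries K)[X]) :
    (P - R) /ₘ toSeries Q = P /ₘ toSeries Q - R /ₘ toSeries Q := by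
  rw [eq_sub_iff_add_eq, ← add_divByMonic hQ, sub_add_cancel]

lemma d_sub (hQ : (toSeries Q).Monic) (t τ : ℤ → (PowerSeries K)[X]) (k : ℤ) :
    d Q (fun k => t k - τ k) k = d Q t k - d Q τ k := by
  have h : ∀ k, poleTerm Q k (t k - τ k) = poleTerm Q k (t k) - poleTerm Q k (τ k) := fun k => by
    simp only [poleTerm]; ring
  simp only [d_apply, h, derivative_sub, sub_divByMonic hQ, sub_modByMonic]
  ring

lemma frac_eq_zero_of_natDegree_lt (hQ : (toSeries Q).Monic) {g : ℕ}
    (hdeg : (toSeries Q).natDegree = 2 * g + 1) (B : (PowerSeries K)[X]) {m k : ℤ}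
    (hk : m.natAbs + 2 * (B.natDegree + 1) < k.natAbs) : frac Q B m k = 0 := by
  rcases frac_cases m k with h | h | ⟨j, rfl⟩
  · exact frac_of_lt _ h
  · exact frac_of_not_even _ h
  · have hj : B.natDegree < j := by omega
    rw [frac_sub_two_mul, divByMonic_pow_eq_zero hQ (d := 2 * g + 1) hdeg.ge, zero_modByMonic]
    nlinarith

lemma exists_mem_gauss_coe [IsUltrametricDist K] (q : K[X]) :
    ∃ B : ℝ≥0, (q : PowerSeries K) ∈ gauss K B := by
  refine ⟨∑ i ∈ q.support, ‖q.coeff i‖₊, coe_mem_gauss fun n => ?_⟩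
  by_cases hn : q.coeff n = 0
  · rw [hn]; exact (ball K _).zero_mem
  · exact Finset.single_le_sum (f := fun i => ‖q.coeff i‖₊) (fun i _ => zero_le)
      (mem_support_iff.2 hn)

lemma exists_toSeries_mem_pgauss [IsUltrametricDist K] (G : K[X][X]) :
    ∃ B : ℝ≥0, toSeries G ∈ pgauss K B := by
  choose B hB using fun i => exists_mem_gauss_coe (G.coeff i)
  refine ⟨∑ i ∈ G.support, B i, fun n => ?_⟩
  rw [toSeries, coeff_map]
  by_cases hn : G.coeff n = 0
  · rw [hn, map_zero]; exact (gauss K _).zero_mem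
  · exact gauss_mono (Finset.single_le_sum (f := B) (fun i _ => zero_le)
      (mem_support_iff.2 hn)) (hB n)

lemma IsFamily.isUnitPoly_unitPart_res [IsUltrametricDist K] [CharZero K] {g : ℕ}
    (hQ : IsFamily g Q) : IsUnitPoly (unitPart (res Q)) :=
  isUnitPoly_unitPart (fun n => hQ.res_mem_integralPoly n)
    (by rw [coeff_zero_eq_eval_zero]; exact hQ.res_zero)

/-- The coefficients of an element of `T` decrease geometrically. -/
lemma exists_mem_pgauss_of_mem_T [IsUltrametricDist K] {g : ℕ} (hR : IsUnitPoly (unitPart (res Q)))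
    {t : ℤ → (PowerSeries K)[X]} (ht : t ∈ T g Q) :
    ∃ B θ : ℝ≥0, θ < 1 ∧ ∀ k, t k ∈ pgauss K (B * θ ^ k.natAbs) := by
  obtain ⟨-, C₀, θ, h0, h1, h⟩ := ht
  have hC : 0 ≤ C₀ := by
    obtain ⟨a, b, hex⟩ := h 0 0
    simpa using hex.const_nonneg
  refine ⟨⟨C₀, hC⟩, ⟨θ, h0.le⟩, by exact_mod_cast h1, fun k m => ?_⟩
  obtain ⟨a, b, hex⟩ := h k m
  have hle : ∀ j : ℕ, C₀ * θ ^ k.natAbs * θ ^ j ≤ C₀ * θ ^ k.natAbs := fun j =>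
    mul_le_of_le_one_right (by positivity) (pow_le_one₀ h0.le h1.le)
  exact hex.mem_gauss hR (fun i => (hex.norm_a_le i).trans (hle i))
    (fun j m => (hex.norm_b_le j m).trans (hle (j + 1)))

end Differential

/-! ### Gain in precision against pole order. -/

section Estimates

lemma three_mul_le_pow {p : ℕ} (hp : 3 ≤ p) (n : ℕ) :
    3 * (p * (2 * n + 1) + 2) ≤ p ^ (n + 3) := by
  have h9 : 9 * p ≤ p ^ 3 := by nlinarith [Nat.mul_le_mul hp hp]
  induction n with
  | zero => simp only [mul_zero, zero_add, mul_one]; linarith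
  | succ n ih =>
    have h1 : p ^ 3 ≤ p ^ (n + 3) := Nat.pow_le_pow_right (by omega) (by omega)
    have h2 : 3 * p ^ (n + 3) ≤ p ^ (n + 3) * p := by nlinarith
    rw [show n + 1 + 3 = n + 3 + 1 by ring, pow_succ]
    nlinarith

/-- The loss on the `n`-th term exceeds its gain `p^(n+1)` by at most `g p^2`, uniformly in `n`;
this is where the bound `-(log_p g + 2)` comes from. -/
lemma mul_le_mul_sq_mul_pow {p g : ℕ} (hp : 3 ≤ p) (hg : 1 ≤ g) (n : ℕ) :
    (2 * g + 1) * (p * (2 * n + 1) + 2) ≤ g * p ^ 2 * p ^ (n + 1) := by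
  calc _ ≤ (3 * g) * (p * (2 * n + 1) + 2) := Nat.mul_le_mul_right _ (by omega)
    _ = g * (3 * (p * (2 * n + 1) + 2)) := by ring
    _ ≤ g * p ^ (n + 3) := Nat.mul_le_mul_left _ (three_mul_le_pow hp n)
    _ = _ := by ring

lemma six_mul_sq_le_pow (M : ℕ) : 6 * (2 * M + 5) ^ 2 ≤ 3 ^ (M + 6) := by
  induction M with
  | zero => norm_num
  | succ M ih =>
    calc 6 * (2 * (M + 1) + 5) ^ 2
        ≤ 6 * (2 * (M + 1) + 5) ^ 2 + (48 * M ^ 2 + 192 * M + 156) := Nat.le_add_right _ _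
      _ = 6 * (2 * M + 5) ^ 2 * 3 := by ring
      _ ≤ 3 ^ (M + 6) * 3 := Nat.mul_le_mul_right _ ih

/-- The inequality `pg ≤ 2N+4` removes `g` and `p` from the loss, leaving something quadratic in
`n`. With `n = 2N+5+m` this is at most `p^(N+m+6)`, and the factor `p^N` completes it to `p^(n+1)`.
-/
lemma mul_mul_pow_le_pow {p g N n : ℕ} (hp : 3 ≤ p) (hg : 1 ≤ g) (hN : p * g ≤ 2 * N + 4)
    (hn : 2 * N + 5 ≤ n) : (2 * g + 1) * (p * (2 * n + 1) + 2) * p ^ N ≤ p ^ (n + 1) := by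
  obtain ⟨m, rfl⟩ := Nat.exists_eq_add_of_le hn
  set n := 2 * N + 5 + m with hnd
  have h1 : p ≤ p * g := Nat.le_mul_of_pos_right _ hg
  have h2 : 3 * g ≤ p * g := Nat.mul_le_mul_right _ hp
  have h3 : (2 * g + 1) * p ≤ 3 * n := by nlinarith
  have h4 : (2 * g + 1) * (p * (2 * n + 1) + 2) ≤ 6 * (2 * (N + m) + 5) ^ 2 := by
    have h5 : (2 * g + 1) * p ≤ 3 * n - 3 := by
      have : (2 * g + 1) * p = 2 * (p * g) + p := by ring
      omega
    have h6 : 2 * (2 * g + 1) ≤ 2 * n - 2 := by omega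
    have h7 : n ≤ 2 * (N + m) + 5 := by omega
    calc (2 * g + 1) * (p * (2 * n + 1) + 2)
        = (2 * g + 1) * p * (2 * n + 1) + 2 * (2 * g + 1) := by ring
      _ ≤ (3 * n - 3) * (2 * n + 1) + (2 * n - 2) :=
          add_le_add (Nat.mul_le_mul_right _ h5) h6
      _ ≤ 6 * n ^ 2 := by
          obtain ⟨n', hn'⟩ := Nat.exists_eq_add_of_le (show 1 ≤ n by omega)
          rw [hn', show 3 * (1 + n') - 3 = 3 * n' by omega, show 2 * (1 + n') - 2 = 2 * n' by omega]
          nlinarith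
      _ ≤ _ := Nat.mul_le_mul_left _ (Nat.pow_le_pow_left h7 2)
  calc _ ≤ 3 ^ (N + m + 6) * p ^ N := Nat.mul_le_mul_right _ (h4.trans (six_mul_sq_le_pow _))
    _ ≤ p ^ (N + m + 6) * p ^ N := Nat.mul_le_mul_right _ (Nat.pow_le_pow_left hp _)
    _ = p ^ (n + 1) := by rw [← pow_add, hnd]; congr 1; ring

end Estimates

/-! ### Approximation of the entries of the Frobenius matrix. -/

section Matrix

variable {p : ℕ} [Fact p.Prime] {K : Type*} [NormedField K] [NormedAlgebra ℚ_[p] K]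
  [IsUltrametricDist K] [CompleteSpace K] {σ : K ≃ₐ[ℚ_[p]] K} {g : ℕ} {Q : K[X][X]}

/-- Since the `n`-th term reaches only `|k| ≤ p(2n+1)`, its norm satisfies the `k`-dependent bound
demanded by the reduction as soon as the numerical inequality `hβ` holds. -/
lemma IsFamily.frob_sub_sum_mem_pgauss_div (hQ : IsFamily g Q) (hp : p ≠ 2)
    (hK : IsUnramified p K) (hσ : IsFrobenius p σ) {i : ℕ} (hi : i < 2 * g) {n₁ : ℕ} {β : ℝ≥0}
    (hβ : ∀ n, n₁ ≤ n → ((2 * g + 1) * (p * (2 * n + 1) + 2) : ℕ) ≤ β * (p : ℝ≥0) ^ (n + 1))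
    (k : ℤ) :
    frob p g σ Q (basisForm i) k - ∑ n ∈ Finset.range n₁,
      frac Q (toSeries (frobNum p σ Q i n)) (p * (2 * n + 1 : ℕ)) k ∈
      pgauss K (β / ((2 * g + 1) * (k.natAbs + 2) : ℕ)) := by
  refine hQ.frob_sub_sum_mem_pgauss hp hK hσ k n₁ fun n hn => ?_
  by_cases hk : p * (2 * n + 1) < k.natAbs
  · rw [hQ.frac_frobNum_eq_zero hi n hk]; exact (pgauss K _).zero_mem
  · refine pgauss_mono ?_ (frac_mem_pgauss hQ.monic_toSeries hQ.toSeries_mem_pgauss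
      (frobNum_mem_pgauss hp hK hσ hQ.coeff_mem_integralPoly i n) _ k)
    have hp0 : (0 : ℝ≥0) < p := by exact_mod_cast (Fact.out : p.Prime).pos
    have h1 : (((2 * g + 1) * (k.natAbs + 2) : ℕ) : ℝ≥0) ≤ β * (p : ℝ≥0) ^ (n + 1) := by
      refine le_trans ?_ (hβ n hn)
      exact_mod_cast Nat.mul_le_mul_left _ (by omega)
    rw [le_div_iff₀ (by positivity), inv_pow, inv_mul_le_iff₀ (by positivity), mul_comm (_ ^ _) β]
    exact h1

/-- Entries of the Frobenius matrix can be computed up to a given precision from finitely many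
terms of the series that defines the Frobenius lift. -/
lemma IsFrobeniusMatrix.sub_mem_gauss {F : Matrix (Fin (2 * g)) (Fin (2 * g)) (PowerSeries K)}
    (hF : IsFrobeniusMatrix p g σ Q F) (hQ : IsFamily g Q) (hp : p ≠ 2) (hK : IsUnramified p K)
    (hσ : IsFrobenius p σ) (i : Fin (2 * g)) {n₁ : ℕ} {β : ℝ≥0} (hβ0 : 0 < β)
    (hβ : ∀ n, n₁ ≤ n → ((2 * g + 1) * (p * (2 * n + 1) + 2) : ℕ) ≤ β * (p : ℝ≥0) ^ (n + 1))
    {Λ : Fin (2 * g) → PowerSeries K} {τ : ℤ → (PowerSeries K)[X]} {B : ℝ≥0} {M : ℕ}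
    (hτ : ∀ k, (τ k).natDegree ≤ 2 * g) (hτB : ∀ k, τ k ∈ pgauss K B)
    (hτM : ∀ k : ℤ, M < k.natAbs → τ k = 0)
    (hU : ∀ k, ∑ n ∈ Finset.range n₁,
      frac Q (toSeries (frobNum p σ Q i n)) (p * (2 * n + 1 : ℕ)) k =
      ∑ l : Fin (2 * g), C (Λ l) * basisForm (l : ℕ) k + d Q τ k) (l : Fin (2 * g)) :
    F i l - Λ l ∈ gauss K β := by
  have := charZero_of_normedAlgebra_padic p K
  obtain ⟨t, ⟨ht, -⟩, hFt⟩ := hF.frob_eq i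
  obtain ⟨B', θ, hθ, htB⟩ := exists_mem_pgauss_of_mem_T hQ.isUnitPoly_unitPart_res ht
  obtain ⟨b, hb1, hb⟩ := hQ.exists_inverse_derivative
  -- Made positive, so that the bounded, finitely supported `τ` also satisfies a geometric bound,
  -- with constant `B / θ'^M`.
  set θ' : ℝ≥0 := max θ (1 / 2) with hθ'
  have hθ'0 : 0 < θ' := lt_max_of_lt_right (by norm_num)
  have hθ'1 : θ' < 1 := max_lt hθ (by
    rw [← NNReal.coe_lt_coe]; norm_num)
  -- Applied to the difference of the two reductions: the tail of the Frobenius series is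
  -- represented by `F i - Λ`, with primitive `t - τ`.
  refine mem_gauss_of_eq_add_d (fun j hj => nnnorm_natCast_inv_le p K hj) (nnnorm_two_inv_le p K hp)
    hQ.monic_toSeries hQ.toSeries_mem_pgauss hQ.natDegree_toSeries hb1 hb hβ0
    (t := fun k => t k - τ k) (B := B' + B / θ' ^ M) hθ'1
    (fun k => (natDegree_sub_le_of_le (ht.1 k) (hτ k)).trans (max_self _).le) (fun k => ?_)
    (hQ.frob_sub_sum_mem_pgauss_div hp hK hσ i.2 hβ) (c := fun l => F i l - Λ l) (fun k => ?_) l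
  · refine (pgauss K _).sub_mem (pgauss_mono ?_ (htB k)) ?_
    · exact mul_le_mul' le_self_add (pow_le_pow_left₀ zero_le (le_max_left _ _) _)
    · by_cases hk : M < k.natAbs
      · rw [hτM k hk]; exact (pgauss K _).zero_mem
      · refine pgauss_mono ?_ (hτB k)
        have h1 : θ' ^ M ≤ θ' ^ k.natAbs :=
          pow_le_pow_of_le_one zero_le hθ'1.le (not_lt.1 hk)
        calc B = B / θ' ^ M * θ' ^ M := (div_mul_cancel₀ _ (pow_pos hθ'0 _).ne').symm
          _ ≤ _ := mul_le_mul' le_add_self h1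
  · rw [hFt, hU, d_sub hQ.monic_toSeries]
    simp only [C_sub, sub_mul, Finset.sum_sub_distrib]
    ring

/-- The comparison with the empty partial sum, where the whole series is tail. -/
lemma IsFrobeniusMatrix.mem_gauss {F : Matrix (Fin (2 * g)) (Fin (2 * g)) (PowerSeries K)}
    (hF : IsFrobeniusMatrix p g σ Q F) (hQ : IsFamily g Q) (hg : 1 ≤ g) (hp : p ≠ 2)
    (hK : IsUnramified p K) (hσ : IsFrobenius p σ) (i l : Fin (2 * g)) :
    F i l ∈ gauss K (g * (p : ℝ≥0) ^ 2) := by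
  have hp3 : 3 ≤ p := (Fact.out : p.Prime).two_le.lt_of_ne hp.symm
  have hg0 : (0 : ℝ≥0) < g := by exact_mod_cast hg
  have hp0 : (0 : ℝ≥0) < p := by exact_mod_cast (by omega : 0 < p)
  have := hF.sub_mem_gauss hQ hp hK hσ i (n₁ := 0) (β := g * (p : ℝ≥0) ^ 2) (by positivity)
    (fun n _ => by exact_mod_cast mul_le_mul_sq_mul_pow hp3 hg n) (Λ := 0) (τ := 0) (B := 0) (M := 0)
    (fun k => by simp) (fun k => (pgauss K _).zero_mem) (fun k _ => rfl)
    (fun k => by simp [d]) l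
  simpa using this

/-- The terms `n ≤ n₀` are brought over `√Q^(2s+1)`. The numerators then have the same weight bound,
because `Q^p` and the error term have the same one. Reducing `r^s U` gives polynomial coordinates
`c`, and dividing by `r^s` in `K⟦Γ⟧` gives an approximation of `F i l`. Multiplying back by the
integral `r^s` preserves the precision. -/
lemma IsFrobeniusMatrix.exists_polynomial
    {F : Matrix (Fin (2 * g)) (Fin (2 * g)) (PowerSeries K)}
    (hF : IsFrobeniusMatrix p g σ Q F) (hQ : IsFamily g Q) (hg : 1 ≤ g) (hp : p ≠ 2)
    (hK : IsUnramified p K) (hσ : IsFrobenius p σ) {N n₀ s : ℕ} (hN : p * g ≤ 2 * N + 4)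
    (hn₀ : 2 * N + 4 ≤ n₀) (hs : 2 * s + 1 = p * (2 * n₀ + 1)) (i l : Fin (2 * g)) :
    ∃ P : K[X], P.natDegree ≤ s * ((4 * g + 1) * degΓ Q) +
        degΓ Q * (p * i + (p - 1) + n₀ * (p * (2 * g + 1))) ∧
      (res Q : PowerSeries K) ^ s * F i l - P ∈ gauss K ((p : ℝ≥0)⁻¹ ^ N) := by
  have := charZero_of_normedAlgebra_padic p K
  have hp3 : 3 ≤ p := (Fact.out : p.Prime).two_le.lt_of_ne hp.symm
  have hp0 : (0 : ℝ≥0) < p := by exact_mod_cast (by omega : 0 < p)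
  set W := degΓ Q * (p * i + (p - 1) + n₀ * (p * (2 * g + 1))) with hW
  set U : K[X][X] := ∑ n ∈ Finset.range (n₀ + 1), Q ^ (p * (n₀ - n)) * frobNum p σ Q i n with hUd
  have hUW : U ∈ weight K (degΓ Q) W := by
    refine (weight K _ _).sum_mem fun n hn => ?_
    have hn := Nat.lt_succ_iff.1 (Finset.mem_range.1 hn)
    obtain ⟨m, rfl⟩ := Nat.exists_eq_add_of_le hn
    refine weight_mono (le_of_eq ?_)
      (mul_mem_weight (pow_mem_weight hQ.mem_weight _) (hQ.frobNum_mem_weight n))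
    rw [hW, Nat.add_sub_cancel_left]
    push_cast
    ring
  obtain ⟨c, G, hc, hcW, hcG⟩ := hQ.exists_reduction hUW s
  set ρ := (res Q : PowerSeries K)⁻¹ with hρ
  have hρr : (res Q : PowerSeries K) ^ s * ρ ^ s = 1 := by
    rw [← mul_pow, hQ.res_mul_inv, one_pow]
  have hUeq : toSeries U = toSeries Q ^ s * (C (ρ ^ s) * toSeries c) +
      conn (toSeries Q) (PowerSeries.C ((s : K) - 1 / 2)) (C (ρ ^ s) * toSeries G) := by
    have h1 := congrArg (Polynomial.map (coeToPowerSeries.ringHom (R := K))) hcG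
    rw [Polynomial.map_add, Polynomial.map_mul, Polynomial.map_mul, Polynomial.map_pow, map_C,
      conn_map, map_pow] at h1
    simp only [coeToPowerSeries.ringHom_apply, coe_C] at h1
    have h2 : C (ρ ^ s) * C ((res Q : PowerSeries K) ^ s) = 1 := by
      rw [← C_mul, mul_comm, hρr, C_1]
    rw [conn_C_mul]
    simp only [toSeries]
    linear_combination C (ρ ^ s) * h1 - U.map coeToPowerSeries.ringHom * h2
  have hdegc : (C (ρ ^ s) * toSeries c).degree < (2 * g : ℕ) := by
    rw [← smul_eq_C_mul]
    exact (degree_smul_le _ _).trans_lt (degree_map_le.trans_lt hc)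
  obtain ⟨B, hB⟩ := exists_toSeries_mem_pgauss G
  have hBG : C (ρ ^ s) * toSeries G ∈ pgauss K B :=
    mul_mem_pgauss_of_left (C_mem_pgauss (by
      simpa using pow_mem_gauss hQ.res_inv_mem_gauss s)) hB
  have hmem := hF.sub_mem_gauss hQ hp hK hσ i (n₁ := n₀ + 1) (β := (p : ℝ≥0)⁻¹ ^ N)
    (by positivity) (fun n hn => ?_) (Λ := fun l => (C (ρ ^ s) * toSeries c).coeff l)
    (τ := frac Q (C (ρ ^ s) * toSeries G) (2 * s - 1))
    (fun k => natDegree_frac_le hQ.monic_toSeries hQ.natDegree_toSeries _ _ _)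
    (fun k => frac_mem_pgauss hQ.monic_toSeries hQ.toSeries_mem_pgauss hBG _ k)
    (fun k hk => frac_eq_zero_of_natDegree_lt hQ.monic_toSeries hQ.natDegree_toSeries _ hk)
    (fun k => ?_) l
  · refine ⟨c.coeff l, hcW l, ?_⟩
    have h1 : toSeries c = c.map coeToPowerSeries.ringHom := rfl
    have h2 : (res Q : PowerSeries K) ^ s * F i l - (c.coeff l : K[X]) =
        (res Q : PowerSeries K) ^ s * (F i l - (C (ρ ^ s) * toSeries c).coeff l) := by
      rw [coeff_C_mul, h1, coeff_map, coeToPowerSeries.ringHom_apply]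
      linear_combination (c.coeff l : PowerSeries K) * hρr
    rw [h2]
    have h3 := mul_mem_gauss (pow_mem_gauss hQ.res_coe_mem_gauss s) hmem
    rwa [one_mul] at h3
  · rw [inv_pow, ← div_eq_inv_mul, le_div_iff₀ (by positivity)]
    exact_mod_cast mul_mul_pow_le_pow hp3 hg hN (by omega)
  · rw [← frac_eq_sum_add_d hQ.monic_toSeries hQ.natDegree_toSeries hdegc hUeq, hUd]
    have h1 : toSeries (∑ n ∈ Finset.range (n₀ + 1), Q ^ (p * (n₀ - n)) * frobNum p σ Q i n) =
        ∑ n ∈ Finset.range (n₀ + 1),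
          toSeries Q ^ (p * (n₀ - n)) * toSeries (frobNum p σ Q i n) := by
      simp [toSeries, Polynomial.map_sum]
    rw [h1, frac_sum hQ.monic_toSeries]
    refine Finset.sum_congr rfl fun n hn => ?_
    have hn := Nat.lt_succ_iff.1 (Finset.mem_range.1 hn)
    obtain ⟨m, rfl⟩ := Nat.exists_eq_add_of_le hn
    rw [← frac_pow_mul hQ.monic_toSeries _ _ (p * m), Nat.add_sub_cancel_left]
    congr 1
    zify at hs
    push_cast
    linear_combination -hs

end Matrix

/-! ### Conclusion: the degree bound and the order of the entries. -/

section Main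

variable {p : ℕ} [Fact p.Prime] {K : Type*} [NormedField K] [NormedAlgebra ℚ_[p] K]
  [FiniteDimensional ℚ_[p] K] {σ : K ≃ₐ[ℚ_[p]] K} {g : ℕ} {Q : K[X][X]}
  {F : Matrix (Fin (2 * g)) (Fin (2 * g)) (PowerSeries K)}

lemma IsFrobeniusMatrix.exists_congrModPow (hF : IsFrobeniusMatrix p g σ Q F) (hQ : IsFamily g Q)
    (hg : 1 ≤ g) (hp : p ≠ 2) (hK : IsUnramified p K) (hσ : IsFrobenius p σ) {N : ℕ}
    (hN : ((p : ℝ) * g - 4) / 2 ≤ N) (i l : Fin (2 * g)) {f : PowerSeries K}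
    (hf : f ∈ S (unitPart (res Q))) (hfF : CongrModPow p (unitPart (res Q)) N f (F i l)) {χ₁ : ℕ}
    (hχ₁ : χ₁ = p * (2 * N + 4) + (p - 1) / 2) :
    ∃ P : K[X], P.natDegree ≤ (2 * N + 5) * (8 * g + 2) * degΓ Q * p + 1 ∧
      CongrModPow p (unitPart (res Q)) N ((res Q : PowerSeries K) ^ χ₁ * f) (P : PowerSeries K) := by
  have := charZero_of_normedAlgebra_padic p K
  have := isUltrametricDist_of_normedAlgebra_padic p K
  have : CompleteSpace K := FiniteDimensional.complete ℚ_[p] K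
  have hu := hQ.isUnitPoly_unitPart_res
  have hodd : Odd p := (Fact.out : p.Prime).odd_of_ne_two hp
  have hFN := mem_gauss_of_ordGE hu hfF
  have hN' : p * g ≤ 2 * N + 4 := by
    have h1 : (p : ℝ) * g ≤ 2 * N + 4 := by linarith
    exact_mod_cast h1
  -- The exponent `χ₁` is determined by the pole order `p(2n₀+1)` of the last term kept, with `n₀ =
  -- 2N+4`; `p` is odd.
  have hs : 2 * χ₁ + 1 = p * (2 * (2 * N + 4) + 1) := by
    obtain ⟨m, rfl⟩ := hodd
    rw [hχ₁, Nat.add_sub_cancel, Nat.mul_div_cancel_left _ two_pos]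
    ring
  obtain ⟨P, hP, hPF⟩ := hF.exists_polynomial hQ hg hp hK hσ hN' le_rfl hs i l
  refine ⟨P, hP.trans ?_, ?_⟩
  · have h1 : χ₁ ≤ p * (2 * N + 5) := by nlinarith
    have h2 : p * i + (p - 1) ≤ p * (2 * g) := by
      have := Nat.mul_le_mul_left p (Nat.succ_le_of_lt i.2)
      rw [Nat.mul_succ] at this
      omega
    calc χ₁ * ((4 * g + 1) * degΓ Q) +
          degΓ Q * (p * i + (p - 1) + (2 * N + 4) * (p * (2 * g + 1)))
        ≤ p * (2 * N + 5) * ((4 * g + 1) * degΓ Q) +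
          degΓ Q * (p * (2 * g) + (2 * N + 4) * (p * (2 * g + 1))) :=
          add_le_add (Nat.mul_le_mul_right _ h1)
            (Nat.mul_le_mul_left _ (Nat.add_le_add_right h2 _))
      _ = degΓ Q * p * ((2 * N + 5) * (4 * g + 1) + (2 * g + (2 * N + 4) * (2 * g + 1))) := by
          ring
      _ ≤ degΓ Q * p * ((2 * N + 5) * (8 * g + 2)) :=
          Nat.mul_le_mul_left _ (by nlinarith [Nat.zero_le (N * g)])
      _ ≤ _ := (le_of_eq (by ring)).trans (Nat.le_succ _)
  · have e : (res Q : PowerSeries K) ^ χ₁ = ((res Q ^ χ₁ : K[X]) : PowerSeries K) := by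
      rw [coe_pow]
    refine ordGE_of_mem_gauss hu ?_ ?_
    · rw [e]
      exact sub_mem_S (coe_mul_mem_S hu _ hf) (coe_mem_S P)
    · have h1 : (p : ℝ≥0)⁻¹ ^ N = (p : ℝ≥0) ^ (-(N : ℝ)) := by
        rw [NNReal.rpow_neg, NNReal.rpow_natCast, inv_pow]
      rw [h1] at hPF
      have h2 := mul_mem_gauss (pow_mem_gauss hQ.res_coe_mem_gauss χ₁) hFN
      rw [one_mul] at h2
      have h3 := (gauss K _).add_mem h2 hPF
      convert h3 using 1
      ring

lemma IsFrobeniusMatrix.ordGE (hF : IsFrobeniusMatrix p g σ Q F) (hQ : IsFamily g Q)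
    (hg : 1 ≤ g) (hp : p ≠ 2) (hK : IsUnramified p K) (hσ : IsFrobenius p σ) {N : ℕ}
    (i l : Fin (2 * g)) {f : PowerSeries K} (hf : f ∈ S (unitPart (res Q)))
    (hfF : CongrModPow p (unitPart (res Q)) N f (F i l)) :
    OrdGE p (unitPart (res Q)) (-(Real.logb p g + 2)) f := by
  have := charZero_of_normedAlgebra_padic p K
  have := isUltrametricDist_of_normedAlgebra_padic p K
  have : CompleteSpace K := FiniteDimensional.complete ℚ_[p] K
  have hu := hQ.isUnitPoly_unitPart_res
  have hp3 : 3 ≤ p := (Fact.out : p.Prime).two_le.lt_of_ne hp.symm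
  have hp0 : (0 : ℝ) < p := by exact_mod_cast (by omega : 0 < p)
  have hFN := mem_gauss_of_ordGE hu hfF
  refine ordGE_of_mem_gauss hu hf ?_
  have h1 := hF.mem_gauss hQ hg hp hK hσ i l
  have hgp : g * (p : ℝ≥0) ^ 2 = (p : ℝ≥0) ^ (-(-(Real.logb p g + 2))) := by
    rw [← NNReal.coe_inj, neg_neg]
    push_cast
    rw [Real.rpow_add hp0, Real.rpow_logb hp0 (by exact_mod_cast (by omega : p ≠ 1))
      (by exact_mod_cast hg)]
    norm_num
  -- Passing from the entry to its reduction `f` changes it by at most `p^-N ≤ 1`, which does not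
  -- affect the bound.
  have hN1 : (p : ℝ≥0) ^ (-(N : ℝ)) ≤ g * (p : ℝ≥0) ^ 2 := by
    have hp1 : (1 : ℝ≥0) ≤ p := by exact_mod_cast (by omega : 1 ≤ p)
    have hg1 : (1 : ℝ≥0) ≤ g := by exact_mod_cast hg
    exact (NNReal.rpow_le_one_of_one_le_of_nonpos hp1 (by simp)).trans
      (one_le_mul_of_one_le_of_one_le hg1 (one_le_pow₀ hp1))
  rw [← hgp]
  have h2 := (gauss K _).add_mem (gauss_mono hN1 hFN) h1
  rwa [sub_add_cancel] at h2

end Main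

end

end HyperellipticFamily

theorem mainTheorem4 (p : ℕ) [Fact p.Prime] (hp : p ≠ 2) (g : ℕ) (hg : 1 ≤ g)
    {K : Type*} [NormedField K] [NormedAlgebra ℚ_[p] K] [FiniteDimensional ℚ_[p] K]
    (hK : HyperellipticFamily.IsUnramified p K)
    (σ : K ≃ₐ[ℚ_[p]] K) (hσ : HyperellipticFamily.IsFrobenius p σ)
    (Q : Polynomial (Polynomial K)) (hQ : HyperellipticFamily.IsFamily g Q)
    (r R : Polynomial K) (hr : r = HyperellipticFamily.res Q)
    (hR : R = HyperellipticFamily.unitPart r)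
    (κ : ℕ) (hκ : κ = HyperellipticFamily.degΓ Q)
    (F : Matrix (Fin (2 * g)) (Fin (2 * g)) (PowerSeries K))
    (hF : HyperellipticFamily.IsFrobeniusMatrix p g σ Q F)
    (N : ℕ) (hN : ((p : ℝ) * g - 4) / 2 ≤ N)
    (i l : Fin (2 * g)) (f : PowerSeries K) (hf : f ∈ HyperellipticFamily.S R)
    (hfF : HyperellipticFamily.CongrModPow p R N f (F i l))
    (χ₁ χ₂ : ℕ) (hχ₁ : χ₁ = p * (2 * N + 4) + (p - 1) / 2)
    (hχ₂ : χ₂ = (2 * N + 5) * (8 * g + 2) * κ * p + 1) :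
    (∃ P : Polynomial K, P.natDegree ≤ χ₂ ∧
      HyperellipticFamily.CongrModPow p R N ((r : PowerSeries K) ^ χ₁ * f) (P : PowerSeries K)) ∧
    HyperellipticFamily.OrdGE p R (-(Real.logb p g + 2)) f := by
  subst hr hR hκ hχ₂
  exact ⟨hF.exists_congrModPow hQ hg hp hK hσ hN i l hf hfF hχ₁, hF.ordGE hQ hg hp hK hσ i l hf hfF⟩
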